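/- Let $\mathbb S=\mathbb R/\mathbb Z$. Let $f:\mathbb S\to\mathbb S$ be a continuous weakly order-preserving map of degree one with a flat interval $U_f=(a,b)$ (a non-degenerate open arc), such that: the derivative of $f$ exists everywhere, is zero on $\overline{U_f}$ and positive elsewhere; $f$ is $C^2$ except at $a$ and $b$; and, for some $\ell>0$, $f(x)=h_r((x-b)^\ell)$ on a right-sided neighbourhood of $b$ and $f(x)=h_l((a-x)^\ell)$ on a left-sided neighbourhood of $a$, where $h_r,h_l$ are $C^2$-diffeomorphisms of an open neighbourhood of $0$ onto their images. Write $f^{i}$ also for $f^{i}(U_f)$ and $f^{-i}$ for the preimage $(f^{i})^{-1}(U_f)$, $i\ge 0$. Assume that $f$ belongs to the class $\mathscr B$: the rotation number $\rho=1/(a_1+1/(a_2+\cdots))$ of $f$ is irrational and of bounded type ($\sup_n a_n<\infty$), and, with $q_n$ the denominator of the $n$-th convergent of $\rho$ ($q_0=1$, $q_1=a_1$), $f$ has bounded geometry, i.e. the scalings $|f^0,f^{q_n}|/|f^0,f^{q_{n-2}}|$, $n\ge2$, are bounded away from zero, where $|\cdot,\cdot|$ is the distance on $\mathbb S$. The preimages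 of $U_f$ in the $n$-th dynamical partition $\mathcal F_n$ are the arcs $f^{-i}$ with $0\le i\le q_{n+1}+q_n-1$. Let $Q>0$. The restriction of $f^i$ to $P=f^{-i}$ is called $Q$-quasi-symmetric if $|f^i(I)|\le Q\,|f^i(J)|$ for all intervals $I,J\subset P$ of equal length which are adjacent (i.e. have a common endpoint and disjoint interiors). Then for every $Q>0$ there is $N=N(f,Q)$ such that for all $n\ge N$ and every preimage $P=f^{-i}$ of the flat interval belonging to $\mathcal F_n$ with $i\ge q_n$, the restriction $f^i|_P$ is not $Q$-quasi-symmetric. In particular, the maps $f^i|_{f^{-i}}$, $i\ge0$, are not quasi-symmetric with a common constant. -/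

import Mathlib

open Set Filter Topology MeasureTheory

noncomputable section

namespace FlatCircle

/-- The class of continuous weakly order-preserving degree one circle maps with a flat interval.
The circle is `ℝ / ℤ`, the map is `f`, `F` is a lift of `f` to the real line, `Ioo a b` is a lift
of the flat interval and `ℓ` is the critical exponent. -/
structure IsFlatMap (f : UnitAddCircle → UnitAddCircle) (F : CircleDeg1Lift) (a b ℓ : ℝ) :
    Prop where
  continuous_map : Continuous f
  continuous_lift : Continuous F
  lift : ∀ x : ℝ, f (x : UnitAddCircle) = ((F x : ℝ) : UnitAddCircle)
  lt : a < b
  lt_add_one : b < a + 1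
  /-- The first derivative vanishes on the closure of the flat interval … -/
  flat : ∀ x ∈ Icc a b, HasDerivAt F 0 x
  /-- … and is positive everywhere else. -/
  deriv_pos : ∀ x ∈ Ioo b (a + 1), 0 < deriv F x
  /-- The map is twice continuously differentiable off the two endpoints `a`, `b`. -/
  contDiff_inside : ContDiffOn ℝ 2 F (Ioo a b)
  contDiff_outside : ContDiffOn ℝ 2 F (Ioo b (a + 1))
  exponent_pos : 0 < ℓ
  /-- To the right of `b` the map is `h ((x - b) ^ ℓ)` for a `C²` diffeomorphism `h` between open
  sets, the source of which contains `0`. -/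
  right_end : ∃ h : OpenPartialHomeomorph ℝ ℝ, (0 : ℝ) ∈ h.source ∧
    ContDiffOn ℝ 2 h h.source ∧ ContDiffOn ℝ 2 h.symm h.target ∧
    ∀ᶠ x in 𝓝[≥] b, F x = h ((x - b) ^ ℓ)
  /-- The analogous form to the left of `a`. -/
  left_end : ∃ h : OpenPartialHomeomorph ℝ ℝ, (0 : ℝ) ∈ h.source ∧
    ContDiffOn ℝ 2 h h.source ∧ ContDiffOn ℝ 2 h.symm h.target ∧
    ∀ᶠ x in 𝓝[≤] a, F x = h ((a - x) ^ ℓ)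

/-- The arc of the circle covered by the real interval `[x, y]`. -/
def arc (x y : ℝ) : Set UnitAddCircle := (fun t : ℝ => (t : UnitAddCircle)) '' Icc x y

/-- The flat interval `U`, an open arc of the circle. -/
def flatInterval (a b : ℝ) : Set UnitAddCircle := (fun t : ℝ => (t : UnitAddCircle)) '' Ioo a b

/-- The length of a subset of the circle (total length one). -/
def len (S : Set UnitAddCircle) : ℝ := (volume : Measure UnitAddCircle).real S

/-- The preimage `f^{-i}` of the flat interval. -/
def preim (f : UnitAddCircle → UnitAddCircle) (a b : ℝ) (i : ℕ) : Set UnitAddCircle :=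
  f^[i] ⁻¹' flatInterval a b

/-- The rotation number, normalised to lie in `[0, 1)`. -/
def rotationNumber (F : CircleDeg1Lift) : ℝ := Int.fract F.translationNumber

/-- `q ρ n` is the denominator, in lowest terms, of the `n`-th convergent of the continued fraction
`ρ = 1 / (a₁ + 1 / (a₂ + ⋯))`; thus `q ρ 0 = 1` and `q ρ 1 = a₁`. -/
def q (ρ : ℝ) (n : ℕ) : ℕ := (ρ.convergent n).den

/-- The partial quotients `a₁, a₂, …` of the continued fraction of `ρ` are bounded. -/
def BoundedType (ρ : ℝ) : Prop :=
  ∃ M : ℝ, 0 < M ∧ ∀ (n : ℕ) (c : ℝ), (GenContFract.of ρ).partDens.get? n = some c → c < M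

/-- `|f^0, f^k|`, the distance between the flat interval and its `k`-th image. For `k ≥ 1` that
image is the single point `f^k(a)`. -/
def imageDist (f : UnitAddCircle → UnitAddCircle) (a b : ℝ) (k : ℕ) : ℝ :=
  Metric.infDist (f^[k] (a : UnitAddCircle)) (flatInterval a b)

/-- The scalings `|f^0, f^{q_n}| / |f^0, f^{q_{n-2}}|`, `n ≥ 2`, are bounded away from zero. -/
def BoundedGeometry (f : UnitAddCircle → UnitAddCircle) (F : CircleDeg1Lift) (a b : ℝ) : Prop :=
  ∃ c : ℝ, 0 < c ∧ ∀ n : ℕ,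
    c ≤ imageDist f a b (q (rotationNumber F) (n + 2)) / imageDist f a b (q (rotationNumber F) n)

/-- The class `𝓑`: maps with a flat interval whose rotation number is irrational of bounded type
and which have bounded geometry. -/
structure IsClassB (f : UnitAddCircle → UnitAddCircle) (F : CircleDeg1Lift) (a b ℓ : ℝ) : Prop
    extends IsFlatMap f F a b ℓ where
  irrational : Irrational (rotationNumber F)
  boundedType : BoundedType (rotationNumber F)
  boundedGeometry : BoundedGeometry f F a b

/-- The preimages of the flat interval which belong to the `n`-th dynamical partition: the sets
`f^{-j}` with `0 ≤ j ≤ q_{n+1} + q_n - 1`. -/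
def partitionPreimages (f : UnitAddCircle → UnitAddCircle) (F : CircleDeg1Lift) (a b : ℝ) (n : ℕ) :
    Set (Set UnitAddCircle) :=
  {P | ∃ j : ℕ, j < q (rotationNumber F) (n + 1) + q (rotationNumber F) n ∧ P = preim f a b j}

/-- `φ` restricted to the arc `P` is `Q`-quasi-symmetric: for any two adjacent intervals of equal
length contained in `P`, the lengths of their images have ratio at most `Q` (in both orders).
For a homeomorphism of `P` onto its image this is the usual notion. -/
def IsQuasiSymmetricOn (Q : ℝ) (φ : UnitAddCircle → UnitAddCircle) (P : Set UnitAddCircle) : Prop :=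
  ∀ x h : ℝ, 0 < h → h ≤ 1 / 2 → arc (x - h) x ⊆ P → arc x (x + h) ⊆ P →
    len (φ '' arc (x - h) x) ≤ Q * len (φ '' arc x (x + h)) ∧
    len (φ '' arc x (x + h)) ≤ Q * len (φ '' arc (x - h) x)

end FlatCircle

end

noncomputable section

namespace FlatCircle

/-! ### Orbits of a lift with irrational translation number -/

/-! After one step the flat interval is a point, and its orbit is ordered on the line like an orbit
of the irrational rotation. Everything is therefore organised by the returns `F^[k] b - l`, which
lie to the left of `a` or to the right of `b` according to the sign of `k τ - l`, and in particular
by the closest ones (`FareyPair`, `IsReturnSequence`).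

The analytic tool is the cross-ratio |M| |T| / (|L| |R|). On `(b, a + 1)` the derivative of `F` is
exp(G) ((x - b)(a + 1 - x))^(ℓ - 1) with G Lipschitz. Vanishing of the derivative at `b` forces ℓ ≥
1, so the power is log-concave, and a map with log-concave derivative does not decrease
cross-ratios. Hence `F` lowers a cross-ratio at most by the factor exp(-C |T|). Along a piece of
orbit which avoids the flat interval and is cut out by closest returns, the lengths |T| have bounded
sum, so a bound on a cross-ratio can be pulled back with a uniform constant
(`crossRatio_pullback_left`, `crossRatio_pullback_right`).

This is used twice. First, let D > D' be consecutive return distances on one side, intermediate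
returns included, and call (D - D') / D' a step ratio. Bounded geometry bounds step ratios from
above; a lower bound is needed. `return_ratio_le` bounds a step ratio by a constant times the
product of the next one on the same side and one on the opposite side. If some step ratio were very
small, the opposite factor would be small too, so going back in time the ratios could only shrink;
with bounded type this gives a uniform positive lower bound (`exists_ratio_lower_bound`). In
particular return distances tend to zero.

Second, let q_n ≤ i < q_(n+1), and let D be the distance of the q_n-th return, say from the left.
The subinterval of f^{-i} lying over [a, a + D] is compared with all of f^{-i}: near the critical
value all relevant lengths are comparable by the first part, and the remaining iterates preserve
this up to a constant. So the subinterval is a definite proportion of f^{-i}, uniformly in i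
(`exists_portion`), while D → 0. A Q-quasi-symmetric map cannot do this: halving an end interval k
times divides the image length by at most (1 + Q)^k (`not_isQuasiSymmetricOn`). -/

lemma iterate_add_int (F : CircleDeg1Lift) (k : ℕ) (x : ℝ) (l : ℤ) :
    F^[k] (x + l) = F^[k] x + l := by
  rw [← CircleDeg1Lift.coe_pow, CircleDeg1Lift.map_add_int]

lemma iterate_sub_int (F : CircleDeg1Lift) (k : ℕ) (x : ℝ) (l : ℤ) :
    F^[k] (x - l) = F^[k] x - l := by
  rw [← CircleDeg1Lift.coe_pow, CircleDeg1Lift.map_sub_int]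

lemma monotone_iterate (F : CircleDeg1Lift) (k : ℕ) : Monotone F^[k] :=
  F.monotone.iterate k

lemma iterate_lt_add_int {F : CircleDeg1Lift} {k : ℕ} {l : ℤ}
    (h : k * F.translationNumber < l) (x : ℝ) : F^[k] x < x + l := by
  rw [← CircleDeg1Lift.coe_pow]
  apply CircleDeg1Lift.map_lt_of_translationNumber_lt_int
  rwa [CircleDeg1Lift.translationNumber_pow]

lemma add_int_lt_iterate {F : CircleDeg1Lift} {k : ℕ} {l : ℤ}
    (h : l < k * F.translationNumber) (x : ℝ) : x + l < F^[k] x := by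
  rw [← CircleDeg1Lift.coe_pow]
  apply CircleDeg1Lift.lt_map_of_int_lt_translationNumber
  rwa [CircleDeg1Lift.translationNumber_pow]

/-- Points of an orbit are ordered on the line as for the rotation. -/
lemma iterate_sub_lt_iterate_sub {F : CircleDeg1Lift} {j k : ℕ} {l m : ℤ}
    (h : j * F.translationNumber - l < k * F.translationNumber - m) (x : ℝ) :
    F^[j] x - l < F^[k] x - m := by
  rcases le_total j k with hjk | hjk
  · obtain ⟨d, rfl⟩ := Nat.exists_eq_add_of_le hjk
    have := add_int_lt_iterate (F := F) (k := d) (l := m - l) (by push_cast at h ⊢; linarith)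
      (F^[j] x)
    rw [add_comm, Function.iterate_add_apply]
    push_cast at this
    linarith
  · obtain ⟨d, rfl⟩ := Nat.exists_eq_add_of_le hjk
    have := iterate_lt_add_int (F := F) (k := d) (l := l - m) (by push_cast at h ⊢; linarith)
      (F^[k] x)
    rw [add_comm k d, Function.iterate_add_apply]
    push_cast at this
    linarith

lemma eq_of_rotation_eq {τ : ℝ} (hτ : Irrational τ) {j k : ℕ} {l m : ℤ}
    (h : j * τ - l = k * τ - m) : j = k ∧ l = m := by
  have h1 : j = k := by
    by_contra hjk
    have hne : ((j : ℤ) - k : ℤ) ≠ 0 := by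
      intro h0; apply hjk; omega
    have h2 : ((((j : ℤ) - k : ℤ)) : ℝ) * τ = ((l - m : ℤ) : ℝ) := by push_cast; linarith
    exact (hτ.intCast_mul hne).ne_int (l - m) h2
  subst h1
  refine ⟨rfl, ?_⟩
  have : (l : ℝ) = m := by linarith
  exact_mod_cast this

lemma iterate_sub_le_iterate_sub {F : CircleDeg1Lift} (hτ : Irrational F.translationNumber)
    {j k : ℕ} {l m : ℤ}
    (h : j * F.translationNumber - l ≤ k * F.translationNumber - m) (x : ℝ) :
    F^[j] x - l ≤ F^[k] x - m := by
  rcases h.lt_or_eq with h | h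
  · exact (iterate_sub_lt_iterate_sub h x).le
  · obtain ⟨rfl, rfl⟩ := eq_of_rotation_eq hτ h
    exact le_rfl

lemma rotation_lt_of_iterate_sub_lt {F : CircleDeg1Lift} (hτ : Irrational F.translationNumber)
    {j k : ℕ} {l m : ℤ} {x : ℝ} (h : F^[j] x - l < F^[k] x - m) :
    j * F.translationNumber - l < k * F.translationNumber - m := by
  by_contra hcon
  exact absurd (iterate_sub_le_iterate_sub hτ (not_lt.1 hcon) x) (not_le.2 h)

lemma rotation_ne_zero {τ : ℝ} (hτ : Irrational τ) {k : ℕ} (hk : 1 ≤ k) (l : ℤ) :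
    k * τ - l ≠ 0 := by
  intro h
  have := eq_of_rotation_eq hτ (j := k) (k := 0) (l := l) (m := 0) (by simpa using h)
  omega

/-! ### Reflection -/

/-- The lift conjugated by `x ↦ -x`. -/
def reflect (F : CircleDeg1Lift) : CircleDeg1Lift where
  toFun x := -F (-x)
  monotone' x y h := neg_le_neg (F.monotone (neg_le_neg h))
  map_add_one' x := by
    have := F.map_add_one (-x - 1)
    rw [sub_add_cancel] at this
    rw [neg_add, ← sub_eq_add_neg, this]
    ring

@[simp] lemma reflect_apply (F : CircleDeg1Lift) (x : ℝ) : reflect F x = -F (-x) := rfl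

@[simp] lemma reflect_reflect (F : CircleDeg1Lift) : reflect (reflect F) = F := by
  ext x; simp

lemma reflect_iterate (F : CircleDeg1Lift) (k : ℕ) (x : ℝ) :
    (reflect F)^[k] x = -F^[k] (-x) := by
  induction k generalizing x with
  | zero => simp
  | succ k ih => rw [Function.iterate_succ_apply, ih, Function.iterate_succ_apply]; simp

@[simp] lemma reflect_translationNumber (F : CircleDeg1Lift) :
    (reflect F).translationNumber = -F.translationNumber := by
  apply CircleDeg1Lift.translationNumber_eq_of_tendsto₀
  have := (F.tendsto_translation_number₀).neg
  refine this.congr fun n => ?_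
  rw [CircleDeg1Lift.coe_pow, reflect_iterate]
  simp [neg_div]

/-! ### Sums of lengths of iterated intervals -/

lemma coe_eq_coe_iff {x y : ℝ} :
    (x : UnitAddCircle) = (y : UnitAddCircle) ↔ ∃ l : ℤ, y = x + l := by
  have h : (x : UnitAddCircle) = (y : UnitAddCircle) ↔ ((y - x : ℝ) : UnitAddCircle) = 0 := by
    rw [AddCircle.coe_sub, sub_eq_zero, eq_comm]
  rw [h, AddCircle.coe_eq_zero_iff]
  refine exists_congr fun l => ?_
  rw [zsmul_one]
  constructor <;> intro h <;> linarith

lemma sub_le_len_coe_Ioo {u v : ℝ} (h : v ≤ u + 1) :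
    ENNReal.ofReal (v - u) ≤ volume ((fun t : ℝ => (t : UnitAddCircle)) '' Ioo u v) := by
  have hop : IsOpen ((fun t : ℝ => (t : UnitAddCircle)) '' Ioo u v) :=
    QuotientAddGroup.isOpenMap_coe _ isOpen_Ioo
  rw [AddCircle.add_projection_respects_measure (T := 1) u hop.measurableSet, ← Real.volume_Ioo]
  apply measure_mono
  intro x hx
  exact ⟨⟨x, hx, rfl⟩, hx.1, by linarith [hx.2]⟩

lemma sum_length_le_one {m : ℕ} {u v : ℕ → ℝ} (h1 : ∀ k < m, u k ≤ v k ∧ v k ≤ u k + 1)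
    (h2 : ∀ k k' : ℕ, k < k' → k' < m → ∀ (l : ℤ) (z : ℝ), z ∈ Ioo (u k) (v k) →
      z + l ∉ Ioo (u k') (v k')) :
    ∑ k ∈ Finset.range m, (v k - u k) ≤ 1 := by
  set S : ℕ → Set UnitAddCircle := fun k => (fun t : ℝ => (t : UnitAddCircle)) '' Ioo (u k) (v k)
  have hS : ∀ k k', k < k' → k' < m → Disjoint (S k) (S k') := by
    intro k k' hk hk'
    rw [Set.disjoint_left]
    rintro _ ⟨z, hz, rfl⟩ ⟨z', hz', he⟩
    obtain ⟨l, hl⟩ := coe_eq_coe_iff.1 he.symm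
    exact h2 k k' hk hk' l z hz (hl ▸ hz')
  have hd : (Finset.range m : Set ℕ).PairwiseDisjoint S := by
    intro i hi j hj hij
    simp only [Finset.coe_range, mem_Iio] at hi hj
    rcases lt_or_gt_of_ne hij with h | h
    · exact hS i j h hj
    · exact (hS j i h hi).symm
  have hm : volume (⋃ k ∈ Finset.range m, S k) = ∑ k ∈ Finset.range m, volume (S k) :=
    measure_biUnion_finset hd fun k _ =>
      (QuotientAddGroup.isOpenMap_coe _ isOpen_Ioo).measurableSet
  have h3 : ∑ k ∈ Finset.range m, ENNReal.ofReal (v k - u k) ≤ 1 := by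
    calc _ ≤ ∑ k ∈ Finset.range m, volume (S k) :=
          Finset.sum_le_sum fun k hk => sub_le_len_coe_Ioo (h1 k (Finset.mem_range.1 hk)).2
      _ ≤ volume (Set.univ : Set UnitAddCircle) := hm ▸ measure_mono (subset_univ _)
      _ = 1 := UnitAddCircle.measure_univ
  rw [← ENNReal.ofReal_sum_of_nonneg fun k hk =>
    sub_nonneg.2 (h1 k (Finset.mem_range.1 hk)).1] at h3
  exact ENNReal.ofReal_le_one.1 h3

/-- The first `m` iterates of `[t, F^[r] t - lr]` have disjoint interiors on the circle: an overlap
of two of them would give a time `1 ≤ j < m` at which the rotation returns closer than at time `r`.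
-/
lemma sum_length_piece_le_one {F : CircleDeg1Lift} (hτ : Irrational F.translationNumber)
    {m r : ℕ} {lr : ℤ} (hr0 : 0 < r * F.translationNumber - lr)
    (hr1 : r * F.translationNumber - lr < 1)
    (hr : ∀ j : ℕ, 1 ≤ j → j < m → ∀ l : ℤ,
      r * F.translationNumber - lr ≤ |j * F.translationNumber - l|) (t : ℝ) :
    ∑ k ∈ Finset.range m, (F^[k] (F^[r] t - lr) - F^[k] t) ≤ 1 := by
  have hv : ∀ k, F^[k] (F^[r] t - lr) = F^[k + r] t - lr := fun k => by
    rw [iterate_sub_int, Function.iterate_add_apply]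
  refine sum_length_le_one (u := fun k => F^[k] t) (v := fun k => F^[k] (F^[r] t - lr)) ?_ ?_
  · intro k _
    constructor
    · apply monotone_iterate
      have := add_int_lt_iterate (F := F) (k := r) (l := lr) (by linarith) t
      linarith
    · have := iterate_lt_add_int (F := F) (k := r) (l := lr + 1) (by push_cast; linarith) t
      push_cast at this
      calc F^[k] (F^[r] t - lr) ≤ F^[k] (t + (1 : ℤ)) := by
            apply monotone_iterate; push_cast; linarith
        _ = _ := by rw [iterate_add_int]; simp
  · intro k k' hk hk' l z hz hz'
    obtain ⟨j, rfl⟩ := Nat.exists_eq_add_of_lt hk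
    have hj := hr (j + 1) (by omega) (by omega) l
    simp only [hv] at hz hz'
    rcases le_abs.1 hj with h | h
    · have := iterate_sub_le_iterate_sub hτ (j := k + r) (k := k + j + 1) (l := lr) (m := l)
        (by push_cast at h ⊢; linarith) t
      linarith [hz.2, hz'.1]
    · have := iterate_sub_le_iterate_sub hτ (j := k + j + 1 + r) (k := k) (l := lr + l) (m := 0)
        (by push_cast at h ⊢; linarith) t
      push_cast at this
      linarith [hz.1, hz'.2]

/-- If `N` steps of the rotation by a closest return time cover an interval, then its first `m`
iterates have total length at most `N`. -/
lemma sum_length_le {F : CircleDeg1Lift} (hτ : Irrational F.translationNumber)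
    {m r : ℕ} {lr : ℤ} (hr0 : 0 < r * F.translationNumber - lr)
    (hr1 : r * F.translationNumber - lr < 1)
    (hr : ∀ j : ℕ, 1 ≤ j → j < m → ∀ l : ℤ,
      r * F.translationNumber - lr ≤ |j * F.translationNumber - l|) (N : ℕ) {t t' : ℝ}
    (ht : t' ≤ F^[N * r] t - N * lr) :
    ∑ k ∈ Finset.range m, (F^[k] t' - F^[k] t) ≤ N := by
  have key : ∑ k ∈ Finset.range m, (F^[k] (F^[N * r] t - N * lr) - F^[k] t) ≤ N := by
    clear ht
    induction N with
    | zero => simp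
    | succ N ih =>
      have h1 := sum_length_piece_le_one hτ hr0 hr1 hr (F^[N * r] t - N * lr)
      have h2 : F^[r] (F^[N * r] t - N * lr) - lr = F^[(N + 1) * r] t - ((N + 1 : ℕ) : ℝ) * lr := by
        have := iterate_sub_int F r (F^[N * r] t) (N * lr)
        push_cast at this
        rw [this, ← Function.iterate_add_apply, add_mul, one_mul, add_comm r]
        push_cast; ring
      rw [h2] at h1
      have h3 : ∑ k ∈ Finset.range m,
          (F^[k] (F^[(N + 1) * r] t - ((N + 1 : ℕ) : ℝ) * lr) - F^[k] t) =
          ∑ k ∈ Finset.range m, (F^[k] (F^[(N + 1) * r] t - ((N + 1 : ℕ) : ℝ) * lr) -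
            F^[k] (F^[N * r] t - N * lr)) +
          ∑ k ∈ Finset.range m, (F^[k] (F^[N * r] t - N * lr) - F^[k] t) := by
        rw [← Finset.sum_add_distrib]
        exact Finset.sum_congr rfl fun k _ => by ring
      rw [h3]
      push_cast at h1 ih ⊢
      linarith
  refine le_trans (Finset.sum_le_sum fun k _ => ?_) key
  exact sub_le_sub_right (monotone_iterate F k ht) _

lemma sum_length_le' {F : CircleDeg1Lift} (hτ : Irrational F.translationNumber)
    {m r : ℕ} {lr : ℤ} (hr0 : r * F.translationNumber - lr < 0)
    (hr1 : -1 < r * F.translationNumber - lr)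
    (hr : ∀ j : ℕ, 1 ≤ j → j < m → ∀ l : ℤ,
      lr - r * F.translationNumber ≤ |j * F.translationNumber - l|) (N : ℕ) {t t' : ℝ}
    (ht : F^[N * r] t' - N * lr ≤ t) :
    ∑ k ∈ Finset.range m, (F^[k] t' - F^[k] t) ≤ N := by
  have h := sum_length_le (F := reflect F) (by simpa using hτ.neg) (m := m) (r := r) (lr := -lr)
    (by simp; linarith) (by simp; linarith)
    (by
      intro j h1 h2 l
      have := hr j h1 h2 (-l)
      rw [← abs_neg] at this
      simp only [reflect_translationNumber]; push_cast at this ⊢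
      ring_nf at this ⊢
      exact this) N
    (t := -t') (t' := -t) (by rw [reflect_iterate]; simp; linarith)
  refine le_trans (le_of_eq ?_) h
  refine Finset.sum_congr rfl fun k _ => ?_
  rw [reflect_iterate, reflect_iterate]; simp; ring

/-! ### Farey pairs of closest returns -/

/-- `(p, u)` is a closest return from the left, `(q, v)` one from the right, and the two are
neighbours: the next closest return is `(p + q, u + v)`. -/
structure FareyPair (τ : ℝ) (p : ℕ) (u : ℤ) (q : ℕ) (v : ℤ) : Prop where
  left : p * τ - u < 0
  right : 0 < q * τ - v
  det : q * u - p * v = 1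

/-- By `det`, (k, l) is an integral combination α(p, u) + β(q, v). If α or β were nonpositive, the
value k τ - l would fall outside the gap between the two returns or `k` would not be positive; hence
α, β ≥ 1. -/
lemma FareyPair.add_le {τ : ℝ} {p q : ℕ} {u v : ℤ} (h : FareyPair τ p u q v) {k : ℕ} {l : ℤ}
    (hk : 1 ≤ k) (h1 : p * τ - u < k * τ - l) (h2 : k * τ - l < q * τ - v) : p + q ≤ k := by
  have hdet := h.det
  have hL := h.left
  have hR := h.right
  obtain ⟨α, hα⟩ : ∃ α : ℤ, α = q * l - k * v := ⟨_, rfl⟩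
  obtain ⟨β, hβ⟩ : ∃ β : ℤ, β = k * u - p * l := ⟨_, rfl⟩
  have hk' : (k : ℤ) = α * p + β * q := by rw [hα, hβ]; linear_combination (-(k : ℤ)) * hdet
  have hl' : l = α * u + β * v := by rw [hα, hβ]; linear_combination (-l) * hdet
  have e1 : (k : ℝ) = α * p + β * q := by exact_mod_cast hk'
  have e2 : (l : ℝ) = α * u + β * v := by exact_mod_cast hl'
  have e3 : (k : ℝ) * τ - l = α * (p * τ - u) + β * (q * τ - v) := by rw [e1, e2]; ring
  rw [e3] at h1 h2
  by_cases ha : 1 ≤ α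
  · by_cases hb : 1 ≤ β
    · have : (p : ℤ) + q ≤ k := by rw [hk']; nlinarith
      exact_mod_cast this
    · exfalso
      have hb' : (β : ℝ) ≤ 0 := by exact_mod_cast (by omega : β ≤ 0)
      have ha' : (1 : ℝ) ≤ α := by exact_mod_cast ha
      nlinarith
  · by_cases hb : 1 ≤ β
    · exfalso
      have hb' : (1 : ℝ) ≤ β := by exact_mod_cast hb
      have ha' : (α : ℝ) ≤ 0 := by exact_mod_cast (by omega : α ≤ 0)
      nlinarith
    · exfalso
      have : (k : ℤ) ≤ 0 := by
        rw [hk']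
        have : α * p ≤ 0 := mul_nonpos_of_nonpos_of_nonneg (by omega) (by omega)
        have : β * q ≤ 0 := mul_nonpos_of_nonpos_of_nonneg (by omega) (by omega)
        linarith
      omega

lemma FareyPair.min_le_abs {τ : ℝ} {p q : ℕ} {u v : ℤ} (h : FareyPair τ p u q v) {k : ℕ} {l : ℤ}
    (hk : 1 ≤ k) (hk' : k < p + q) : min (u - p * τ) (q * τ - v) ≤ |k * τ - l| := by
  by_contra hcon
  rw [not_le, lt_min_iff, abs_lt, abs_lt] at hcon
  have := h.add_le (l := l) hk (by linarith [hcon.1.1]) (by linarith [hcon.2.2])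
  omega

/-! ### Cross-ratios along orbits -/

/-- The cross-ratio `|M| |T| / (|L| |R|)` of the adjacent intervals `L`, `M`, `R` with union `T`. -/
def crossRatio (t₁ t₂ t₃ t₄ : ℝ) : ℝ := (t₃ - t₂) * (t₄ - t₁) / ((t₂ - t₁) * (t₄ - t₃))

/-- The topological properties of a lift of a map with a flat interval and irrational rotation
number. -/
structure IsFlatLift (F : CircleDeg1Lift) (a b : ℝ) : Prop where
  continuous : Continuous F
  lt : a < b
  lt_add_one : b < a + 1
  map_eq : ∀ x ∈ Icc a b, F x = F b
  strictMonoOn : StrictMonoOn F (Icc b (a + 1))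
  irrational : Irrational F.translationNumber

/-- A lift contracts cross-ratios by a factor which is controlled by the length. -/
def HasCrossBound (F : CircleDeg1Lift) (a b C : ℝ) : Prop :=
  0 ≤ C ∧ ∀ t₁ t₂ t₃ t₄ : ℝ, b < t₁ → t₁ < t₂ → t₂ < t₃ → t₃ < t₄ → t₄ < a + 1 →
    crossRatio t₁ t₂ t₃ t₄ ≤ Real.exp (C * (t₄ - t₁)) * crossRatio (F t₁) (F t₂) (F t₃) (F t₄)

lemma IsFlatLift.surjective_iterate {F : CircleDeg1Lift} {a b : ℝ} (h : IsFlatLift F a b) (m : ℕ)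
    (y : ℝ) : ∃ x, F^[m] x = y :=
  (F.continuous_iff_surjective.1 h.continuous).iterate m y

lemma crossRatio_sub (t₁ t₂ t₃ t₄ l : ℝ) :
    crossRatio (t₁ - l) (t₂ - l) (t₃ - l) (t₄ - l) = crossRatio t₁ t₂ t₃ t₄ := by
  simp [crossRatio]

/-- An interval which misses the translates of `[a, b]` lies between two of them. -/
lemma exists_between_translates {a b : ℝ} (hab : a < b) {s t : ℝ} (hst : s ≤ t)
    (h : ∀ (l : ℤ), ∀ x ∈ Icc s t, x ∉ Icc (a + l) (b + l)) :
    ∃ l : ℤ, b + l < s ∧ t < a + 1 + l := by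
  refine ⟨⌈s - a⌉ - 1, ?_, ?_⟩
  · by_contra hc
    refine h (⌈s - a⌉ - 1) s ⟨le_rfl, hst⟩ ⟨?_, not_lt.1 hc⟩
    have := Int.ceil_lt_add_one (s - a)
    push_cast; linarith
  · by_contra hc
    have hc' := not_lt.1 hc
    have := Int.le_ceil (s - a)
    push_cast at hc'
    exact h ⌈s - a⌉ (a + ⌈s - a⌉) ⟨by linarith, by linarith⟩ ⟨le_rfl, by linarith⟩

/-- Cross-ratios along an orbit which avoids the flat interval. -/
lemma crossRatio_iterate_le {F : CircleDeg1Lift} {a b C : ℝ} (hF : IsFlatLift F a b)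
    (hC : HasCrossBound F a b C) {m : ℕ} {t₁ t₂ t₃ t₄ : ℝ} (h12 : t₁ < t₂) (h23 : t₂ < t₃)
    (h34 : t₃ < t₄)
    (hfree : ∀ j : ℕ, 1 ≤ j → j ≤ m → ∀ l : ℤ, F^[j] b + l ∉ Icc (F^[m] t₁) (F^[m] t₄)) :
    crossRatio t₁ t₂ t₃ t₄ ≤
      Real.exp (C * ∑ k ∈ Finset.range m, (F^[k] t₄ - F^[k] t₁)) *
        crossRatio (F^[m] t₁) (F^[m] t₂) (F^[m] t₃) (F^[m] t₄) := by
  induction m generalizing t₁ t₂ t₃ t₄ with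
  | zero => simp
  | succ m ih =>
    -- A point of a translate of `[a, b]` has the same image as an endpoint, so after `m + 1` steps
    -- it would land on a translate of `F^[m + 1] b`, which `hfree` excludes.
    have hmiss : ∀ (l : ℤ), ∀ x ∈ Icc t₁ t₄, x ∉ Icc (a + l) (b + l) := by
      intro l x hx hxab
      have h1 : F x = F b + l := by
        have := hF.map_eq (x - l) ⟨by linarith [hxab.1], by linarith [hxab.2]⟩
        rw [CircleDeg1Lift.map_sub_int] at this
        linarith
      have h2 : F^[m + 1] x = F^[m + 1] b + l := by
        rw [Function.iterate_succ_apply, h1, iterate_add_int, ← Function.iterate_succ_apply]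
      refine hfree (m + 1) (by omega) le_rfl l ?_
      rw [← h2]
      exact ⟨monotone_iterate F _ hx.1, monotone_iterate F _ hx.2⟩
    obtain ⟨l, hl1, hl4⟩ := exists_between_translates hF.lt (by linarith : t₁ ≤ t₄) hmiss
    have hmono : ∀ x y, t₁ ≤ x → x < y → y ≤ t₄ → F x < F y := by
      intro x y hx hxy hy
      have := hF.strictMonoOn (show x - l ∈ Icc b (a + 1) from ⟨by linarith, by linarith⟩)
        (show y - l ∈ Icc b (a + 1) from ⟨by linarith, by linarith⟩) (by linarith)
      rw [CircleDeg1Lift.map_sub_int, CircleDeg1Lift.map_sub_int] at this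
      linarith
    have hstep := hC.2 (t₁ - l) (t₂ - l) (t₃ - l) (t₄ - l) (by linarith) (by linarith)
      (by linarith) (by linarith) (by linarith)
    simp only [CircleDeg1Lift.map_sub_int, crossRatio_sub, sub_sub_sub_cancel_right] at hstep
    have hih := ih (hmono t₁ t₂ le_rfl h12 (by linarith)) (hmono t₂ t₃ h12.le h23 h34.le)
      (hmono t₃ t₄ (by linarith) h34 le_rfl) (by
        intro j hj hjm l'
        rw [← Function.iterate_succ_apply, ← Function.iterate_succ_apply]
        exact hfree j hj (by omega) l')
    simp only [← Function.iterate_succ_apply] at hih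
    rw [Finset.sum_range_succ', mul_add, Real.exp_add]
    simp only [Function.iterate_zero, id]
    calc _ ≤ _ := hstep
      _ ≤ Real.exp (C * (t₄ - t₁)) * _ :=
        mul_le_mul_of_nonneg_left hih (Real.exp_nonneg _)
      _ = _ := by ring

/-! ### Analytic hypotheses on a lift and their invariance under reflection -/

/-- Comparison, near the right end of the flat interval, of the lift with a power of the distance
to that end. -/
structure HasEndBounds (F : CircleDeg1Lift) (a b : ℝ) : Prop where
  -- Division-free comparison of the mean slope on `[x, y]` with the mean slope on `[b, x]`; `lower`
  -- is the opposite inequality, which holds only near `b` since the slope degenerates again at `a +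
  -- 1`.
  upper : ∀ C₀ : ℝ, ∃ C₁ : ℝ, 0 < C₁ ∧ ∀ x y : ℝ, b < x → x < y → y < a + 1 →
    y - b ≤ C₀ * (x - b) → (F y - F x) * (x - b) ≤ C₁ * ((y - x) * (F x - F b))
  lower : ∃ c : ℝ, 0 < c ∧ ∃ η : ℝ, 0 < η ∧ ∀ x y : ℝ, b < x → x < y → y < b + η →
    c * ((y - x) * (F x - F b)) ≤ (F y - F x) * (x - b)

/-- The analytic properties of a lift which matter for the geometry of its orbits. -/
structure IsRegularLift (F : CircleDeg1Lift) (a b C : ℝ) : Prop extends IsFlatLift F a b where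
  cross : HasCrossBound F a b C
  right : HasEndBounds F a b
  left : HasEndBounds (reflect F) (-b) (-a)

lemma IsFlatLift.reflect {F : CircleDeg1Lift} {a b : ℝ} (h : IsFlatLift F a b) :
    IsFlatLift (reflect F) (-b) (-a) where
  continuous := by
    have : Continuous fun x => -F (-x) := (h.continuous.comp continuous_neg).neg
    exact this
  lt := neg_lt_neg h.lt
  lt_add_one := by linarith [h.lt_add_one]
  map_eq x hx := by
    simp only [reflect_apply, neg_neg]
    rw [h.map_eq (-x) ⟨by linarith [hx.2], by linarith [hx.1]⟩, h.map_eq a ⟨le_rfl, h.lt.le⟩]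
  strictMonoOn x hx y hy hxy := by
    have := h.strictMonoOn (show -y + 1 ∈ Icc b (a + 1) from ⟨by linarith [hy.2], by linarith [hy.1]⟩)
      (show -x + 1 ∈ Icc b (a + 1) from ⟨by linarith [hx.2], by linarith [hx.1]⟩) (by linarith)
    rw [CircleDeg1Lift.map_add_one, CircleDeg1Lift.map_add_one] at this
    simp only [reflect_apply]; linarith
  irrational := by simpa using h.irrational.neg

lemma HasCrossBound.reflect {F : CircleDeg1Lift} {a b C : ℝ} (h : HasCrossBound F a b C) :
    HasCrossBound (reflect F) (-b) (-a) C := by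
  refine ⟨h.1, fun t₁ t₂ t₃ t₄ h1 h2 h3 h4 h5 => ?_⟩
  have := h.2 (1 - t₄) (1 - t₃) (1 - t₂) (1 - t₁) (by linarith) (by linarith) (by linarith)
    (by linarith) (by linarith)
  have e : ∀ t, F (1 - t) = F (-t) + 1 := fun t => by
    rw [show 1 - t = -t + 1 by ring, CircleDeg1Lift.map_add_one]
  simp only [e] at this
  have e1 : ∀ x₁ x₂ x₃ x₄ : ℝ, crossRatio (1 - x₄) (1 - x₃) (1 - x₂) (1 - x₁) =
      crossRatio x₁ x₂ x₃ x₄ := fun x₁ x₂ x₃ x₄ => by unfold crossRatio; congr 1 <;> ring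
  have e2 : ∀ x₁ x₂ x₃ x₄ : ℝ, crossRatio (x₄ + 1) (x₃ + 1) (x₂ + 1) (x₁ + 1) =
      crossRatio (-x₁) (-x₂) (-x₃) (-x₄) := fun x₁ x₂ x₃ x₄ => by
    unfold crossRatio; congr 1 <;> ring
  rw [e1, e2] at this
  simpa [show 1 - t₁ - (1 - t₄) = t₄ - t₁ by ring] using this

lemma IsRegularLift.reflect {F : CircleDeg1Lift} {a b C : ℝ} (h : IsRegularLift F a b C) :
    IsRegularLift (reflect F) (-b) (-a) C where
  toIsFlatLift := h.toIsFlatLift.reflect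
  cross := h.cross.reflect
  right := h.left
  left := by simpa using h.right

/-- Returns of the flat interval can thus be written with `b` alone; the image of `a` is needed only
to see that a return from the left lies to the left of `a`. -/
lemma IsFlatLift.iterate_eq {F : CircleDeg1Lift} {a b : ℝ} (h : IsFlatLift F a b) {k : ℕ}
    (hk : 1 ≤ k) : F^[k] a = F^[k] b := by
  obtain ⟨k, rfl⟩ := Nat.exists_eq_add_of_le' hk
  rw [Function.iterate_succ_apply, Function.iterate_succ_apply, h.map_eq a ⟨le_rfl, h.lt.le⟩]

lemma IsFlatLift.iterate_lt_left {F : CircleDeg1Lift} {a b : ℝ} (h : IsFlatLift F a b) {k : ℕ}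
    (hk : 1 ≤ k) {l : ℤ} (hl : k * F.translationNumber - l < 0) : F^[k] b - l < a := by
  rw [← h.iterate_eq hk]
  have := iterate_lt_add_int (F := F) (k := k) (l := l) (by linarith) a
  linarith

lemma lt_iterate_right {F : CircleDeg1Lift} {b : ℝ} {k : ℕ} {l : ℤ}
    (hl : 0 < k * F.translationNumber - l) : b < F^[k] b - l := by
  have := add_int_lt_iterate (F := F) (k := k) (l := l) (by linarith) b
  linarith

lemma crossRatio_nonneg {t₁ t₂ t₃ t₄ : ℝ} (h12 : t₁ < t₂) (h23 : t₂ < t₃) (h34 : t₃ < t₄) :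
    0 ≤ crossRatio t₁ t₂ t₃ t₄ :=
  div_nonneg (mul_nonneg (by linarith) (by linarith)) (mul_nonneg (by linarith) (by linarith))

lemma lt_of_iterate_lt {F : CircleDeg1Lift} {m : ℕ} {x y : ℝ} (h : F^[m] x < F^[m] y) : x < y :=
  (monotone_iterate F m).reflect_lt h

/-! ### Pull-back of cross-ratios along closest returns -/

/-- Pulling back, by the iterates of a closest return from the left, cross-ratios of points between
the preceding return from the left and the right end of the flat interval. -/
lemma crossRatio_pullback_left {F : CircleDeg1Lift} {a b C : ℝ} (hF : IsFlatLift F a b)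
    (hC : HasCrossBound F a b C) {p₀ r N : ℕ} {u₀ v : ℤ}
    (hP : FareyPair F.translationNumber p₀ u₀ r v) (hp : 1 ≤ p₀ + r)
    (hN : u₀ - p₀ * F.translationNumber < N * (r * F.translationNumber - v))
    (hmin : r * F.translationNumber - v ≤ u₀ - p₀ * F.translationNumber)
    (hr1 : r * F.translationNumber - v < 1)
    {s₁ s₂ s₃ s₄ t₁ t₂ t₃ t₄ : ℝ} (h1 : F^[p₀] b - u₀ < s₁) (h12 : s₁ < s₂) (h23 : s₂ < s₃)
    (h34 : s₃ < s₄) (h4 : s₄ < b)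
    (e1 : F^[p₀ + r - 1] t₁ = s₁ + (u₀ + v : ℤ)) (e2 : F^[p₀ + r - 1] t₂ = s₂ + (u₀ + v : ℤ))
    (e3 : F^[p₀ + r - 1] t₃ = s₃ + (u₀ + v : ℤ)) (e4 : F^[p₀ + r - 1] t₄ = s₄ + (u₀ + v : ℤ)) :
    crossRatio t₁ t₂ t₃ t₄ ≤ Real.exp (C * N) * crossRatio s₁ s₂ s₃ s₄ := by
  have hτ := hF.irrational
  have hR := hP.right
  -- A point of the orbit of `b` in this range would be a return strictly between the two members of
  -- the Farey pair, hence have time at least `p₀ + r`, one more than the number of iterates pulled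
  -- back.
  have hfree : ∀ j : ℕ, 1 ≤ j → j ≤ p₀ + r - 1 → ∀ l : ℤ,
      F^[j] b + l ∉ Icc (F^[p₀ + r - 1] t₁) (F^[p₀ + r - 1] t₄) := by
    rintro j hj hjm l ⟨hl1, hl4⟩
    rw [e1] at hl1
    rw [e4] at hl4
    have hlow : F^[p₀] b - u₀ < F^[j] b - ((u₀ + v - l : ℤ) : ℝ) := by push_cast at hl1 ⊢; linarith
    have hup : j * F.translationNumber - ((u₀ + v - l : ℤ) : ℝ) ≤ 0 := by
      by_contra hc
      have := lt_iterate_right (b := b) (not_le.1 hc)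
      push_cast at this hl4; linarith
    have := hP.add_le hj (rotation_lt_of_iterate_sub_lt hτ hlow) (by linarith)
    omega
  have hlt : ∀ {x y s s' : ℝ}, F^[p₀ + r - 1] x = s + (u₀ + v : ℤ) →
      F^[p₀ + r - 1] y = s' + (u₀ + v : ℤ) → s < s' → x < y := by
    intro x y s s' hx hy hs
    refine lt_of_iterate_lt (F := F) (m := p₀ + r - 1) ?_
    rw [hx, hy]; linarith
  -- By `hN`, `N` steps of the return `r` carry the `p₀`-th return, and so `s₁`, beyond `b > s₄`.
  -- Upstairs they therefore carry `t₁` beyond `t₄`, and `sum_length_le` applies.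
  have hsum : ∑ k ∈ Finset.range (p₀ + r - 1), (F^[k] t₄ - F^[k] t₁) ≤ N := by
    refine sum_length_le hτ hR hr1 ?_ N (r := r) (lr := v) ?_
    · intro j hj hjm l
      refine le_trans ?_ (hP.min_le_abs hj (by omega))
      rw [min_eq_right hmin]
    · by_contra hc
      have h5 := monotone_iterate F (p₀ + r - 1) (not_le.1 hc).le
      have e5 : F^[p₀ + r - 1] (F^[N * r] t₁ - N * v) =
          F^[N * r] s₁ + (u₀ + v : ℤ) - (N * v : ℤ) := by
        have h6 := iterate_sub_int F (p₀ + r - 1) (F^[N * r] t₁) (N * v)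
        push_cast at h6 ⊢
        rw [h6, ← Function.iterate_add_apply, Nat.add_comm, Function.iterate_add_apply, e1,
          iterate_add_int]
        push_cast; ring
      have h7 : F^[N * r + p₀] b - (u₀ : ℤ) ≤ F^[N * r] s₁ := by
        rw [Function.iterate_add_apply, ← iterate_sub_int]
        exact monotone_iterate F _ h1.le
      have h8 := lt_iterate_right (F := F) (b := b) (k := N * r + p₀) (l := u₀ + N * v)
        (by push_cast; linarith)
      rw [e5, e4] at h5
      push_cast at h5 h7 h8
      linarith
  have hmain := crossRatio_iterate_le hF hC (hlt e1 e2 h12) (hlt e2 e3 h23) (hlt e3 e4 h34) hfree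
  rw [e1, e2, e3, e4] at hmain
  have e : crossRatio (s₁ + (u₀ + v : ℤ)) (s₂ + (u₀ + v : ℤ)) (s₃ + (u₀ + v : ℤ))
      (s₄ + (u₀ + v : ℤ)) = crossRatio s₁ s₂ s₃ s₄ := by
    simp [crossRatio]
  rw [e] at hmain
  refine hmain.trans (mul_le_mul_of_nonneg_right ?_ (crossRatio_nonneg h12 h23 h34))
  exact Real.exp_le_exp.2 (mul_le_mul_of_nonneg_left hsum hC.1)

/-- Pulling back cross-ratios of image points of an interval between the flat interval and a
closest return from the right. -/
lemma crossRatio_pullback_right {F : CircleDeg1Lift} {a b C : ℝ} (hF : IsFlatLift F a b)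
    (hC : HasCrossBound F a b C) {s q N m : ℕ} {us w : ℤ}
    (hP : FareyPair F.translationNumber s us q w) (hm : m ≤ s + q)
    (hN : q * F.translationNumber - w < N * (us - s * F.translationNumber))
    (hmin : us - s * F.translationNumber ≤ q * F.translationNumber - w)
    (hq : 1 ≤ q) (hq1 : q * F.translationNumber - w < 1)
    {x₁ x₂ x₃ x₄ t₁ t₂ t₃ t₄ : ℝ} (h1 : b < x₁) (h12 : x₁ < x₂) (h23 : x₂ < x₃)
    (h34 : x₃ < x₄) (h4 : x₄ < F^[q] b - w)
    (e1 : F^[m] t₁ = F x₁) (e2 : F^[m] t₂ = F x₂) (e3 : F^[m] t₃ = F x₃) (e4 : F^[m] t₄ = F x₄) :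
    crossRatio t₁ t₂ t₃ t₄ ≤ Real.exp (C * N) * crossRatio (F x₁) (F x₂) (F x₃) (F x₄) := by
  have hτ := hF.irrational
  have hL := hP.left
  have hR := hP.right
  have hB1 : F^[q] b - w < a + 1 := by
    have := hF.iterate_lt_left hq (l := w + 1) (by push_cast; linarith)
    push_cast at this; linarith
  have hFmono : ∀ {x y : ℝ}, b ≤ x → x < y → y ≤ a + 1 → F x < F y := fun hx hxy hy =>
    hF.strictMonoOn ⟨hx, hxy.le.trans hy⟩ ⟨hx.trans hxy.le, hy⟩ hxy
  -- The points to avoid are images under `F`, so a hit at time `j` yields a return at time `j - 1`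
  -- strictly between `b` and the `q`-th return. Time zero is impossible because `(b, a + 1)`
  -- contains no translate of `b`; otherwise the Farey property makes `j - 1` at least `s + q`.
  have hfree : ∀ j : ℕ, 1 ≤ j → j ≤ m → ∀ l : ℤ, F^[j] b + l ∉ Icc (F^[m] t₁) (F^[m] t₄) := by
    rintro j hj hjm l ⟨hl1, hl4⟩
    rw [e1] at hl1
    rw [e4] at hl4
    obtain ⟨j, rfl⟩ := Nat.exists_eq_add_of_le' hj
    rw [Function.iterate_succ_apply', ← CircleDeg1Lift.map_add_int] at hl1 hl4
    have hy1 : b < F^[j] b + l := by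
      by_contra hc
      have := F.monotone (not_lt.1 hc)
      linarith [hFmono le_rfl h1 (by linarith)]
    have hy4 : F^[j] b + l < F^[q] b - w := by
      by_contra hc
      have := F.monotone (not_lt.1 hc)
      linarith [hFmono (by linarith) h4 (by linarith)]
    have hrot : 0 < j * F.translationNumber - ((-l : ℤ) : ℝ) := by
      have := rotation_lt_of_iterate_sub_lt hτ (j := 0) (k := j) (l := 0) (m := -l) (x := b)
        (by push_cast; simpa using hy1)
      simpa using this
    have hj0 : 1 ≤ j := by
      rcases Nat.eq_zero_or_pos j with rfl | h
      · exfalso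
        simp only [Function.iterate_zero, id] at hy1 hy4
        have h0 : (0 : ℝ) < l := by linarith
        have h0' : (1 : ℝ) ≤ l := by exact_mod_cast (show (1 : ℤ) ≤ l by exact_mod_cast h0)
        linarith [hF.lt]
      · exact h
    have := hP.add_le hj0 (l := -l) (by linarith)
      (rotation_lt_of_iterate_sub_lt hτ (x := b) (by push_cast; linarith))
    omega
  have hlt : ∀ {x y s s' : ℝ}, F^[m] x = F s → F^[m] y = F s' → b < s → s < s' → s' ≤ a + 1 →
      x < y := by
    intro x y s s' hx hy h1 h2 h3
    refine lt_of_iterate_lt (F := F) (m := m) ?_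
    rw [hx, hy]; exact hFmono h1.le h2 h3
  -- `N` steps of the left return `s` carry `x₄` to the left of `a`; below `b` the map takes values
  -- at most `F b < F x₁`.
  have hsum : ∑ k ∈ Finset.range m, (F^[k] t₄ - F^[k] t₁) ≤ N := by
    refine sum_length_le' hτ hL (by linarith) ?_ N (r := s) (lr := us) ?_
    · intro j hj hjm l
      refine le_trans ?_ (hP.min_le_abs hj (by omega))
      rw [min_eq_left hmin]
    · by_contra hc
      have h5 := monotone_iterate F m (not_le.1 hc).le
      have e5 : F^[m] (F^[N * s] t₄ - N * us) = F (F^[N * s] x₄ - (N * us : ℤ)) := by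
        have h6 := iterate_sub_int F m (F^[N * s] t₄) (N * us)
        push_cast at h6 ⊢
        rw [h6, ← Function.iterate_add_apply, Nat.add_comm, Function.iterate_add_apply, e4,
          ← Function.iterate_succ_apply, Function.iterate_succ_apply']
        have h7 := CircleDeg1Lift.map_sub_int F (F^[N * s] x₄) (N * us)
        push_cast at h7
        rw [h7]
      have h7 : F^[N * s] x₄ ≤ F^[N * s + q] b - w := by
        rw [Function.iterate_add_apply, ← iterate_sub_int]
        exact monotone_iterate F _ h4.le
      have h8 := hF.iterate_lt_left (k := N * s + q) (l := w + N * us)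
        (by omega) (by push_cast; linarith)
      have h9 : F (F^[N * s] x₄ - (N * us : ℤ)) ≤ F b := by
        apply F.monotone
        push_cast at h7 h8 ⊢
        linarith [hF.lt]
      rw [e5, e1] at h5
      linarith [hFmono le_rfl h1 (by linarith)]
  have hmain := crossRatio_iterate_le hF hC (hlt e1 e2 h1 h12 (by linarith))
    (hlt e2 e3 (by linarith) h23 (by linarith)) (hlt e3 e4 (by linarith) h34 (by linarith)) hfree
  rw [e1, e2, e3, e4] at hmain
  refine hmain.trans (mul_le_mul_of_nonneg_right ?_ (crossRatio_nonneg
    (hFmono h1.le h12 (by linarith)) (hFmono (by linarith) h23 (by linarith))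
    (hFmono (by linarith) h34 (by linarith))))
  exact Real.exp_le_exp.2 (mul_le_mul_of_nonneg_left hsum hC.1)

lemma IsFlatLift.iterate_lt_add_one {F : CircleDeg1Lift} {a b : ℝ} (h : IsFlatLift F a b) {k : ℕ}
    (hk : 1 ≤ k) {l : ℤ} (hl : k * F.translationNumber - l < 1) : F^[k] b - l < a + 1 := by
  have := h.iterate_lt_left hk (l := l + 1) (by push_cast; linarith)
  push_cast at this; linarith

/-! ### Comparison of consecutive step ratios -/

/-- The interval between two consecutive closest returns from the left is not small relative to the
preceding one, unless the last interval of closest returns from the right is large. -/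
lemma return_ratio_le {F : CircleDeg1Lift} {a b C C₀ C₁ : ℝ} (hF : IsFlatLift F a b)
    (hC : HasCrossBound F a b C) (hC₁ : 0 < C₁)
    (hU : ∀ x y : ℝ, b < x → x < y → y < a + 1 →
      y - b ≤ C₀ * (x - b) → (F y - F x) * (x - b) ≤ C₁ * ((y - x) * (F x - F b)))
    {p₀ r N q q₀ : ℕ} {u₀ v w w₀ : ℤ}
    (hP : FareyPair F.translationNumber p₀ u₀ r v) (hp₀ : 1 ≤ p₀)
    (hN : u₀ - p₀ * F.translationNumber < N * (r * F.translationNumber - v))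
    (hmin : r * F.translationNumber - v ≤ u₀ - p₀ * F.translationNumber)
    (hr1 : r * F.translationNumber - v < 1)
    (hq : 0 < q * F.translationNumber - w)
    (hpq : (p₀ + r + q : ℕ) * F.translationNumber - (u₀ + v + w : ℤ) < 0)
    (hq₀ : 1 ≤ q₀) (hq₀1 : q₀ * F.translationNumber - w₀ < 1)
    (hqq₀ : q * F.translationNumber - w < q₀ * F.translationNumber - w₀)
    (hpq₀ : 0 < (p₀ + r + q₀ : ℕ) * F.translationNumber - (u₀ + v + w₀ : ℤ))
    {D₀ D D' E₀ E : ℝ} (hD₀ : D₀ = a - (F^[p₀] b - u₀))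
    (hD : D = a - (F^[p₀ + r] b - (u₀ + v : ℤ)))
    (hD' : D' = a - (F^[p₀ + r + q] b - (u₀ + v + w : ℤ)))
    (hE₀ : E₀ = F^[q₀] b - w₀ - b) (hE : E = F^[q] b - w - b)
    (hDC : D₀ ≤ C₀ * D) (hEC : E₀ ≤ C₀ * E) :
    (D₀ - D) / D ≤ 2 * C₀ * C₁ * Real.exp (C * N) * ((D - D') / D' * ((E₀ - E) / E)) := by
  have hR := hP.right
  have hL := hP.left
  have hab := hF.lt
  -- Under `F^[p₀ + r]` the `q`-th return `B` goes to the left of the translated flat interval and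
  -- the `q₀`-th return `B₀` to its right, so `z` lies between them.
  obtain ⟨z, hz⟩ := hF.surjective_iterate (p₀ + r) (a + (u₀ + v : ℤ))
  have hDpos : 0 < D' := by
    have := hF.iterate_lt_left (by omega) hpq
    linarith
  have hDD' : D' < D := by
    have := iterate_sub_lt_iterate_sub (F := F) (j := p₀ + r) (k := p₀ + r + q) (l := u₀ + v)
      (m := u₀ + v + w) (by push_cast; linarith) b
    linarith
  have hDD₀ : D < D₀ := by
    have := iterate_sub_lt_iterate_sub (F := F) (j := p₀) (k := p₀ + r) (l := u₀)
      (m := u₀ + v) (by push_cast; linarith) b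
    linarith
  have hEpos : 0 < E := by
    have := lt_iterate_right (b := b) hq
    linarith
  have hEE₀ : E < E₀ := by
    have := iterate_sub_lt_iterate_sub hqq₀ b
    linarith
  obtain ⟨B, hB⟩ : ∃ B, B = F^[q] b - w := ⟨_, rfl⟩
  obtain ⟨B₀, hB₀⟩ : ∃ B₀, B₀ = F^[q₀] b - w₀ := ⟨_, rfl⟩
  obtain ⟨A, hA⟩ : ∃ A, A = F^[p₀ + r] b - (u₀ + v : ℤ) := ⟨_, rfl⟩
  obtain ⟨A', hA'⟩ : ∃ A', A' = F^[p₀ + r + q] b - (u₀ + v + w : ℤ) := ⟨_, rfl⟩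
  have hB₀1 : B₀ < a + 1 := hB₀ ▸ hF.iterate_lt_add_one hq₀ hq₀1
  have hFB : F^[p₀ + r] B = A' + (u₀ + v : ℤ) := by
    rw [hB, iterate_sub_int, ← Function.iterate_add_apply, hA']
    push_cast; ring
  have hFB₀ : b + (u₀ + v : ℤ) < F^[p₀ + r] B₀ := by
    have := lt_iterate_right (b := b) hpq₀
    rw [hB₀, iterate_sub_int, ← Function.iterate_add_apply]
    push_cast at this ⊢; linarith
  have hBz : B < z := lt_of_iterate_lt (F := F) (m := p₀ + r) (by rw [hFB, hz]; linarith)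
  have hzB₀ : z < B₀ := lt_of_iterate_lt (F := F) (m := p₀ + r) (by rw [hz]; linarith)
  -- The outer point is taken halfway to the preceding return: it must be strictly inside the range
  -- of the pull-back, while `[c, A]` keeps half of the length `D₀ - D`.
  obtain ⟨c, hc⟩ : ∃ c, c = (A + (F^[p₀] b - u₀)) / 2 := ⟨_, rfl⟩
  obtain ⟨t₁, ht₁⟩ := hF.surjective_iterate (p₀ + r - 1) (c + (u₀ + v : ℤ))
  have hpred : ∀ x, F^[p₀ + r - 1] (F x) = F^[p₀ + r] x := fun x => by
    rw [← Function.iterate_succ_apply]; congr 2; omega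
  -- The pull-back stops one step early, at the critical value: `F b`, `F B`, `F z` lie over `A`,
  -- `A'`, `a`.
  have hcr := crossRatio_pullback_left hF hC hP (by omega) hN hmin hr1 (s₁ := c) (s₂ := A)
    (s₃ := A') (s₄ := a) (t₁ := t₁) (t₂ := F b) (t₃ := F B) (t₄ := F z) (by linarith)
    (by linarith) (by linarith) (by linarith) (by linarith) ht₁ (by rw [hpred, hA]; ring)
    (by rw [hpred, hFB]) (by rw [hpred, hz])
  have ht₁b : t₁ < F b := lt_of_iterate_lt (F := F) (m := p₀ + r - 1) (by
    rw [hpred, ht₁]; linarith)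
  have hFmono : ∀ {x y : ℝ}, b ≤ x → x < y → y ≤ a + 1 → F x < F y := fun hx hxy hy =>
    hF.strictMonoOn ⟨hx, hxy.le.trans hy⟩ ⟨hx.trans hxy.le, hy⟩ hxy
  have hbB : F b < F B := hFmono le_rfl (by linarith) (by linarith)
  have hBz' : F B < F z := hFmono (by linarith) hBz (by linarith)
  have hzB₀' : F z < F B₀ := hFmono (by linarith) hzB₀ (by linarith)
  have hup := hU B B₀ (by linarith) (by linarith) hB₀1 (by
    have e1 : B₀ - b = E₀ := by rw [hE₀, hB₀]
    have e2 : B - b = E := by rw [hE, hB]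
    rw [e1, e2]; exact hEC)
  -- In the cross-ratio |T| ≥ |L|, and |R| = F z - F B is at most F B₀ - F B. The power law at `b`
  -- then turns the quotient into E / (E₀ - E).
  have hlow : (F B - F b) / (F B₀ - F B) ≤ crossRatio t₁ (F b) (F B) (F z) := by
    unfold crossRatio
    rw [div_le_div_iff₀ (by linarith) (mul_pos (by linarith) (by linarith))]
    have h1 : (F b - t₁) * (F z - F B) ≤ (F z - t₁) * (F B₀ - F B) :=
      mul_le_mul (by linarith) (by linarith) (by linarith) (by linarith)
    calc _ = (F B - F b) * ((F b - t₁) * (F z - F B)) := rfl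
      _ ≤ (F B - F b) * ((F z - t₁) * (F B₀ - F B)) :=
        mul_le_mul_of_nonneg_left h1 (by linarith)
      _ = _ := by ring
  have hlow' : E / (C₁ * (E₀ - E)) ≤ (F B - F b) / (F B₀ - F B) := by
    rw [div_le_div_iff₀ (mul_pos hC₁ (by linarith)) (by linarith)]
    have e1 : B - b = E := by rw [hE, hB]
    have e2 : B₀ - B = E₀ - E := by rw [hE, hE₀, hB, hB₀]; ring
    rw [e1, e2] at hup
    linarith
  have hright : crossRatio c A A' a ≤ (D - D') * (C₀ * D) / ((D₀ - D) / 2 * D') := by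
    have e1 : A' - A = D - D' := by rw [hD, hD', hA, hA']; ring
    have e2 : A - c = (D₀ - D) / 2 := by rw [hc, hD₀, hD, hA]; ring
    have e3 : a - A' = D' := by rw [hD', hA']
    have e4 : a - c ≤ C₀ * D := by
      have : a - c = (D + D₀) / 2 := by rw [hc, hD, hD₀, hA]; ring
      linarith
    unfold crossRatio
    rw [e1, e2, e3]
    gcongr
  have hK : 0 < Real.exp (C * N) := Real.exp_pos _
  have hfin := (hlow'.trans hlow).trans (hcr.trans (mul_le_mul_of_nonneg_left hright hK.le))
  obtain ⟨K, hKdef⟩ : ∃ K, K = Real.exp (C * N) := ⟨_, rfl⟩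
  rw [← hKdef] at hfin hK ⊢
  have hμ : 0 < E₀ - E := by linarith
  have hν : 0 < D₀ - D := by linarith
  have hDp : 0 < D := by linarith
  rw [← mul_div_assoc, div_le_div_iff₀ (by positivity) (by positivity)] at hfin
  have e : 2 * C₀ * C₁ * K * ((D - D') / D' * ((E₀ - E) / E)) =
      (2 * C₀ * C₁ * K * ((D - D') * (E₀ - E))) / (D' * E) := by
    field_simp
  rw [e, div_le_div_iff₀ hDp (by positivity)]
  linarith

/-- The total interval is longer than either outer one, so a bounded cross-ratio prevents the middle
interval from being large relative to either neighbour. -/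
lemma le_mul_of_crossRatio_le {t₁ t₂ t₃ t₄ K : ℝ} (h12 : t₁ < t₂) (h23 : t₂ < t₃) (h34 : t₃ < t₄)
    (h : crossRatio t₁ t₂ t₃ t₄ ≤ K) : t₃ - t₂ ≤ K * (t₄ - t₃) ∧ t₃ - t₂ ≤ K * (t₂ - t₁) := by
  unfold crossRatio at h
  rw [div_le_iff₀ (mul_pos (by linarith) (by linarith))] at h
  have hK : 0 < K := by
    by_contra hc
    have h1 : K * ((t₂ - t₁) * (t₄ - t₃)) ≤ 0 :=
      mul_nonpos_of_nonpos_of_nonneg (not_lt.1 hc) (mul_nonneg (by linarith) (by linarith))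
    have h2 : 0 < (t₃ - t₂) * (t₄ - t₁) := mul_pos (by linarith) (by linarith)
    linarith
  constructor
  · have h1 : (t₃ - t₂) * (t₂ - t₁) ≤ (t₃ - t₂) * (t₄ - t₁) :=
      mul_le_mul_of_nonneg_left (by linarith) (by linarith)
    exact le_of_mul_le_mul_right (a := t₂ - t₁) (by linarith) (by linarith)
  · have h1 : (t₃ - t₂) * (t₄ - t₃) ≤ (t₃ - t₂) * (t₄ - t₁) :=
      mul_le_mul_of_nonneg_left (by linarith) (by linarith)
    exact le_of_mul_le_mul_right (a := t₄ - t₃) (by linarith) (by linarith)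

/-! ### A definite portion of each preimage over a short end of the flat interval -/

set_option maxHeartbeats 1000000 in
/-- In a preimage of the flat interval, a definite portion at one end is mapped to an interval
whose length is the distance of a closest return. -/
lemma exists_portion_left {F : CircleDeg1Lift} {a b C C₀ C₁ c₂ η ε : ℝ} {N : ℕ}
    (hF : IsFlatLift F a b)
    (hC : HasCrossBound F a b C) (hC₁ : 0 < C₁) (hC₀ : 0 < C₀)
    (hU : ∀ x y : ℝ, b < x → x < y → y < a + 1 →
      y - b ≤ C₀ * (x - b) → (F y - F x) * (x - b) ≤ C₁ * ((y - x) * (F x - F b)))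
    (hc₂ : 0 < c₂) (hLow : ∀ x y : ℝ, b < x → x < y → y < b + η →
      c₂ * ((y - x) * (F x - F b)) ≤ (F y - F x) * (x - b)) (hε : 0 < ε) :
    ∃ K : ℝ, ∀ (p₀ r q q₀ s q₁ i : ℕ) (u₀ v w w₀ us w₁ : ℤ) (D₀ D E₀ E E₁ : ℝ),
    FareyPair F.translationNumber p₀ u₀ r v → 1 ≤ p₀ →
    u₀ - p₀ * F.translationNumber < N * (r * F.translationNumber - v) →
    r * F.translationNumber - v ≤ u₀ - p₀ * F.translationNumber →
    r * F.translationNumber - v < 1 →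
    0 < q * F.translationNumber - w →
    (p₀ + r + q : ℕ) * F.translationNumber - (u₀ + v + w : ℤ) < 0 →
    q * F.translationNumber - w < q₀ * F.translationNumber - w₀ →
    0 < (p₀ + r + q₀ : ℕ) * F.translationNumber - (u₀ + v + w₀ : ℤ) →
    q₀ * F.translationNumber - w₀ < q₁ * F.translationNumber - w₁ →
    FareyPair F.translationNumber s us q₁ w₁ →
    q₁ * F.translationNumber - w₁ < N * (us - s * F.translationNumber) →
    us - s * F.translationNumber ≤ q₁ * F.translationNumber - w₁ →
    1 ≤ q₁ → q₁ * F.translationNumber - w₁ < 1 →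
    p₀ + r ≤ i → i < p₀ + r + (s + q₁) →
    D₀ = a - (F^[p₀] b - u₀) → D = a - (F^[p₀ + r] b - (u₀ + v : ℤ)) →
    E₁ = F^[q₁] b - w₁ - b → E₀ = F^[q₀] b - w₀ - b → E = F^[q] b - w - b →
    D₀ ≤ C₀ * D → E₀ ≤ C₀ * E → D < b - a → E₁ < η → ε * D ≤ D₀ - D → ε * E₀ ≤ E₁ - E₀ →
    ∃ (α α' β : ℝ) (l : ℤ), α < β ∧ F^[i] α = a + l ∧ F^[i] α' = a + D + l ∧ F^[i] β = b + l ∧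
      β - α ≤ K * (α' - α) := by
  obtain ⟨M, hM⟩ : ∃ M, M = Real.exp (C * N) := ⟨_, rfl⟩
  have hMpos : 0 < M := hM ▸ Real.exp_pos _
  obtain ⟨K₃, hK₃⟩ : ∃ K₃, K₃ = (C₁ * C₀ + 1) * (M * ((C₀ + 1) * 2 / ε)) := ⟨_, rfl⟩
  have hK₃pos : 0 < K₃ := by rw [hK₃]; positivity
  refine ⟨1 + M * (K₃ * (1 + 2 / (c₂ * ε))), ?_⟩
  intro p₀ r q q₀ s q₁ i u₀ v w w₀ us w₁ D₀ D E₀ E E₁ hP hp₀ hN hmin hr1 hq hpq hqq₀ hpq₀ hq₀q₁ hP'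
    hN' hmin' hq₁ hq₁1 hpi hi hD₀ hD hE₁ hE₀ hE hDC hEC hDab hE₁η hDε hEε
  have hR := hP.right
  have hL := hP.left
  have hab := hF.lt
  -- `[z, zb]` is the preimage of order `p₀ + r` of the flat interval lying between the right
  -- returns `B` and `B₀`, and `[z, z']` is its part over `[a, a + D]`.
  obtain ⟨z, hz⟩ := hF.surjective_iterate (p₀ + r) (a + (u₀ + v : ℤ))
  obtain ⟨z', hz'⟩ := hF.surjective_iterate (p₀ + r) (a + D + (u₀ + v : ℤ))
  obtain ⟨zb, hzb⟩ := hF.surjective_iterate (p₀ + r) (b + (u₀ + v : ℤ))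
  obtain ⟨B, hB⟩ : ∃ B, B = F^[q] b - w := ⟨_, rfl⟩
  obtain ⟨B₀, hB₀⟩ : ∃ B₀, B₀ = F^[q₀] b - w₀ := ⟨_, rfl⟩
  obtain ⟨B₁, hB₁⟩ : ∃ B₁, B₁ = F^[q₁] b - w₁ := ⟨_, rfl⟩
  obtain ⟨A, hA⟩ : ∃ A, A = F^[p₀ + r] b - (u₀ + v : ℤ) := ⟨_, rfl⟩
  have eE : E = B - b := by rw [hE, hB]
  have eE₀ : E₀ = B₀ - b := by rw [hE₀, hB₀]
  have eE₁ : E₁ = B₁ - b := by rw [hE₁, hB₁]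
  have eD : D = a - A := by rw [hD, hA]
  have hDpos : 0 < D := by
    have := hF.iterate_lt_left (k := p₀ + r) (l := u₀ + v) (by omega)
      (by push_cast at hpq ⊢; linarith)
    linarith
  have hDD₀ : D < D₀ := by
    have := iterate_sub_lt_iterate_sub (F := F) (j := p₀) (k := p₀ + r) (l := u₀)
      (m := u₀ + v) (by push_cast; linarith) b
    linarith
  have hEpos : 0 < E := by
    have := lt_iterate_right (b := b) hq
    linarith
  have hEE₀ : E < E₀ := by
    have := iterate_sub_lt_iterate_sub hqq₀ b
    linarith
  have hE₀E₁ : E₀ < E₁ := by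
    have := iterate_sub_lt_iterate_sub hq₀q₁ b
    linarith
  have hB₁1 : B₁ < a + 1 := hB₁ ▸ hF.iterate_lt_add_one hq₁ hq₁1
  have hFB : F^[p₀ + r] B < a + (u₀ + v : ℤ) := by
    have := hF.iterate_lt_left (k := p₀ + r + q) (by omega) hpq
    rw [hB, iterate_sub_int, ← Function.iterate_add_apply]
    push_cast at this ⊢; linarith
  have hFB₀ : b + (u₀ + v : ℤ) < F^[p₀ + r] B₀ := by
    have := lt_iterate_right (b := b) hpq₀
    rw [hB₀, iterate_sub_int, ← Function.iterate_add_apply]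
    push_cast at this ⊢; linarith
  have hBz : B < z := lt_of_iterate_lt (F := F) (m := p₀ + r) (by rw [hz]; exact hFB)
  have hzz' : z < z' := lt_of_iterate_lt (F := F) (m := p₀ + r) (by rw [hz, hz']; linarith)
  have hz'b : z' < zb := lt_of_iterate_lt (F := F) (m := p₀ + r) (by rw [hz', hzb]; linarith)
  have hzbB₀ : zb < B₀ := lt_of_iterate_lt (F := F) (m := p₀ + r) (by rw [hzb]; linarith)
  -- Halfway to the preceding return from the right, to stay strictly inside the range of the second
  -- pull-back.
  obtain ⟨Bm, hBm⟩ : ∃ Bm, Bm = (B₀ + B₁) / 2 := ⟨_, rfl⟩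
  have hFmono : ∀ {x y : ℝ}, b ≤ x → x < y → y ≤ a + 1 → F x < F y := fun hx hxy hy =>
    hF.strictMonoOn ⟨hx, hxy.le.trans hy⟩ ⟨hx.trans hxy.le, hy⟩ hxy
  have m1 : F b < F B := hFmono le_rfl (by linarith) (by linarith)
  have m2 : F B < F z := hFmono (by linarith) hBz (by linarith)
  have m3 : F z < F z' := hFmono (by linarith) hzz' (by linarith)
  have m4 : F z' < F zb := hFmono (by linarith) hz'b (by linarith)
  have m5 : F zb < F B₀ := hFmono (by linarith) hzbB₀ (by linarith)
  have m6 : F B₀ < F Bm := hFmono (by linarith) (by linarith) (by linarith)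
  have hpred : ∀ x, F^[p₀ + r - 1] (F x) = F^[p₀ + r] x := fun x => by
    rw [← Function.iterate_succ_apply]; congr 2; omega
  -- the portion adjacent to the near end, seen around the critical value
  have step1 : F z - F b ≤ M * ((C₀ + 1) * 2 / ε) * (F z' - F z) := by
    obtain ⟨c, hc⟩ : ∃ c, c = (A + (F^[p₀] b - u₀)) / 2 := ⟨_, rfl⟩
    have eAc : A - c = (D₀ - D) / 2 := by rw [hc, hD₀, eD]; ring
    obtain ⟨t₁, ht₁⟩ := hF.surjective_iterate (p₀ + r - 1) (c + (u₀ + v : ℤ))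
    have ht₁b : t₁ < F b := lt_of_iterate_lt (F := F) (m := p₀ + r - 1) (by
      rw [hpred, ht₁]; linarith)
    have hcr := crossRatio_pullback_left hF hC hP (by omega) hN hmin hr1 (s₁ := c) (s₂ := A)
      (s₃ := a) (s₄ := a + D) (t₁ := t₁) (t₂ := F b) (t₃ := F z) (t₄ := F z') (by linarith)
      (by linarith) (by linarith) (by linarith) (by linarith) ht₁ (by rw [hpred, hA]; ring)
      (by rw [hpred, hz]) (by rw [hpred, hz'])
    -- The inequalities ε D ≤ D₀ - D and D₀ ≤ C₀ D make the lengths of this configuration comparable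
    -- with D.
    have hright : crossRatio c A a (a + D) ≤ (C₀ + 1) * 2 / ε := by
      have e4 : a + D - c ≤ (C₀ + 1) * D := by
        have : a - c = (D + D₀) / 2 := by rw [hc, hD₀, eD]; ring
        linarith
      unfold crossRatio
      rw [show a + D - a = D by ring, ← eD, eAc, div_le_div_iff₀ (mul_pos (by linarith) hDpos) hε]
      have h1 : D * (a + D - c) * ε ≤ D * ((C₀ + 1) * D) * ε := by gcongr
      have h2 : (C₀ + 1) * D * (ε * D) ≤ (C₀ + 1) * D * (D₀ - D) :=
        mul_le_mul_of_nonneg_left hDε (by positivity)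
      linarith
    rw [← hM] at hcr
    exact (le_mul_of_crossRatio_le ht₁b (by linarith) (by linarith)
      (hcr.trans (mul_le_mul_of_nonneg_left hright hMpos.le))).1
  -- The preimage lies between `B` and `B₀`. Since E₀ ≤ C₀ E, the end bound gives F B₀ - F B a
  -- length at most a multiple of F B - F b, hence of F z - F b, which step 1 controls.
  have step2 : F zb - F z ≤ K₃ * (F z' - F z) := by
    have hEC' : B₀ - b ≤ C₀ * (B - b) := by rwa [← eE₀, ← eE]
    have hup := hU B B₀ (by linarith) (by linarith) (by linarith) hEC'
    have h1 : (F B₀ - F B) ≤ C₁ * C₀ * (F B - F b) := by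
      have h2 : (B₀ - B) * (F B - F b) ≤ C₀ * (B - b) * (F B - F b) :=
        mul_le_mul_of_nonneg_right (by linarith) (by linarith)
      have h3 : C₁ * ((B₀ - B) * (F B - F b)) ≤ C₁ * (C₀ * (B - b) * (F B - F b)) :=
        mul_le_mul_of_nonneg_left h2 hC₁.le
      exact le_of_mul_le_mul_right (a := B - b) (by linarith) (by linarith)
    have h2 : F zb - F z ≤ (C₁ * C₀ + 1) * (F z - F b) := by
      have : C₁ * C₀ * (F B - F b) ≤ C₁ * C₀ * (F z - F b) :=
        mul_le_mul_of_nonneg_left (by linarith) (by positivity)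
      linarith
    calc _ ≤ _ := h2
      _ ≤ (C₁ * C₀ + 1) * (M * ((C₀ + 1) * 2 / ε) * (F z' - F z)) :=
        mul_le_mul_of_nonneg_left step1 (by positivity)
      _ = _ := by rw [hK₃]; ring
  -- Room on the far side: here the lower bound ε E₀ ≤ E₁ - E₀ on a step ratio and the lower end
  -- bound are needed.
  have step3 : c₂ * ε / 2 * (F zb - F z) ≤ F Bm - F zb := by
    have hlo := hLow B₀ Bm (by linarith) (by linarith) (by linarith)
    have h1 : ε / 2 * (B₀ - b) ≤ Bm - B₀ := by rw [hBm, ← eE₀]; linarith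
    have h2 : c₂ * (ε / 2 * (B₀ - b) * (F B₀ - F b)) ≤ c₂ * ((Bm - B₀) * (F B₀ - F b)) :=
      mul_le_mul_of_nonneg_left (mul_le_mul_of_nonneg_right h1 (by linarith)) hc₂.le
    have h3 : c₂ * ε / 2 * (F B₀ - F b) ≤ F Bm - F B₀ :=
      le_of_mul_le_mul_right (a := B₀ - b) (by linarith) (by linarith)
    have h4 : c₂ * ε / 2 * (F zb - F z) ≤ c₂ * ε / 2 * (F B₀ - F b) :=
      mul_le_mul_of_nonneg_left (by linarith) (by positivity)
    linarith
  -- The last `p₀ + r - 1` of the `i` steps start at the critical value and are treated by step 1;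
  -- the first `m ≤ s + q₁` steps, which end at points `F x`, are treated by
  -- `crossRatio_pullback_right`.
  obtain ⟨m, rfl⟩ : ∃ m, i = p₀ + r - 1 + m := ⟨i - (p₀ + r - 1), by omega⟩
  obtain ⟨α, hα⟩ := hF.surjective_iterate m (F z)
  obtain ⟨α', hα'⟩ := hF.surjective_iterate m (F z')
  obtain ⟨β, hβ⟩ := hF.surjective_iterate m (F zb)
  obtain ⟨γ, hγ⟩ := hF.surjective_iterate m (F Bm)
  have n1 : α < α' := lt_of_iterate_lt (F := F) (m := m) (by rw [hα, hα']; exact m3)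
  have n2 : α' < β := lt_of_iterate_lt (F := F) (m := m) (by rw [hα', hβ]; exact m4)
  have n3 : β < γ := lt_of_iterate_lt (F := F) (m := m) (by rw [hβ, hγ]; linarith)
  have hcr := crossRatio_pullback_right hF hC hP' (m := m) (by omega) hN' hmin' hq₁ hq₁1
    (x₁ := z) (x₂ := z') (x₃ := zb) (x₄ := Bm) (by linarith) hzz' hz'b (by linarith) (by linarith)
    hα hα' hβ hγ
  have hright : crossRatio (F z) (F z') (F zb) (F Bm) ≤ K₃ * (1 + 2 / (c₂ * ε)) := by
    unfold crossRatio
    rw [mul_div_mul_comm]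
    apply mul_le_mul _ _ (div_nonneg (by linarith) (by linarith)) hK₃pos.le
    · rw [div_le_iff₀ (sub_pos.2 m3)]
      exact (sub_le_sub_left m3.le _).trans step2
    · rw [div_le_iff₀ (sub_pos.2 (m5.trans m6))]
      have h1 : F zb - F z ≤ 2 / (c₂ * ε) * (F Bm - F zb) := by
        rw [div_mul_eq_mul_div, le_div_iff₀ (by positivity)]
        calc _ = 2 * (c₂ * ε / 2 * (F zb - F z)) := by ring
          _ ≤ _ := mul_le_mul_of_nonneg_left step3 (by norm_num)
      calc F Bm - F z = (F Bm - F zb) + (F zb - F z) := by ring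
        _ ≤ (F Bm - F zb) + 2 / (c₂ * ε) * (F Bm - F zb) := add_le_add le_rfl h1
        _ = _ := by ring
  rw [← hM] at hcr
  have hfin := (le_mul_of_crossRatio_le n1 n2 n3
      (hcr.trans (mul_le_mul_of_nonneg_left hright hMpos.le))).2
  refine ⟨α, α', β, u₀ + v, n1.trans n2, ?_, ?_, ?_, ?_⟩
  · rw [Function.iterate_add_apply, hα, hpred, hz]
  · rw [Function.iterate_add_apply, hα', hpred, hz']
  · rw [Function.iterate_add_apply, hβ, hpred, hzb]
  · calc β - α = (α' - α) + (β - α') := by ring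
      _ ≤ (α' - α) + M * (K₃ * (1 + 2 / (c₂ * ε))) * (α' - α) := add_le_add le_rfl hfin
      _ = _ := by ring

/-! ### Closest returns of a continued fraction and their distances -/

lemma FareyPair.reflect {τ : ℝ} {p q : ℕ} {u v : ℤ} (h : FareyPair τ p u q v) :
    FareyPair (-τ) q (-v) p (-u) where
  left := by have := h.right; push_cast; linarith
  right := by have := h.left; push_cast; linarith
  det := by linarith [h.det]

/-- Intermediate returns also form Farey pairs, as long as the rotation has not crossed zero; this
is what makes the estimates available between `Q n` and `Q (n + 2)`. -/
lemma FareyPair.add_mul {τ : ℝ} {p q : ℕ} {u v : ℤ} (h : FareyPair τ p u q v) (k : ℕ)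
    (hk : (p + k * q : ℕ) * τ - (u + k * v : ℤ) < 0) :
    FareyPair τ (p + k * q) (u + k * v) q v where
  left := hk
  right := h.right
  det := by push_cast; linarith [h.det]

/-- The sequences of denominators `Q` and numerators `L` of the convergents of `τ`, with the partial
quotients `A`. -/
structure IsReturnSequence (τ : ℝ) (Q : ℕ → ℕ) (L : ℕ → ℤ) (A : ℕ → ℕ) : Prop where
  one_le : ∀ n, 1 ≤ Q n
  one_le_quot : ∀ n, 1 ≤ A n
  add_two : ∀ n, Q (n + 2) = Q n + A n * Q (n + 1)
  add_two' : ∀ n, L (n + 2) = L n + A n * L (n + 1)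
  farey_left : ∀ n, Q n * τ - L n < 0 → FareyPair τ (Q n) (L n) (Q (n + 1)) (L (n + 1))
  farey_right : ∀ n, 0 < Q n * τ - L n → FareyPair τ (Q (n + 1)) (L (n + 1)) (Q n) (L n)
  abs_lt_one : ∀ n, |Q n * τ - L n| < 1

lemma IsReturnSequence.reflect {τ : ℝ} {Q : ℕ → ℕ} {L : ℕ → ℤ} {A : ℕ → ℕ}
    (h : IsReturnSequence τ Q L A) : IsReturnSequence (-τ) Q (fun n => -L n) A where
  one_le := h.one_le
  one_le_quot := h.one_le_quot
  add_two := h.add_two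
  add_two' n := by rw [h.add_two' n]; ring
  farey_left n hn := (h.farey_right n (by push_cast at hn; linarith)).reflect
  farey_right n hn := (h.farey_left n (by push_cast at hn; linarith)).reflect
  abs_lt_one n := by
    have := h.abs_lt_one n
    rw [← abs_neg] at this
    convert this using 2
    push_cast; ring

/-- The distance from the translate of the `k`-th image of the flat interval to that interval. -/
def gap (F : CircleDeg1Lift) (a b : ℝ) (k : ℕ) (l : ℤ) : ℝ :=
  max (a - (F^[k] b - l)) (F^[k] b - l - b)

lemma IsFlatLift.gap_left {F : CircleDeg1Lift} {a b : ℝ} (h : IsFlatLift F a b) {k : ℕ}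
    (hk : 1 ≤ k) {l : ℤ} (hl : k * F.translationNumber - l < 0) :
    gap F a b k l = a - (F^[k] b - l) := by
  have := h.iterate_lt_left hk hl
  have := h.lt
  exact max_eq_left (by linarith)

lemma IsFlatLift.gap_right {F : CircleDeg1Lift} {a b : ℝ} (h : IsFlatLift F a b) {k : ℕ}
    {l : ℤ} (hl : 0 < k * F.translationNumber - l) :
    gap F a b k l = F^[k] b - l - b := by
  have := lt_iterate_right (b := b) hl
  have := h.lt
  exact max_eq_right (by linarith)

lemma IsFlatLift.gap_pos {F : CircleDeg1Lift} {a b : ℝ} (h : IsFlatLift F a b) {k : ℕ}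
    (hk : 1 ≤ k) (l : ℤ) : 0 < gap F a b k l := by
  rcases lt_or_gt_of_ne (rotation_ne_zero h.irrational hk l) with hl | hl
  · rw [h.gap_left hk hl]
    linarith [h.iterate_lt_left hk hl]
  · rw [h.gap_right hl]
    linarith [lt_iterate_right (b := b) hl]

lemma IsFlatLift.gap_reflect {F : CircleDeg1Lift} {a b : ℝ} (h : IsFlatLift F a b) {k : ℕ}
    (hk : 1 ≤ k) (l : ℤ) : gap (FlatCircle.reflect F) (-b) (-a) k (-l) = gap F a b k l := by
  unfold gap
  rw [reflect_iterate, neg_neg, h.iterate_eq hk, max_comm]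
  push_cast
  congr 1 <;> ring

/-! ### Lower bound for step ratios from their recursion -/

/-- If consecutive ratios `s n j` of return distances satisfy the recursive inequalities, then they
are bounded away from zero. -/
lemma exists_ratio_lower_bound {A : ℕ → ℕ} {M : ℕ} {s : ℕ → ℕ → ℝ} {K C₀ : ℝ}
    (hA : ∀ n, 1 ≤ A n) (hM : ∀ n, A n ≤ M) (hK : 0 < K)
    (hpos : ∀ n j, j < A n → 0 < s n j) (hle : ∀ n j, j < A n → s n j ≤ C₀)
    (h0 : ∀ n, s n (A n - 1) ≤ K * (s (n + 2) 0 * s (n + 1) (A (n + 1) - 1)))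
    (h1 : ∀ n j, j + 1 < A (n + 2) →
      s (n + 2) j ≤ K * (s (n + 2) (j + 1) * s (n + 1) (A (n + 1) - 1))) :
    ∃ ε : ℝ, 0 < ε ∧ ∀ n, ε ≤ s n (A n - 1) ∧ ∀ j, j < A (n + 2) → ε ≤ s (n + 2) j := by
  have hC₀ : 0 < C₀ := (hpos 0 0 (hA 0)).trans_le (hle 0 0 (hA 0))
  -- Enlarging `K` makes K₁ C₀ ≥ 1, so that powers of it are increasing.
  obtain ⟨K₁, hK₁⟩ : ∃ K₁, K₁ = max K (1 / C₀) := ⟨_, rfl⟩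
  have hKK₁ : K ≤ K₁ := hK₁ ▸ le_max_left _ _
  have hK₁pos : 0 < K₁ := hK.trans_le hKK₁
  have hK₁C : 1 ≤ K₁ * C₀ := by
    rw [← div_le_iff₀ hC₀]; exact hK₁ ▸ le_max_right _ _
  obtain ⟨m, hm⟩ : ∃ m : ℕ → ℝ, m = fun n => s n (A n - 1) := ⟨_, rfl⟩
  have hlast : ∀ n, A n - 1 < A n := fun n => by have := hA n; omega
  have hmpos : ∀ n, 0 < m n := fun n => hm ▸ hpos n _ (hlast n)
  have h0' : ∀ n, m n ≤ K₁ * (s (n + 2) 0 * m (n + 1)) := fun n => by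
    rw [hm]
    exact (h0 n).trans (mul_le_mul_of_nonneg_right hKK₁
      (mul_nonneg (hpos _ _ (hA _)).le (hpos _ _ (hlast _)).le))
  have h1' : ∀ n j, j + 1 < A (n + 2) → s (n + 2) j ≤ K₁ * (s (n + 2) (j + 1) * m (n + 1)) := by
    intro n j hj
    rw [hm]
    exact (h1 n j hj).trans (mul_le_mul_of_nonneg_right hKK₁
      (mul_nonneg (hpos _ _ hj).le (hpos _ _ (hlast _)).le))
  have hA' : ∀ n, m n ≤ K₁ * C₀ * m (n + 1) := fun n => by
    refine (h0' n).trans ?_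
    rw [mul_assoc]
    have := hle (n + 2) 0 (hA _)
    have := hmpos (n + 1)
    gcongr
  -- Chosen so that m (n + 2) < ε₀ forces K₁ m (n + 1) ≤ 1, because m (n + 1) ≤ K₁ C₀ m (n + 2).
  obtain ⟨ε₀, hε₀⟩ : ∃ ε₀, ε₀ = 1 / (K₁ * (K₁ * C₀)) := ⟨_, rfl⟩
  have hε₀pos : 0 < ε₀ := by rw [hε₀]; positivity
  -- Once K₁ m (n + 1) ≤ 1 the recursion says that the ratios of level `n + 2` do not decrease in
  -- `j` and start above m n. Hence m (n + 2) ≥ min ε₀ (m n), and no decay is possible.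
  have hdesc : ∀ n, m (n + 2) < ε₀ → m n ≤ m (n + 2) := by
    intro n hn
    have h2 : K₁ * m (n + 1) ≤ 1 := by
      rw [hε₀, lt_div_iff₀ (by positivity)] at hn
      have := mul_le_mul_of_nonneg_left (hA' (n + 1)) hK₁pos.le
      nlinarith
    have hmon : ∀ j, j < A (n + 2) → s (n + 2) 0 ≤ s (n + 2) j := by
      intro j
      induction j with
      | zero => intro _; exact le_rfl
      | succ j ih =>
        intro hj
        refine (ih (by omega)).trans ((h1' n j hj).trans ?_)
        have := mul_le_mul_of_nonneg_left h2 (hpos _ _ hj).le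
        linarith
    have h3 := hmon _ (hlast (n + 2))
    have h4 : s (n + 2) (A (n + 2) - 1) = m (n + 2) := by rw [hm]
    rw [h4] at h3
    have h5 : s (n + 2) 0 * (K₁ * m (n + 1)) ≤ s (n + 2) 0 * 1 :=
      mul_le_mul_of_nonneg_left h2 (hpos _ _ (hA _)).le
    linarith [h0' n]
  obtain ⟨ε₁, hε₁⟩ : ∃ ε₁, ε₁ = min ε₀ (min (m 0) (m 1)) := ⟨_, rfl⟩
  have hε₁pos : 0 < ε₁ := hε₁ ▸ lt_min hε₀pos (lt_min (hmpos 0) (hmpos 1))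
  have hmlow : ∀ n, ε₁ ≤ m n ∧ ε₁ ≤ m (n + 1) := by
    intro n
    induction n with
    | zero =>
      rw [hε₁]
      exact ⟨(min_le_right _ _).trans (min_le_left _ _), (min_le_right _ _).trans (min_le_right _ _)⟩
    | succ n ih =>
      refine ⟨ih.2, ?_⟩
      by_cases h : m (n + 2) < ε₀
      · exact ih.1.trans (hdesc n h)
      · exact (hε₁ ▸ min_le_left _ _ : ε₁ ≤ ε₀).trans (not_lt.1 h)
  -- The other ratios follow from the last ones, losing a factor K₁ C₀ with each `j`; bounded type
  -- keeps the number of factors at most `M + 1`.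
  have hstep : ∀ n j, j < A (n + 2) → ε₁ / (K₁ * C₀) ^ (j + 1) ≤ s (n + 2) j := by
    intro n j
    induction j with
    | zero =>
      intro _
      rw [div_le_iff₀ (by positivity), zero_add, pow_one]
      refine (hmlow n).1.trans ((h0' n).trans ?_)
      have := hle (n + 1) _ (hlast (n + 1))
      have h6 : m (n + 1) ≤ C₀ := by rw [hm]; exact this
      have := hpos (n + 2) 0 (hA _)
      calc K₁ * (s (n + 2) 0 * m (n + 1)) ≤ K₁ * (s (n + 2) 0 * C₀) := by gcongr
        _ = _ := by ring
    | succ j ih =>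
      intro hj
      have := ih (by omega)
      rw [div_le_iff₀ (by positivity)] at this ⊢
      refine this.trans ?_
      have h7 := h1' n j hj
      have h6 : m (n + 1) ≤ C₀ := by rw [hm]; exact hle (n + 1) _ (hlast (n + 1))
      have h8 := hpos (n + 2) (j + 1) hj
      have h9 : s (n + 2) j ≤ s (n + 2) (j + 1) * (K₁ * C₀) :=
        h7.trans (by
          calc K₁ * (s (n + 2) (j + 1) * m (n + 1)) ≤ K₁ * (s (n + 2) (j + 1) * C₀) := by gcongr
            _ = _ := by ring)
      calc s (n + 2) j * (K₁ * C₀) ^ (j + 1)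
          ≤ s (n + 2) (j + 1) * (K₁ * C₀) * (K₁ * C₀) ^ (j + 1) :=
            mul_le_mul_of_nonneg_right h9 (by positivity)
        _ = _ := by ring
  refine ⟨ε₁ / (K₁ * C₀) ^ (M + 1), by positivity, fun n => ⟨?_, fun j hj => ?_⟩⟩
  · have h10 : ε₁ / (K₁ * C₀) ^ (M + 1) ≤ ε₁ := div_le_self hε₁pos.le (one_le_pow₀ hK₁C)
    have h11 := (hmlow n).1
    rw [hm] at h11
    exact h10.trans h11
  · refine le_trans ?_ (hstep n j hj)
    have := hM (n + 2)
    exact div_le_div_of_nonneg_left hε₁pos.le (by positivity) (pow_le_pow_right₀ hK₁C (by omega))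

lemma FareyPair.mul_add {τ : ℝ} {p q : ℕ} {u v : ℤ} (h : FareyPair τ p u q v) (k : ℕ)
    (hk : 0 < (q + k * p : ℕ) * τ - (v + k * u : ℤ)) :
    FareyPair τ p u (q + k * p) (v + k * u) where
  left := h.left
  right := hk
  det := by push_cast; linarith [h.det]

/-- The time of the `j`-th intermediate closest return between `Q n` and `Q (n + 2)`. -/
def midTime (Q : ℕ → ℕ) (n j : ℕ) : ℕ := Q n + j * Q (n + 1)

/-- The translation that belongs to an intermediate closest return. -/
def midShift (L : ℕ → ℤ) (n j : ℕ) : ℤ := L n + j * L (n + 1)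

/-- The distance of an intermediate closest return. -/
def returnGap (F : CircleDeg1Lift) (a b : ℝ) (Q : ℕ → ℕ) (L : ℕ → ℤ) (n j : ℕ) : ℝ :=
  gap F a b (midTime Q n j) (midShift L n j)

/-- The relative change of the distance from one intermediate closest return to the next. -/
def stepRatio (F : CircleDeg1Lift) (a b : ℝ) (Q : ℕ → ℕ) (L : ℕ → ℤ) (n j : ℕ) : ℝ :=
  (returnGap F a b Q L n j - returnGap F a b Q L n (j + 1)) / returnGap F a b Q L n (j + 1)

lemma midTime_zero (Q : ℕ → ℕ) (n : ℕ) : midTime Q n 0 = Q n := by simp [midTime]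

lemma midShift_zero (L : ℕ → ℤ) (n : ℕ) : midShift L n 0 = L n := by simp [midShift]

lemma midTime_succ (Q : ℕ → ℕ) (n j : ℕ) : midTime Q n (j + 1) = midTime Q n j + Q (n + 1) := by
  unfold midTime; ring

lemma midShift_succ (L : ℕ → ℤ) (n j : ℕ) :
    midShift L n (j + 1) = midShift L n j + L (n + 1) := by
  unfold midShift; push_cast; ring

lemma midShift_neg (L : ℕ → ℤ) (n j : ℕ) :
    midShift (fun n => -L n) n j = -midShift L n j := by
  unfold midShift; ring

lemma mid_rotation (Q : ℕ → ℕ) (L : ℕ → ℤ) (τ : ℝ) (n j : ℕ) :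
    midTime Q n j * τ - midShift L n j = (Q n * τ - L n) + j * (Q (n + 1) * τ - L (n + 1)) := by
  unfold midTime midShift; push_cast; ring

namespace IsReturnSequence

variable {τ : ℝ} {Q : ℕ → ℕ} {L : ℕ → ℤ} {A : ℕ → ℕ}

lemma midTime_quot (h : IsReturnSequence τ Q L A) (n : ℕ) : midTime Q n (A n) = Q (n + 2) :=
  (h.add_two n).symm

lemma midShift_quot (h : IsReturnSequence τ Q L A) (n : ℕ) : midShift L n (A n) = L (n + 2) :=
  (h.add_two' n).symm

lemma one_le_midTime (h : IsReturnSequence τ Q L A) (n j : ℕ) : 1 ≤ midTime Q n j :=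
  (h.one_le n).trans (Nat.le_add_right _ _)

lemma rotation_add_two (h : IsReturnSequence τ Q L A) (n : ℕ) :
    Q (n + 2) * τ - L (n + 2) = (Q n * τ - L n) + A n * (Q (n + 1) * τ - L (n + 1)) := by
  rw [← h.midTime_quot, ← h.midShift_quot, mid_rotation]

lemma neg_of_pos (h : IsReturnSequence τ Q L A) {n : ℕ} (hn : 0 < Q n * τ - L n) :
    Q (n + 1) * τ - L (n + 1) < 0 := (h.farey_right n hn).left

lemma pos_of_neg (h : IsReturnSequence τ Q L A) {n : ℕ} (hn : Q n * τ - L n < 0) :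
    0 < Q (n + 1) * τ - L (n + 1) := (h.farey_left n hn).right

lemma mid_neg (h : IsReturnSequence τ Q L A) {n : ℕ} (hn : Q n * τ - L n < 0) {j : ℕ}
    (hj : j ≤ A n) : midTime Q n j * τ - midShift L n j < 0 := by
  have h1 := h.pos_of_neg hn
  have h2 := h.neg_of_pos h1
  have h3 := h.rotation_add_two n
  rw [mid_rotation]
  have : (j : ℝ) * (Q (n + 1) * τ - L (n + 1)) ≤ A n * (Q (n + 1) * τ - L (n + 1)) :=
    mul_le_mul_of_nonneg_right (by exact_mod_cast hj) h1.le
  linarith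

lemma mid_pos (h : IsReturnSequence τ Q L A) {n : ℕ} (hn : 0 < Q n * τ - L n) {j : ℕ}
    (hj : j ≤ A n) : 0 < midTime Q n j * τ - midShift L n j := by
  have := h.reflect.mid_neg (n := n) (by push_cast; linarith) hj
  rw [midShift_neg] at this
  push_cast at this; linarith

lemma add_lt_zero (h : IsReturnSequence τ Q L A) {n : ℕ} (hn : Q n * τ - L n < 0) :
    (Q n * τ - L n) + (Q (n + 1) * τ - L (n + 1)) < 0 := by
  have := h.mid_neg hn (h.one_le_quot n)
  rw [mid_rotation] at this
  simpa using this

lemma zero_lt_add (h : IsReturnSequence τ Q L A) {n : ℕ} (hn : 0 < Q n * τ - L n) :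
    0 < (Q n * τ - L n) + (Q (n + 1) * τ - L (n + 1)) := by
  have := h.mid_pos hn (h.one_le_quot n)
  rw [mid_rotation] at this
  simpa using this

lemma lt_succ (h : IsReturnSequence τ Q L A) (n : ℕ) : Q (n + 1) < Q (n + 2) := by
  rw [h.add_two]
  have := h.one_le n
  have := h.one_le_quot n
  nlinarith

lemma exists_between (h : IsReturnSequence τ Q L A) {n₀ i : ℕ} (hi : Q n₀ ≤ i) :
    ∃ n, n₀ ≤ n ∧ Q n ≤ i ∧ i < Q (n + 1) := by
  have hgrow : ∀ k, k ≤ Q (k + 1) := by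
    intro k
    induction k with
    | zero => exact Nat.zero_le _
    | succ k ih => exact Nat.succ_le_of_lt (ih.trans_lt (h.lt_succ k))
  by_contra hcon
  push Not at hcon
  have hall : ∀ k, Q (n₀ + k) ≤ i := by
    intro k
    induction k with
    | zero => exact hi
    | succ k ih => exact hcon _ (Nat.le_add_right _ _) ih
  have h1 := hall (i + 2)
  have h2 := hgrow (n₀ + i + 1)
  rw [show n₀ + i + 1 + 1 = n₀ + (i + 2) by ring] at h2
  omega

end IsReturnSequence

/-! ### Step ratios of the return distances -/

section Returns

variable {F : CircleDeg1Lift} {a b C : ℝ} {Q : ℕ → ℕ} {L : ℕ → ℤ} {A : ℕ → ℕ}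

lemma returnGap_reflect (hF : IsFlatLift F a b) (hT : IsReturnSequence F.translationNumber Q L A)
    (n j : ℕ) :
    returnGap (reflect F) (-b) (-a) Q (fun n => -L n) n j = returnGap F a b Q L n j := by
  unfold returnGap
  rw [midShift_neg, hF.gap_reflect (hT.one_le_midTime n j)]

lemma stepRatio_reflect (hF : IsFlatLift F a b) (hT : IsReturnSequence F.translationNumber Q L A)
    (n j : ℕ) :
    stepRatio (reflect F) (-b) (-a) Q (fun n => -L n) n j = stepRatio F a b Q L n j := by
  unfold stepRatio
  simp only [returnGap_reflect hF hT]

lemma returnGap_pos (hF : IsFlatLift F a b) (hT : IsReturnSequence F.translationNumber Q L A)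
    (n j : ℕ) : 0 < returnGap F a b Q L n j :=
  hF.gap_pos (hT.one_le_midTime n j) _

lemma returnGap_quot (hT : IsReturnSequence F.translationNumber Q L A) (n : ℕ) :
    returnGap F a b Q L n (A n) = returnGap F a b Q L (n + 2) 0 := by
  unfold returnGap
  rw [hT.midTime_quot, hT.midShift_quot, midTime_zero, midShift_zero]

lemma returnGap_succ_lt_of_neg (hF : IsFlatLift F a b)
    (hT : IsReturnSequence F.translationNumber Q L A) {n j : ℕ} (hj : j < A n)
    (hn : Q n * F.translationNumber - L n < 0) :
    returnGap F a b Q L n (j + 1) < returnGap F a b Q L n j := by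
  unfold returnGap
  rw [hF.gap_left (hT.one_le_midTime _ _) (hT.mid_neg hn hj.le),
    hF.gap_left (hT.one_le_midTime _ _) (hT.mid_neg hn hj)]
  have := iterate_sub_lt_iterate_sub (F := F) (j := midTime Q n j) (k := midTime Q n (j + 1))
    (l := midShift L n j) (m := midShift L n (j + 1)) (by
      rw [mid_rotation, mid_rotation]; push_cast
      linarith [hT.pos_of_neg hn]) b
  linarith

lemma returnGap_succ_lt (hF : IsFlatLift F a b) (hT : IsReturnSequence F.translationNumber Q L A)
    {n j : ℕ} (hj : j < A n) : returnGap F a b Q L n (j + 1) < returnGap F a b Q L n j := by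
  rcases lt_or_gt_of_ne (rotation_ne_zero hF.irrational (hT.one_le n) (L n)) with hn | hn
  · exact returnGap_succ_lt_of_neg hF hT hj hn
  · have := returnGap_succ_lt_of_neg (F := reflect F) hF.reflect (L := fun n => -L n) (Q := Q)
      (A := A) (by simpa using hT.reflect) hj (by simp; linarith)
    rwa [returnGap_reflect hF hT, returnGap_reflect hF hT] at this

lemma returnGap_anti (hF : IsFlatLift F a b) (hT : IsReturnSequence F.translationNumber Q L A)
    {n j k : ℕ} (hjk : j ≤ k) (hk : k ≤ A n) :
    returnGap F a b Q L n k ≤ returnGap F a b Q L n j := by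
  induction k, hjk using Nat.le_induction with
  | base => exact le_rfl
  | succ k hjk ih => exact (returnGap_succ_lt hF hT (by omega)).le.trans (ih (by omega))

/-- Bounded geometry compares only the two ends of a level; monotonicity extends this to all its
intermediate returns. -/
lemma returnGap_le_mul {C₀ : ℝ} (hC₀ : 0 < C₀) (hF : IsFlatLift F a b)
    (hT : IsReturnSequence F.translationNumber Q L A)
    (hBG : ∀ n, returnGap F a b Q L n 0 ≤ C₀ * returnGap F a b Q L (n + 2) 0)
    {n j k : ℕ} (hj : j ≤ A n) (hk : k ≤ A n) :
    returnGap F a b Q L n j ≤ C₀ * returnGap F a b Q L n k :=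
  calc _ ≤ _ := returnGap_anti hF hT (Nat.zero_le _) hj
    _ ≤ _ := hBG n
    _ = C₀ * returnGap F a b Q L n (A n) := by rw [returnGap_quot hT]
    _ ≤ _ := mul_le_mul_of_nonneg_left (returnGap_anti hF hT hk le_rfl) hC₀.le

/-- The estimate `return_ratio_le` for closest returns in terms of convergents. -/
lemma gap_ratio_le {C₀ C₁ : ℝ} {N : ℕ} (hF : IsFlatLift F a b)
    (hC : HasCrossBound F a b C) (hC₁ : 0 < C₁) (hC₀ : 0 < C₀)
    (hU : ∀ x y : ℝ, b < x → x < y → y < a + 1 →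
      y - b ≤ C₀ * (x - b) → (F y - F x) * (x - b) ≤ C₁ * ((y - x) * (F x - F b)))
    (hT : IsReturnSequence F.translationNumber Q L A)
    (hBG : ∀ n, returnGap F a b Q L n 0 ≤ C₀ * returnGap F a b Q L (n + 2) 0)
    {n j : ℕ} (hn : Q (n + 1) * F.translationNumber - L (n + 1) < 0) (hj : j < A (n + 1))
    {p₀ r : ℕ} {u₀ v : ℤ} (hP : FareyPair F.translationNumber p₀ u₀ r v) (hp₀ : 1 ≤ p₀)
    (e1 : p₀ + r = midTime Q (n + 1) j) (e2 : u₀ + v = midShift L (n + 1) j)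
    (hN : u₀ - p₀ * F.translationNumber < N * (r * F.translationNumber - v))
    (hmin : r * F.translationNumber - v ≤ u₀ - p₀ * F.translationNumber)
    (hr1 : r * F.translationNumber - v < 1)
    (hD : gap F a b p₀ u₀ ≤ C₀ * returnGap F a b Q L (n + 1) j) :
    (gap F a b p₀ u₀ - returnGap F a b Q L (n + 1) j) / returnGap F a b Q L (n + 1) j ≤
      2 * C₀ * C₁ * Real.exp (C * N) *
        (stepRatio F a b Q L (n + 1) j * stepRatio F a b Q L n (A n - 1)) := by
  have hθ2 := hT.pos_of_neg hn
  have hθ0 : 0 < Q n * F.translationNumber - L n := by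
    rcases lt_or_gt_of_ne (rotation_ne_zero hF.irrational (hT.one_le n) (L n)) with h | h
    · exact absurd (hT.pos_of_neg h) (not_lt.2 hn.le)
    · exact h
  obtain ⟨k, hk⟩ : ∃ k, A n = k + 1 := ⟨A n - 1, by have := hT.one_le_quot n; omega⟩
  have hq₀ := mid_rotation Q L F.translationNumber n k
  have hq : (Q (n + 2) : ℝ) * F.translationNumber - L (n + 2) =
      midTime Q n k * F.translationNumber - midShift L n k +
        (Q (n + 1) * F.translationNumber - L (n + 1)) := by
    rw [hT.rotation_add_two, hk, hq₀]; push_cast; ring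
  have hpj := mid_rotation Q L F.translationNumber (n + 1) j
  have hneg : (midTime Q (n + 1) j * F.translationNumber - midShift L (n + 1) j : ℝ) < 0 :=
    hT.mid_neg hn hj.le
  have hneg' := hT.mid_neg hn hj
  have hge : (Q (n + 1) * F.translationNumber - L (n + 1) : ℝ) ≤
      midTime Q (n + 1) j * F.translationNumber - midShift L (n + 1) j := by
    rw [hpj]
    have : 0 ≤ (j : ℝ) * (Q (n + 2) * F.translationNumber - L (n + 2)) := by positivity
    linarith
  have hq₀1 : (midTime Q n k * F.translationNumber - midShift L n k : ℝ) < 1 := by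
    rw [hq₀]
    have h1 := (abs_lt.1 (hT.abs_lt_one n)).2
    have : (k : ℝ) * (Q (n + 1) * F.translationNumber - L (n + 1)) ≤ 0 :=
      mul_nonpos_of_nonneg_of_nonpos (by positivity) hn.le
    linarith
  have hL := hP.left
  unfold stepRatio
  rw [show A n - 1 = k by omega, show k + 1 = A n by omega]
  have main := return_ratio_le (q := Q (n + 2)) (w := L (n + 2)) (q₀ := midTime Q n k)
    (w₀ := midShift L n k) (D₀ := gap F a b p₀ u₀) (D := returnGap F a b Q L (n + 1) j)
    (D' := returnGap F a b Q L (n + 1) (j + 1)) (E₀ := returnGap F a b Q L n k)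
    (E := returnGap F a b Q L n (A n)) hF hC hC₁ hU hP hp₀ hN hmin hr1 hθ2
    (by rw [e1, e2, ← midTime_succ, ← midShift_succ]; exact hneg')
    (hT.one_le_midTime _ _) hq₀1 (by linarith)
    (by rw [e1, e2]; push_cast; linarith)
    (hF.gap_left hp₀ hL)
    (by rw [e1, e2]; exact hF.gap_left (hT.one_le_midTime _ _) hneg)
    (by rw [e1, e2, ← midTime_succ, ← midShift_succ]
        exact hF.gap_left (hT.one_le_midTime _ _) hneg')
    (hF.gap_right (hT.mid_pos hθ0 (by omega)))
    (by rw [returnGap, hT.midTime_quot, hT.midShift_quot]; exact hF.gap_right hθ2)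
    hD (returnGap_le_mul hC₀ hF hT hBG (by omega) le_rfl)
  exact main

end Returns

section Returns

variable {F : CircleDeg1Lift} {a b C : ℝ} {Q : ℕ → ℕ} {L : ℕ → ℤ} {A : ℕ → ℕ}

lemma stepRatio_pos (hF : IsFlatLift F a b) (hT : IsReturnSequence F.translationNumber Q L A)
    {n j : ℕ} (hj : j < A n) : 0 < stepRatio F a b Q L n j :=
  div_pos (sub_pos.2 (returnGap_succ_lt hF hT hj)) (returnGap_pos hF hT _ _)

lemma stepRatio_le {C₀ : ℝ} (hC₀ : 0 < C₀) (hF : IsFlatLift F a b)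
    (hT : IsReturnSequence F.translationNumber Q L A)
    (hBG : ∀ n, returnGap F a b Q L n 0 ≤ C₀ * returnGap F a b Q L (n + 2) 0)
    {n j : ℕ} (hj : j < A n) : stepRatio F a b Q L n j ≤ C₀ := by
  unfold stepRatio
  rw [div_le_iff₀ (returnGap_pos hF hT _ _)]
  have h1 := returnGap_le_mul hC₀ hF hT hBG hj.le hj
  have h2 := returnGap_pos hF hT n (j + 1)
  linarith

lemma pos_of_neg_of_sub_one (hF : IsFlatLift F a b)
    (hT : IsReturnSequence F.translationNumber Q L A) {n : ℕ}
    (hn : Q (n + 1) * F.translationNumber - L (n + 1) < 0) :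
    0 < Q n * F.translationNumber - L n := by
  rcases lt_or_gt_of_ne (rotation_ne_zero hF.irrational (hT.one_le n) (L n)) with h | h
  · exact absurd (hT.pos_of_neg h) (not_lt.2 hn.le)
  · exact h

lemma neg_of_pos_of_sub_one (hF : IsFlatLift F a b)
    (hT : IsReturnSequence F.translationNumber Q L A) {n : ℕ}
    (hn : 0 < Q (n + 1) * F.translationNumber - L (n + 1)) :
    Q n * F.translationNumber - L n < 0 := by
  rcases lt_or_gt_of_ne (rotation_ne_zero hF.irrational (hT.one_le n) (L n)) with h | h
  · exact h
  · exact absurd (hT.neg_of_pos h) (not_lt.2 hn.le)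

/-- The recursive inequalities for closest returns from the left. -/
lemma exists_recursion_left {C₀ : ℝ} {M : ℕ} (hR : IsRegularLift F a b C) (hC₀ : 0 < C₀)
    (hT : IsReturnSequence F.translationNumber Q L A) (hM : ∀ n, A n ≤ M)
    (hBG : ∀ n, returnGap F a b Q L n 0 ≤ C₀ * returnGap F a b Q L (n + 2) 0) :
    ∃ K : ℝ, 0 < K ∧ ∀ n, Q (n + 2) * F.translationNumber - L (n + 2) < 0 →
      (stepRatio F a b Q L n (A n - 1) ≤
        K * (stepRatio F a b Q L (n + 2) 0 * stepRatio F a b Q L (n + 1) (A (n + 1) - 1))) ∧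
      ∀ j, j + 1 < A (n + 2) → stepRatio F a b Q L (n + 2) j ≤
        K * (stepRatio F a b Q L (n + 2) (j + 1) *
          stepRatio F a b Q L (n + 1) (A (n + 1) - 1)) := by
  obtain ⟨C₁, hC₁, hU⟩ := hR.right.upper C₀
  have hF := hR.toIsFlatLift
  -- Each left return used as `p₀` is less than `M + 1` steps of the accompanying right return away
  -- from zero, by bounded type and closeness of the next return; `M + 3` leaves room.
  refine ⟨2 * C₀ * C₁ * Real.exp (C * (M + 3 : ℕ)), by positivity, fun n hn => ?_⟩
  have hθ1 := pos_of_neg_of_sub_one hF hT hn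
  have hθ0 := neg_of_pos_of_sub_one hF hT hθ1
  have hθ3 := hT.pos_of_neg hn
  constructor
  -- Transition between levels: the return before `Q (n + 2)` on its side is the last intermediate
  -- one of level `n`.
  · obtain ⟨k, hk⟩ : ∃ k, A n = k + 1 := ⟨A n - 1, by have := hT.one_le_quot n; omega⟩
    have hmid := mid_rotation Q L F.translationNumber n k
    have hrot : (Q (n + 2) : ℝ) * F.translationNumber - L (n + 2) =
        midTime Q n k * F.translationNumber - midShift L n k +
          (Q (n + 1) * F.translationNumber - L (n + 1)) := by
      rw [hT.rotation_add_two, hk, hmid]; push_cast; ring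
    have hlt := hT.zero_lt_add hθ1
    have hneg := hT.mid_neg hθ0 (j := k) (by omega)
    have hP : FareyPair F.translationNumber (midTime Q n k) (midShift L n k) (Q (n + 1))
        (L (n + 1)) := (hT.farey_left n hθ0).add_mul k hneg
    have main := gap_ratio_le (N := M + 3) hF hR.cross hC₁ hC₀ hU hT hBG (n := n + 1) (j := 0) hn
      (hT.one_le_quot _) hP (hT.one_le_midTime _ _)
      (by rw [← midTime_succ, ← hk, hT.midTime_quot, midTime_zero])
      (by rw [← midShift_succ, ← hk, hT.midShift_quot, midShift_zero])
      (by push_cast; nlinarith) (by linarith) ((abs_lt.1 (hT.abs_lt_one _)).2)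
      (by
        change returnGap F a b Q L n k ≤ C₀ * returnGap F a b Q L (n + 2) 0
        rw [← returnGap_quot hT]
        exact returnGap_le_mul hC₀ hF hT hBG (by omega) le_rfl)
    refine le_trans (le_of_eq ?_) main
    unfold stepRatio
    rw [show A n - 1 = k by omega, show k + 1 = A n by omega, returnGap_quot hT]
    rfl
  · intro j hj
    have hmid := mid_rotation Q L F.translationNumber (n + 2) j
    have hneg := hT.mid_neg hn (j := j) (by omega)
    have hneg' := hT.mid_neg hn (j := j + 1) (by omega)
    rw [mid_rotation] at hneg'
    push_cast at hneg'
    have hP : FareyPair F.translationNumber (midTime Q (n + 2) j) (midShift L (n + 2) j)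
        (Q (n + 3)) (L (n + 3)) := (hT.farey_left (n + 2) hn).add_mul j hneg
    have hrot := hT.rotation_add_two (n + 2)
    have hθ4 := hT.zero_lt_add hθ3
    have hA : (A (n + 2) : ℝ) * (Q (n + 3) * F.translationNumber - L (n + 3)) ≤
        M * (Q (n + 3) * F.translationNumber - L (n + 3)) :=
      mul_le_mul_of_nonneg_right (by exact_mod_cast hM _) hθ3.le
    have hj0 : 0 ≤ (j : ℝ) * (Q (n + 3) * F.translationNumber - L (n + 3)) := by positivity
    exact gap_ratio_le (N := M + 3) hF hR.cross hC₁ hC₀ hU hT hBG (n := n + 1) (j := j + 1) hn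
      hj hP (hT.one_le_midTime _ _) (midTime_succ _ _ _).symm (midShift_succ _ _ _).symm
      (by push_cast; linarith) (by linarith) ((abs_lt.1 (hT.abs_lt_one _)).2)
      (returnGap_le_mul hC₀ hF hT hBG (by omega) hj.le)

/-- The recursion is proved for returns from the left. Reflection exchanges the sides and preserves
step ratios, so both parities feed the same abstract recursion. -/
lemma exists_stepRatio_lower_bound {C₀ : ℝ} {M : ℕ} (hR : IsRegularLift F a b C) (hC₀ : 0 < C₀)
    (hT : IsReturnSequence F.translationNumber Q L A) (hM : ∀ n, A n ≤ M)
    (hBG : ∀ n, returnGap F a b Q L n 0 ≤ C₀ * returnGap F a b Q L (n + 2) 0) :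
    ∃ ε : ℝ, 0 < ε ∧ ∀ n, ε ≤ stepRatio F a b Q L n (A n - 1) ∧
      ∀ j, j < A (n + 2) → ε ≤ stepRatio F a b Q L (n + 2) j := by
  have hF := hR.toIsFlatLift
  obtain ⟨K₁, hK₁, h1⟩ := exists_recursion_left hR hC₀ hT hM hBG
  obtain ⟨K₂, hK₂, h2⟩ := exists_recursion_left hR.reflect (L := fun n => -L n) hC₀
    (by simpa using hT.reflect) hM (by simpa only [returnGap_reflect hF hT] using hBG)
  simp only [stepRatio_reflect hF hT] at h2
  have hlast : ∀ n, A n - 1 < A n := fun n => by have := hT.one_le_quot n; omega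
  have hsp : ∀ n j, j < A n → 0 < stepRatio F a b Q L n j := fun n j hj => stepRatio_pos hF hT hj
  have hm1 : ∀ {x y z : ℝ}, 0 < y → 0 < z → x ≤ K₁ * (y * z) → x ≤ max K₁ K₂ * (y * z) :=
    fun hy hz h => h.trans (mul_le_mul_of_nonneg_right (le_max_left _ _) (by positivity))
  have hm2 : ∀ {x y z : ℝ}, 0 < y → 0 < z → x ≤ K₂ * (y * z) → x ≤ max K₁ K₂ * (y * z) :=
    fun hy hz h => h.trans (mul_le_mul_of_nonneg_right (le_max_right _ _) (by positivity))
  refine exists_ratio_lower_bound (K := max K₁ K₂) (C₀ := C₀) hT.one_le_quot hM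
    (lt_max_of_lt_left hK₁) hsp (fun n j hj => stepRatio_le hC₀ hF hT hBG hj) ?_ ?_
  · intro n
    rcases lt_or_gt_of_ne (rotation_ne_zero hF.irrational (hT.one_le (n + 2)) (L (n + 2)))
      with hn | hn
    · exact hm1 (hsp _ _ (hT.one_le_quot _)) (hsp _ _ (hlast _)) (h1 n hn).1
    · exact hm2 (hsp _ _ (hT.one_le_quot _)) (hsp _ _ (hlast _))
        (h2 n (by simp; linarith)).1
  · intro n j hj
    rcases lt_or_gt_of_ne (rotation_ne_zero hF.irrational (hT.one_le (n + 2)) (L (n + 2)))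
      with hn | hn
    · exact hm1 (hsp _ _ hj) (hsp _ _ (hlast _)) ((h1 n hn).2 j hj)
    · exact hm2 (hsp _ _ hj) (hsp _ _ (hlast _)) ((h2 n (by simp; linarith)).2 j hj)

/-- The last step of a level alone contracts the distance by 1 / (1 + ε), so each parity decays
geometrically. -/
lemma exists_returnGap_lt {ε : ℝ} (hF : IsFlatLift F a b)
    (hT : IsReturnSequence F.translationNumber Q L A) (hε : 0 < ε)
    (h : ∀ n, ε ≤ stepRatio F a b Q L n (A n - 1)) {δ : ℝ} (hδ : 0 < δ) :
    ∃ n₀, ∀ n ≥ n₀, returnGap F a b Q L n 0 < δ := by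
  obtain ⟨u, hu⟩ : ∃ u : ℕ → ℝ, u = fun n => returnGap F a b Q L n 0 := ⟨_, rfl⟩
  have hupos : ∀ n, 0 < u n := fun n => hu ▸ returnGap_pos hF hT n 0
  have hstep : ∀ n, u (n + 2) ≤ (1 / (1 + ε)) * u n := by
    intro n
    have h1 := h n
    obtain ⟨k, hk⟩ : ∃ k, A n = k + 1 := ⟨A n - 1, by have := hT.one_le_quot n; omega⟩
    unfold stepRatio at h1
    rw [show A n - 1 = k by omega, show k + 1 = A n by omega, returnGap_quot hT,
      le_div_iff₀ (returnGap_pos hF hT _ _)] at h1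
    have h2 := returnGap_anti hF hT (n := n) (Nat.zero_le k) (by omega)
    rw [hu, one_div, ← div_eq_inv_mul, le_div_iff₀ (by positivity)]
    linarith
  obtain ⟨B, hB⟩ : ∃ B, B = max (u 0) (u 1) := ⟨_, rfl⟩
  have hr1 : 1 / (1 + ε) < 1 := by rw [div_lt_one (by positivity)]; linarith
  have hr0 : 0 < 1 / (1 + ε) := by positivity
  have hbound : ∀ n, u n ≤ B ∧ u (n + 1) ≤ B := by
    intro n
    induction n with
    | zero => exact ⟨hB ▸ le_max_left _ _, hB ▸ le_max_right _ _⟩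
    | succ n ih =>
      refine ⟨ih.2, (hstep n).trans (le_trans ?_ ih.1)⟩
      have := hupos n
      nlinarith
  have hpow : ∀ k n, 2 * k ≤ n → u n ≤ (1 / (1 + ε)) ^ k * B := by
    intro k
    induction k with
    | zero => intro n _; simpa using (hbound n).1
    | succ k ih =>
      intro n hn
      obtain ⟨m, rfl⟩ : ∃ m, n = m + 2 := ⟨n - 2, by omega⟩
      refine (hstep m).trans ?_
      rw [pow_succ', mul_assoc]
      exact mul_le_mul_of_nonneg_left (ih m (by omega)) hr0.le
  have hBpos : 0 < B := (hupos 0).trans_le (hbound 0).1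
  obtain ⟨k, hk⟩ := exists_pow_lt_of_lt_one (div_pos hδ hBpos) hr1
  refine ⟨2 * k, fun n hn => ?_⟩
  have h3 := hpow k n hn
  rw [lt_div_iff₀ hBpos] at hk
  rw [hu] at h3
  exact h3.trans_lt hk

/-- In the preimages of the flat interval whose time lies between two denominators of convergents
the first of which belongs to a return from the left, a definite portion is mapped to an interval
the length of which is the distance of that return. -/
lemma exists_portion_of_neg {C₀ ε : ℝ} (hR : IsRegularLift F a b C) (hC₀ : 0 < C₀)
    (hT : IsReturnSequence F.translationNumber Q L A)
    (hBG : ∀ n, returnGap F a b Q L n 0 ≤ C₀ * returnGap F a b Q L (n + 2) 0) (hε : 0 < ε)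
    (hstep : ∀ n, ε ≤ stepRatio F a b Q L n (A n - 1) ∧
      ∀ j, j < A (n + 2) → ε ≤ stepRatio F a b Q L (n + 2) j) :
    ∃ (K : ℝ) (n₀ : ℕ), ∀ n ≥ n₀, Q n * F.translationNumber - L n < 0 →
      ∀ i, Q n ≤ i → i < Q (n + 1) → ∃ (α α' β : ℝ) (l : ℤ), α < β ∧ F^[i] α = a + l ∧
        F^[i] α' = a + returnGap F a b Q L n 0 + l ∧ F^[i] β = b + l ∧ β - α ≤ K * (α' - α) := by
  obtain ⟨C₁, hC₁, hU⟩ := hR.right.upper C₀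
  obtain ⟨c₂, hc₂, η, hη, hLow⟩ := hR.right.lower
  have hF := hR.toIsFlatLift
  -- Three steps suffice: the left return before `n + 3` is within two steps of its right partner,
  -- and the right return needed as `q₁` is within three steps of its left partner.
  obtain ⟨K, hK⟩ := exists_portion_left (N := 3) hF hR.cross hC₁ hC₀ hU hc₂ hLow hε
  obtain ⟨n₁, hn₁⟩ := exists_returnGap_lt hF hT hε (fun n => (hstep n).1)
    (lt_min hη (sub_pos.2 hF.lt))
  refine ⟨K, n₁ + 3, fun n' hn' hθ i hi hi' => ?_⟩
  obtain ⟨n, rfl⟩ : ∃ n, n' = n + 3 := ⟨n' - 3, by omega⟩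
  have hθ2 := pos_of_neg_of_sub_one hF hT hθ
  have hθ1 := neg_of_pos_of_sub_one hF hT hθ2
  have hθ0 := pos_of_neg_of_sub_one hF hT hθ1
  have hθ4 := hT.pos_of_neg hθ
  have hs0 := hT.zero_lt_add hθ0
  have hs1 := hT.add_lt_zero hθ1
  have hs2 := hT.zero_lt_add hθ2
  have hs3 := hT.add_lt_zero hθ
  obtain ⟨k₀, hk₀⟩ : ∃ k, A n = k + 1 := ⟨A n - 1, by have := hT.one_le_quot n; omega⟩
  obtain ⟨k₁, hk₁⟩ : ∃ k, A (n + 1) = k + 1 :=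
    ⟨A (n + 1) - 1, by have := hT.one_le_quot (n + 1); omega⟩
  obtain ⟨k₂, hk₂⟩ : ∃ k, A (n + 2) = k + 1 :=
    ⟨A (n + 2) - 1, by have := hT.one_le_quot (n + 2); omega⟩
  have hratio : ∀ {m j : ℕ}, ε ≤ stepRatio F a b Q L m j →
      ε * returnGap F a b Q L m (j + 1) ≤
        returnGap F a b Q L m j - returnGap F a b Q L m (j + 1) := by
    intro m j h
    unfold stepRatio at h
    rwa [le_div_iff₀ (returnGap_pos hF hT _ _)] at h
  -- the return from the left before `n + 3`
  have hm1 := mid_rotation Q L F.translationNumber (n + 1) k₁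
  have hrot1 : (Q (n + 3) : ℝ) * F.translationNumber - L (n + 3) =
      midTime Q (n + 1) k₁ * F.translationNumber - midShift L (n + 1) k₁ +
        (Q (n + 2) * F.translationNumber - L (n + 2)) := by
    rw [hT.rotation_add_two, hk₁, hm1]; push_cast; ring
  have hneg1 := hT.mid_neg hθ1 (j := k₁) (by omega)
  have hP : FareyPair F.translationNumber (midTime Q (n + 1) k₁) (midShift L (n + 1) k₁)
      (Q (n + 2)) (L (n + 2)) := (hT.farey_left (n + 1) hθ1).add_mul k₁ hneg1
  have e1 : midTime Q (n + 1) k₁ + Q (n + 2) = Q (n + 3) := by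
    rw [← midTime_succ, ← hk₁, hT.midTime_quot]
  have e2 : midShift L (n + 1) k₁ + L (n + 2) = L (n + 3) := by
    rw [← midShift_succ, ← hk₁, hT.midShift_quot]
  -- the return from the right before `n + 4`
  have hm2 := mid_rotation Q L F.translationNumber (n + 2) k₂
  have hrot2 : (Q (n + 4) : ℝ) * F.translationNumber - L (n + 4) =
      midTime Q (n + 2) k₂ * F.translationNumber - midShift L (n + 2) k₂ +
        (Q (n + 3) * F.translationNumber - L (n + 3)) := by
    rw [hT.rotation_add_two, hk₂, hm2]; push_cast; ring
  have hpos2 := hT.mid_pos hθ2 (j := k₂) (by omega)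
  have f1 : midTime Q (n + 2) k₂ + Q (n + 3) = Q (n + 4) := by
    rw [← midTime_succ, ← hk₂, hT.midTime_quot]
  have f2 : midShift L (n + 2) k₂ + L (n + 3) = L (n + 4) := by
    rw [← midShift_succ, ← hk₂, hT.midShift_quot]
  have gD : returnGap F a b Q L (n + 3) 0 = a - (F^[Q (n + 3)] b - L (n + 3)) := by
    rw [returnGap, midTime_zero, midShift_zero]
    exact hF.gap_left (hT.one_le _) hθ
  have gE : returnGap F a b Q L (n + 4) 0 = F^[Q (n + 4)] b - L (n + 4) - b := by
    rw [returnGap, midTime_zero, midShift_zero]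
    exact hF.gap_right hθ4
  have qD : returnGap F a b Q L (n + 1) (k₁ + 1) = returnGap F a b Q L (n + 3) 0 := by
    rw [← hk₁, returnGap_quot hT]
  have qE : returnGap F a b Q L (n + 2) (k₂ + 1) = returnGap F a b Q L (n + 4) 0 := by
    rw [← hk₂, returnGap_quot hT]
  have dDC : returnGap F a b Q L (n + 1) k₁ ≤ C₀ * returnGap F a b Q L (n + 3) 0 := by
    rw [← qD]; exact returnGap_le_mul hC₀ hF hT hBG (by omega) (by omega)
  have dEC : returnGap F a b Q L (n + 2) k₂ ≤ C₀ * returnGap F a b Q L (n + 4) 0 := by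
    rw [← qE]; exact returnGap_le_mul hC₀ hF hT hBG (by omega) (by omega)
  have dε : ε * returnGap F a b Q L (n + 3) 0 ≤
      returnGap F a b Q L (n + 1) k₁ - returnGap F a b Q L (n + 3) 0 := by
    rw [← qD]; exact hratio (by have := (hstep (n + 1)).1; rwa [hk₁] at this)
  have hsmall : returnGap F a b Q L (n + 3) 0 < b - a :=
    (hn₁ (n + 3) (by omega)).trans_le (min_le_right _ _)
  have hsmall' : ∀ m j, n ≤ m → j ≤ A m → returnGap F a b Q L m j < η := fun m j hm hj =>
    (returnGap_anti hF hT (Nat.zero_le _) hj).trans_lt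
      ((hn₁ m (by omega)).trans_le (min_le_left _ _))
  -- the preceding return from the right
  obtain ⟨s, us, q₁, w₁, hP', hsum, hlt, hle, hN', hq₁, hq₁1, hη₁, hε₁⟩ :
      ∃ (s : ℕ) (us : ℤ) (q₁ : ℕ) (w₁ : ℤ), FareyPair F.translationNumber s us q₁ w₁ ∧
        s + q₁ = midTime Q (n + 2) k₂ ∧
        midTime Q (n + 2) k₂ * F.translationNumber - midShift L (n + 2) k₂ <
          q₁ * F.translationNumber - w₁ ∧
        us - s * F.translationNumber ≤ q₁ * F.translationNumber - w₁ ∧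
        q₁ * F.translationNumber - w₁ < 3 * (us - s * F.translationNumber) ∧
        1 ≤ q₁ ∧ q₁ * F.translationNumber - w₁ < 1 ∧
        F^[q₁] b - w₁ - b < η ∧
        ε * returnGap F a b Q L (n + 2) k₂ ≤
          (F^[q₁] b - w₁ - b) - returnGap F a b Q L (n + 2) k₂ := by
    -- The right return before the last intermediate one of level `n + 2` lies in that level, unless
    -- `A (n + 2) = 1`; then it is the last intermediate return of level `n`.
    rcases Nat.eq_zero_or_pos k₂ with rfl | hk₂pos
    · have hm0 := mid_rotation Q L F.translationNumber n k₀
      have hrot0 : (Q (n + 2) : ℝ) * F.translationNumber - L (n + 2) =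
          midTime Q n k₀ * F.translationNumber - midShift L n k₀ +
            (Q (n + 1) * F.translationNumber - L (n + 1)) := by
        rw [hT.rotation_add_two, hk₀, hm0]; push_cast; ring
      have hpos0 := hT.mid_pos hθ0 (j := k₀) (by omega)
      have hgap : returnGap F a b Q L n k₀ = F^[midTime Q n k₀] b - midShift L n k₀ - b :=
        hF.gap_right hpos0
      have hmle : (midTime Q n k₀ : ℝ) * F.translationNumber - midShift L n k₀ < 1 := by
        rw [hm0]
        have h1 := (abs_lt.1 (hT.abs_lt_one n)).2
        have : (k₀ : ℝ) * (Q (n + 1) * F.translationNumber - L (n + 1)) ≤ 0 :=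
          mul_nonpos_of_nonneg_of_nonpos (by positivity) hθ1.le
        linarith
      rw [midTime_zero, midShift_zero]
      refine ⟨Q (n + 1), L (n + 1), midTime Q n k₀, midShift L n k₀,
        (hT.farey_right n hθ0).mul_add k₀ hpos0, ?_, by linarith, by linarith, by linarith,
        hT.one_le_midTime _ _, hmle, hgap ▸ hsmall' n k₀ le_rfl (by omega), ?_⟩
      · rw [add_comm, ← midTime_succ, ← hk₀, hT.midTime_quot]
      · rw [← hgap, ← returnGap_quot hT, hk₀]
        exact hratio (by have := (hstep n).1; rwa [hk₀] at this)
    · obtain ⟨k, rfl⟩ : ∃ k, k₂ = k + 1 := ⟨k₂ - 1, by omega⟩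
      have hm3 := mid_rotation Q L F.translationNumber (n + 2) k
      have hposk := hT.mid_pos hθ2 (j := k) (by omega)
      have hgap : returnGap F a b Q L (n + 2) k =
          F^[midTime Q (n + 2) k] b - midShift L (n + 2) k - b := hF.gap_right hposk
      have hmle : (midTime Q (n + 2) k : ℝ) * F.translationNumber - midShift L (n + 2) k < 1 := by
        rw [hm3]
        have h1 := (abs_lt.1 (hT.abs_lt_one (n + 2))).2
        have : (k : ℝ) * (Q (n + 2 + 1) * F.translationNumber - L (n + 2 + 1)) ≤ 0 :=
          mul_nonpos_of_nonneg_of_nonpos (by positivity) hθ.le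
        linarith
      push_cast at hm2
      refine ⟨Q (n + 3), L (n + 3), midTime Q (n + 2) k, midShift L (n + 2) k,
        (hT.farey_right (n + 2) hθ2).mul_add k hposk, ?_, by linarith, by linarith, by linarith,
        hT.one_le_midTime _ _, hmle, hgap ▸ hsmall' (n + 2) k (by omega) (by omega), ?_⟩
      · rw [midTime_succ, add_comm]
      · rw [← hgap]
        exact hratio ((hstep n).2 k (by omega))
  have main := hK (midTime Q (n + 1) k₁) (Q (n + 2)) (Q (n + 4)) (midTime Q (n + 2) k₂) s q₁ i
    (midShift L (n + 1) k₁) (L (n + 2)) (L (n + 4)) (midShift L (n + 2) k₂) us w₁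
    (returnGap F a b Q L (n + 1) k₁) (returnGap F a b Q L (n + 3) 0)
    (returnGap F a b Q L (n + 2) k₂) (returnGap F a b Q L (n + 4) 0) (F^[q₁] b - w₁ - b)
    hP (hT.one_le_midTime _ _) (by push_cast; linarith) (by linarith)
    ((abs_lt.1 (hT.abs_lt_one _)).2) hθ4
    (by rw [e1, e2]; push_cast; linarith) (by linarith) (by rw [e1, e2]; push_cast; linarith)
    hlt hP' (by push_cast; linarith) hle hq₁ hq₁1 (by rw [e1]; exact hi)
    (by rw [e1, hsum, add_comm, f1]; exact hi')
    (hF.gap_left (hT.one_le_midTime _ _) hneg1) (by rw [e1, e2]; exact gD) rfl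
    (hF.gap_right hpos2) gE dDC dEC hsmall hη₁ dε hε₁
  exact main

/-- Arbitrarily small intervals at one end of the flat interval have as preimages definite portions
of the preimages of the flat interval. -/
theorem exists_portion {C₀ : ℝ} {M : ℕ} (hR : IsRegularLift F a b C) (hC₀ : 0 < C₀)
    (hT : IsReturnSequence F.translationNumber Q L A) (hM : ∀ n, A n ≤ M)
    (hBG : ∀ n, returnGap F a b Q L n 0 ≤ C₀ * returnGap F a b Q L (n + 2) 0) :
    ∃ K : ℝ, ∀ δ : ℝ, 0 < δ → ∃ n₀, ∀ i, Q n₀ ≤ i → ∃ (α α' β D : ℝ) (l : ℤ), 0 < D ∧ D < δ ∧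
      α < β ∧ F^[i] α = a + l ∧ F^[i] β = b + l ∧
      ((F^[i] α' = a + D + l ∧ β - α ≤ K * (α' - α)) ∨
        (F^[i] α' = b - D + l ∧ β - α ≤ K * (β - α'))) := by
  have hF := hR.toIsFlatLift
  obtain ⟨ε, hε, hstep⟩ := exists_stepRatio_lower_bound hR hC₀ hT hM hBG
  obtain ⟨K₁, n₁, h1⟩ := exists_portion_of_neg hR hC₀ hT hBG hε hstep
  obtain ⟨K₂, n₂, h2⟩ := exists_portion_of_neg hR.reflect (L := fun n => -L n) hC₀
    (by simpa using hT.reflect) (by simpa only [returnGap_reflect hF hT] using hBG) hε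
    (by simpa only [stepRatio_reflect hF hT] using hstep)
  have hpos : ∀ {K x y : ℝ}, 0 < x → x ≤ K * y → 0 < max (max K₁ K₂) 1 → K ≤ max (max K₁ K₂) 1 →
      0 ≤ y → x ≤ max (max K₁ K₂) 1 * y := fun _ h _ hk hy =>
    h.trans (mul_le_mul_of_nonneg_right hk hy)
  refine ⟨max (max K₁ K₂) 1, fun δ hδ => ?_⟩
  have hKpos : 0 < max (max K₁ K₂) 1 := lt_max_of_lt_right one_pos
  obtain ⟨n₃, hn₃⟩ := exists_returnGap_lt hF hT hε (fun n => (hstep n).1) hδ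
  refine ⟨max n₃ (max n₁ n₂), fun i hi => ?_⟩
  obtain ⟨n, hn, hni, hni'⟩ := hT.exists_between hi
  have hn₃' : n₃ ≤ n := (le_max_left _ _).trans hn
  have hn₁' : n₁ ≤ n := ((le_max_left _ _).trans (le_max_right _ _)).trans hn
  have hn₂' : n₂ ≤ n := ((le_max_right _ _).trans (le_max_right _ _)).trans hn
  have hDpos := returnGap_pos hF hT n 0
  rcases lt_or_gt_of_ne (rotation_ne_zero hF.irrational (hT.one_le n) (L n)) with hθ | hθ
  · obtain ⟨α, α', β, l, hαβ, e1, e2, e3, e4⟩ := h1 n hn₁' hθ i hni hni'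
    have hlt : α < α' := lt_of_iterate_lt (F := F) (m := i) (by rw [e1, e2]; linarith)
    exact ⟨α, α', β, _, l, hDpos, hn₃ n hn₃', hαβ, e1, e3, Or.inl ⟨e2,
      hpos (by linarith) e4 hKpos ((le_max_left _ _).trans (le_max_left _ _)) (by linarith)⟩⟩
  -- For a return from the right the reflected lift is used; the portion then sits at the end over
  -- `b`.
  · obtain ⟨α, α', β, l, hαβ, e1, e2, e3, e4⟩ := h2 n hn₂' (by simp; linarith) i hni hni'
    rw [reflect_iterate] at e1 e2 e3
    rw [returnGap_reflect hF hT] at e2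
    have hlt : -α' < -α := lt_of_iterate_lt (F := F) (m := i) (by linarith)
    refine ⟨-β, -α', -α, _, -l, hDpos, hn₃ n hn₃', by linarith, by push_cast; linarith,
      by push_cast; linarith, Or.inr ⟨by push_cast; linarith, ?_⟩⟩
    have := hpos (by linarith) e4 hKpos ((le_max_right _ _).trans (le_max_left _ _)) (by linarith)
    rw [show -α - -β = β - α by ring, show -α - -α' = α' - α by ring]
    exact this

end Returns

/-! ### Fibres of the iterates and lengths of arcs -/

lemma IsFlatLift.map_eq_of_map_eq {F : CircleDeg1Lift} {a b : ℝ} (h : IsFlatLift F a b) {x y : ℝ}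
    (hxy : x < y) (he : F x = F y) : ∃ l : ℤ, F x = F b + l := by
  obtain ⟨n, hn⟩ : ∃ n : ℤ, n = ⌊x - b⌋ := ⟨_, rfl⟩
  have h1 : b + n ≤ x := by have := Int.floor_le (x - b); rw [hn]; linarith
  have h2 : x < b + n + 1 := by have := Int.lt_floor_add_one (x - b); rw [hn]; linarith
  have hmono : ∀ {s t : ℝ}, b + n ≤ s → s < t → t ≤ a + 1 + n → F s < F t := by
    intro s t hs hst ht
    have := h.strictMonoOn (show s - n ∈ Icc b (a + 1) from ⟨by linarith, by linarith⟩)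
      (show t - n ∈ Icc b (a + 1) from ⟨by linarith, by linarith⟩) (by linarith)
    rw [CircleDeg1Lift.map_sub_int, CircleDeg1Lift.map_sub_int] at this
    linarith
  have h3 : a + 1 + n ≤ x := by
    by_contra hc
    rcases le_or_gt y (a + 1 + n) with hy | hy
    · exact absurd he (hmono h1 hxy hy).ne
    · have := hmono h1 (not_le.1 hc) le_rfl
      have := F.monotone hy.le
      linarith
  refine ⟨n + 1, ?_⟩
  have := h.map_eq (x - (n + 1 : ℤ)) ⟨by push_cast; linarith, by push_cast; linarith⟩
  rw [CircleDeg1Lift.map_sub_int] at this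
  linarith

/-- Two points are merged only when some iterate collapses them inside a translate of the flat
interval, after which they follow the orbit of `b`. -/
lemma IsFlatLift.iterate_eq_of_iterate_eq {F : CircleDeg1Lift} {a b : ℝ} (h : IsFlatLift F a b)
    {i : ℕ} {x y : ℝ} (hxy : x < y) (he : F^[i] x = F^[i] y) :
    ∃ (j : ℕ) (l : ℤ), 1 ≤ j ∧ F^[i] x = F^[j] b + l := by
  induction i generalizing x y with
  | zero => exact absurd he hxy.ne
  | succ i ih =>
    rw [Function.iterate_succ_apply, Function.iterate_succ_apply] at he
    rcases (F.monotone hxy.le).lt_or_eq with hlt | heq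
    · obtain ⟨j, l, hj, hl⟩ := ih hlt he
      exact ⟨j, l, hj, hl⟩
    · obtain ⟨l, hl⟩ := h.map_eq_of_map_eq hxy heq
      exact ⟨i + 1, l, by omega, by
        rw [Function.iterate_succ_apply, hl, iterate_add_int, ← Function.iterate_succ_apply]⟩

/-- The forward orbit of `b` never meets a translate of `[a, b]`, so a point of `[a, b] + l` has a
single preimage under each iterate. -/
lemma IsFlatLift.iterate_lt_iterate {F : CircleDeg1Lift} {a b : ℝ} (h : IsFlatLift F a b)
    {i : ℕ} {x y c : ℝ} {l : ℤ} (hc : c ∈ Icc a b) (hxy : x < y)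
    (he : F^[i] x = c + l ∨ F^[i] y = c + l) : F^[i] x < F^[i] y := by
  refine (monotone_iterate F i hxy.le).lt_of_ne fun heq => ?_
  have hx : F^[i] x = c + l := by
    rcases he with he | he
    · exact he
    · exact heq.trans he
  obtain ⟨j, l', hj, hl'⟩ := h.iterate_eq_of_iterate_eq hxy heq
  have hcj : F^[j] b - ((l - l' : ℤ) : ℝ) = c := by push_cast; linarith
  rcases lt_or_gt_of_ne (rotation_ne_zero h.irrational hj (l - l')) with hn | hn
  · have := h.iterate_lt_left hj hn
    linarith [hc.1]
  · have := lt_iterate_right (b := b) hn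
    linarith [hc.2]

lemma isCompact_arc (x y : ℝ) : IsCompact (arc x y) :=
  isCompact_Icc.image (AddCircle.continuous_mk' 1)

lemma len_arc {x y : ℝ} (hxy : x ≤ y) (hy : y < x + 1) : len (arc x y) = y - x := by
  have h1 : ENNReal.ofReal (y - x) ≤ volume (arc x y) :=
    (sub_le_len_coe_Ioo hy.le).trans (measure_mono (image_mono Ioo_subset_Icc_self))
  have h2 : volume (arc x y) ≤ ENNReal.ofReal (y - x) := by
    rw [AddCircle.add_projection_respects_measure (T := 1) (y - 1)
      (isCompact_arc x y).isClosed.measurableSet, ← Real.volume_Icc]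
    apply measure_mono
    rintro z ⟨⟨w, hw, hwz⟩, hz1, hz2⟩
    obtain ⟨l, hl⟩ := coe_eq_coe_iff.1 hwz
    have hl0 : l = 0 := by
      have h3 : (l : ℝ) < 1 := by linarith [hw.1]
      have h4 : (-1 : ℝ) < l := by linarith [hw.2]
      have h3' : l < 1 := by exact_mod_cast h3
      have h4' : -1 < l := by exact_mod_cast h4
      omega
    rw [hl, hl0]
    simpa using hw
  rw [len, measureReal_def, le_antisymm h2 h1, ENNReal.toReal_ofReal (by linarith)]

lemma iterate_coe {f : UnitAddCircle → UnitAddCircle} {F : CircleDeg1Lift}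
    (hf : ∀ x : ℝ, f (x : UnitAddCircle) = ((F x : ℝ) : UnitAddCircle)) (i : ℕ) (x : ℝ) :
    f^[i] (x : UnitAddCircle) = ((F^[i] x : ℝ) : UnitAddCircle) := by
  induction i generalizing x with
  | zero => rfl
  | succ i ih => rw [Function.iterate_succ_apply, hf, ih, Function.iterate_succ_apply]

lemma image_arc {f : UnitAddCircle → UnitAddCircle} {F : CircleDeg1Lift}
    (hf : ∀ x : ℝ, f (x : UnitAddCircle) = ((F x : ℝ) : UnitAddCircle)) (hF : Continuous F)
    (i : ℕ) {x y : ℝ} (hxy : x ≤ y) : f^[i] '' arc x y = arc (F^[i] x) (F^[i] y) := by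
  apply Subset.antisymm
  · rintro _ ⟨_, ⟨t, ht, rfl⟩, rfl⟩
    exact ⟨F^[i] t, ⟨monotone_iterate F i ht.1, monotone_iterate F i ht.2⟩, (iterate_coe hf i t).symm⟩
  · rintro _ ⟨s, hs, rfl⟩
    obtain ⟨t, ht, rfl⟩ := intermediate_value_Icc hxy (hF.iterate i).continuousOn hs
    exact ⟨_, ⟨t, ht, rfl⟩, iterate_coe hf i t⟩

/-! ### Quasi-symmetry against a definite portion -/

/-- Adjacent intervals are available only strictly inside the open preimage; letting the margin η
tend to zero reaches its ends. -/
lemma doubling_of_adjacent {g : ℝ → ℝ} (hm : Monotone g) (hg : Continuous g) {w Q : ℝ}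
    (hQ : 0 < Q)
    (h : ∀ x h, 0 < h → 0 < x - h → x + h < w → g (x + h) - g x ≤ Q * (g x - g (x - h)))
    {s : ℝ} (hs : 0 < s) (hsw : 2 * s ≤ w) : g (2 * s) - g 0 ≤ (1 + Q) * (g s - g 0) := by
  have hlim : Tendsto (fun η => g (2 * s - η)) (𝓝[>] 0) (𝓝 (g (2 * s))) := by
    have : Continuous fun η => g (2 * s - η) := hg.comp (continuous_const.sub continuous_id)
    have h0 := this.tendsto 0
    simp only [sub_zero] at h0
    exact h0.mono_left nhdsWithin_le_nhds
  have hle : g (2 * s) ≤ g s + Q * (g s - g 0) := by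
    refine le_of_tendsto hlim ?_
    filter_upwards [Ioo_mem_nhdsGT hs] with η hη
    have h1 := h s (s - η) (by linarith [hη.2]) (by linarith [hη.1]) (by linarith [hη.1])
    have h2 : g 0 ≤ g (s - (s - η)) := hm (by linarith [hη.1])
    have h3 : Q * (g s - g (s - (s - η))) ≤ Q * (g s - g 0) :=
      mul_le_mul_of_nonneg_left (by linarith) hQ.le
    rw [show s + (s - η) = 2 * s - η by ring] at h1
    linarith
  linarith

lemma le_pow_mul_of_adjacent {g : ℝ → ℝ} (hm : Monotone g) (hg : Continuous g) {w Q : ℝ}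
    (hw : 0 < w) (hQ : 0 < Q)
    (h : ∀ x h, 0 < h → 0 < x - h → x + h < w → g (x + h) - g x ≤ Q * (g x - g (x - h)))
    (k : ℕ) : g w - g 0 ≤ (1 + Q) ^ k * (g (w / 2 ^ k) - g 0) := by
  induction k with
  | zero => simp
  | succ k ih =>
    have h1 : (1 : ℝ) ≤ 2 ^ k := one_le_pow₀ (by norm_num)
    have e : 2 * (w / 2 ^ (k + 1)) = w / 2 ^ k := by rw [pow_succ]; field_simp
    have hd := doubling_of_adjacent hm hg hQ h (s := w / 2 ^ (k + 1)) (by positivity)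
      (by rw [e]; exact div_le_self hw.le h1)
    rw [e] at hd
    calc _ ≤ _ := ih
      _ ≤ (1 + Q) ^ k * ((1 + Q) * (g (w / 2 ^ (k + 1)) - g 0)) :=
        mul_le_mul_of_nonneg_left hd (by positivity)
      _ = _ := by ring

/-- A quasi-symmetric iterate cannot map a definite portion of a preimage of the flat interval to a
very short interval at one of its ends. -/
lemma not_isQuasiSymmetricOn {f : UnitAddCircle → UnitAddCircle} {F : CircleDeg1Lift} {a b Q K : ℝ}
    (hf : ∀ x : ℝ, f (x : UnitAddCircle) = ((F x : ℝ) : UnitAddCircle)) (hF : IsFlatLift F a b)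
    (hQ : 0 < Q) {k i : ℕ} (hK : K ≤ 2 ^ k) {α α' β D : ℝ} {l : ℤ}
    (hD0 : 0 < D)
    (hD : (1 + Q) ^ k * D < b - a) (hαβ : α < β) (hα : F^[i] α = a + l) (hβ : F^[i] β = b + l)
    (h : (F^[i] α' = a + D + l ∧ β - α ≤ K * (α' - α)) ∨
        (F^[i] α' = b - D + l ∧ β - α ≤ K * (β - α'))) :
    ¬ IsQuasiSymmetricOn Q f^[i] (preim f a b i) := by
  intro hqs
  have hβ1 : β < α + 1 := by
    refine lt_of_iterate_lt (F := F) (m := i) ?_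
    have := iterate_add_int F i α 1
    push_cast at this
    rw [this, hα, hβ]
    linarith [hF.lt_add_one]
  -- Only α lies over `a + l` and only β over `b + l`, so the open interval between them is mapped
  -- into the open flat interval.
  have hin : ∀ x, α < x → x < β → a + l < F^[i] x ∧ F^[i] x < b + l := by
    intro x h1 h2
    rw [← hα, ← hβ]
    exact ⟨hF.iterate_lt_iterate (c := a) ⟨le_rfl, hF.lt.le⟩ h1 (Or.inl hα),
      hF.iterate_lt_iterate (c := b) ⟨hF.lt.le, le_rfl⟩ h2 (Or.inr hβ)⟩
  have hsub : ∀ u v, α < u → v < β → arc u v ⊆ preim f a b i := by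
    rintro u v hu hv _ ⟨t, ht, rfl⟩
    have h3 := hin t (by linarith [ht.1]) (by linarith [ht.2])
    refine ⟨F^[i] t - l, ⟨by linarith [h3.1], by linarith [h3.2]⟩, ?_⟩
    change _ = f^[i] (t : UnitAddCircle)
    rw [iterate_coe hf]
    exact coe_eq_coe_iff.2 ⟨l, by ring⟩
  have hlen : ∀ u v, α < u → u ≤ v → v < β → len (f^[i] '' arc u v) = F^[i] v - F^[i] u := by
    intro u v hu huv hv
    rw [image_arc hf hF.continuous i huv]
    refine len_arc (monotone_iterate F i huv) ?_
    have h3 := hin u hu (by linarith)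
    have h4 := hin v (by linarith) hv
    linarith [hF.lt_add_one]
  have hadj : ∀ x h, 0 < h → α < x - h → x + h < β →
      F^[i] x - F^[i] (x - h) ≤ Q * (F^[i] (x + h) - F^[i] x) ∧
      F^[i] (x + h) - F^[i] x ≤ Q * (F^[i] x - F^[i] (x - h)) := by
    intro x h hh h1 h2
    have := hqs x h hh (by linarith) (hsub _ _ h1 (by linarith)) (hsub _ _ (by linarith) h2)
    rwa [hlen _ _ h1 (by linarith) (by linarith), hlen _ _ (by linarith) (by linarith) h2] at this
  have hcont : Continuous F^[i] := hF.continuous.iterate i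
  have hmono := monotone_iterate F i
  have hpos : (0 : ℝ) < 2 ^ k := by positivity
  have hportion : ∀ {y : ℝ}, 0 ≤ y → β - α ≤ K * y → (β - α) / 2 ^ k ≤ y := fun hy h => by
    rw [div_le_iff₀ hpos, mul_comm]
    exact h.trans (mul_le_mul_of_nonneg_right hK hy)
  rcases h with ⟨hα', hp⟩ | ⟨hα', hp⟩
  · have hlt : α < α' := lt_of_iterate_lt (F := F) (m := i) (by rw [hα, hα']; linarith)
    have h1 := le_pow_mul_of_adjacent (g := fun s => F^[i] (α + s)) (w := β - α)
      (fun s t hst => hmono (by linarith)) (hcont.comp (continuous_const.add continuous_id))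
      (by linarith) hQ (fun x h hh h1 h2 => by
        have := (hadj (α + x) h hh (by linarith) (by linarith)).2
        rwa [add_assoc, add_sub_assoc] at this) k
    have h2 : F^[i] (α + (β - α) / 2 ^ k) ≤ F^[i] α' :=
      hmono (by linarith [hportion (sub_nonneg.2 hlt.le) hp])
    simp only [add_zero, add_sub_cancel, hα, hβ] at h1
    rw [hα'] at h2
    have h3 : (1 + Q) ^ k * (F^[i] (α + (β - α) / 2 ^ k) - (a + l)) ≤ (1 + Q) ^ k * D :=
      mul_le_mul_of_nonneg_left (by linarith) (by positivity)
    linarith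
  · have hlt : α' < β := lt_of_iterate_lt (F := F) (m := i) (by rw [hβ, hα']; linarith)
    -- Reversing source and target makes the end β the base point of an increasing function.
    have h1 := le_pow_mul_of_adjacent (g := fun s => -F^[i] (β - s)) (w := β - α)
      (fun s t hst => neg_le_neg (hmono (by linarith)))
      (hcont.comp (continuous_const.sub continuous_id)).neg
      (by linarith) hQ (fun x h hh h1 h2 => by
        have := (hadj (β - x) h hh (by linarith) (by linarith)).1
        rw [sub_sub, sub_add] at this
        linarith) k
    have h2 : F^[i] α' ≤ F^[i] (β - (β - α) / 2 ^ k) :=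
      hmono (by linarith [hportion (sub_nonneg.2 hlt.le) hp])
    simp only [sub_zero, sub_sub_cancel, hα, hβ] at h1
    rw [hα'] at h2
    have h3 : (1 + Q) ^ k * (-F^[i] (β - (β - α) / 2 ^ k) - -(b + l)) ≤ (1 + Q) ^ k * D :=
      mul_le_mul_of_nonneg_left (by linarith) (by positivity)
    linarith

/-! ### Convergents as a return sequence -/

section ContinuedFraction

variable {ρ : ℝ}

lemma not_terminatedAt_of (hρ : Irrational ρ) (n : ℕ) : ¬ (GenContFract.of ρ).TerminatedAt n := by
  intro h
  obtain ⟨r, hr⟩ := (GenContFract.terminates_iff_rat ρ).1 ⟨n, h⟩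
  exact hρ ⟨r, hr.symm⟩

lemma exists_quot (hρ : Irrational ρ) (n : ℕ) :
    ∃ k : ℕ, 1 ≤ k ∧ (GenContFract.of ρ).s.get? n = some ⟨1, k⟩ := by
  obtain ⟨gp, hgp⟩ := Option.ne_none_iff_exists'.1 (not_terminatedAt_of hρ n)
  obtain ⟨h1, z, hz⟩ := GenContFract.of_partNum_eq_one_and_exists_int_partDen_eq hgp
  have h2 := GenContFract.of_one_le_get?_partDen (GenContFract.partDen_eq_s_b hgp)
  rw [hz] at h2
  have h3 : 1 ≤ z := by exact_mod_cast h2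
  lift z to ℕ using by omega
  refine ⟨z, by exact_mod_cast h3, ?_⟩
  rw [hgp]
  cases gp
  simp_all

lemma exists_int_nums_dens (hρ : Irrational ρ) (n : ℕ) : ∃ u v : ℤ,
    (GenContFract.of ρ).nums n = u ∧ (GenContFract.of ρ).dens n = v := by
  have key : ∀ n, (∃ u v : ℤ, (GenContFract.of ρ).nums n = u ∧ (GenContFract.of ρ).dens n = v) ∧
      ∃ u v : ℤ, (GenContFract.of ρ).nums (n + 1) = u ∧ (GenContFract.of ρ).dens (n + 1) = v := by
    intro n
    induction n with
    | zero =>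
      obtain ⟨k, -, hk⟩ := exists_quot hρ 0
      refine ⟨⟨⌊ρ⌋, 1, ?_, ?_⟩, ⟨k * ⌊ρ⌋ + 1, k, ?_, ?_⟩⟩
      · rw [GenContFract.zeroth_num_eq_h, GenContFract.of_h_eq_floor]
      · rw [GenContFract.zeroth_den_eq_one]; simp
      · rw [GenContFract.first_num_eq hk, GenContFract.of_h_eq_floor]; push_cast; ring
      · rw [GenContFract.first_den_eq hk]; simp
    | succ n ih =>
      obtain ⟨⟨u, v, hu, hv⟩, u', v', hu', hv'⟩ := ih
      obtain ⟨k, -, hk⟩ := exists_quot hρ (n + 1)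
      refine ⟨⟨u', v', hu', hv'⟩, k * u' + u, k * v' + v, ?_, ?_⟩
      · rw [GenContFract.nums_recurrence hk hu hu']; push_cast; ring
      · rw [GenContFract.dens_recurrence hk hv hv']; push_cast; ring
  exact (key n).1

lemma nums_mul_dens_sub (hρ : Irrational ρ) (n : ℕ) :
    (GenContFract.of ρ).nums n * (GenContFract.of ρ).dens (n + 1) -
      (GenContFract.of ρ).dens n * (GenContFract.of ρ).nums (n + 1) = (-1) ^ (n + 1) :=
  SimpContFract.determinant (s := SimpContFract.of ρ) (not_terminatedAt_of hρ n)

lemma one_le_dens (hρ : Irrational ρ) (n : ℕ) : 1 ≤ (GenContFract.of ρ).dens n := by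
  have := GenContFract.succ_nth_fib_le_of_nth_den (v := ρ) (n := n)
    (Or.inr (not_terminatedAt_of hρ _))
  have h1 : 1 ≤ Nat.fib (n + 1) := Nat.fib_pos.2 (by omega)
  exact le_trans (by exact_mod_cast h1) this

/-- The numerators and denominators of the convergents are given in lowest terms. -/
lemma nums_dens_eq (hρ : Irrational ρ) (n : ℕ) :
    (GenContFract.of ρ).nums n = (ρ.convergent n).num ∧ (GenContFract.of ρ).dens n = q ρ n := by
  obtain ⟨u, v, hu, hv⟩ := exists_int_nums_dens hρ n
  obtain ⟨u', v', hu', hv'⟩ := exists_int_nums_dens hρ (n + 1)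
  have hdet := nums_mul_dens_sub hρ n
  have h1 := one_le_dens hρ n
  rw [hv] at h1
  have hv1 : 1 ≤ v := by exact_mod_cast h1
  rw [hu, hv, hu', hv'] at hdet
  have hdet' : u * v' - v * u' = (-1) ^ (n + 1) := by exact_mod_cast hdet
  -- The determinant identity is a Bézout relation, so the recursively defined fraction is already
  -- in lowest terms.
  have hcop : IsCoprime u v := by
    refine ⟨(-1) ^ (n + 1) * v', -(-1) ^ (n + 1) * u', ?_⟩
    have h2 : ((-1 : ℤ) ^ (n + 1)) * (-1) ^ (n + 1) = 1 := by
      rw [← mul_pow]; norm_num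
    linear_combination (-1) ^ (n + 1) * hdet' + h2
  have hc := Real.convs_eq_convergent ρ n
  rw [GenContFract.conv_eq_num_div_den, hu, hv] at hc
  have hc' : (u : ℚ) / v = ρ.convergent n := by
    have : (((u : ℚ) / v : ℚ) : ℝ) = (ρ.convergent n : ℝ) := by push_cast; exact hc
    exact_mod_cast this
  have hn := Rat.num_div_eq_of_coprime (show 0 < v by omega) (Int.isCoprime_iff_nat_coprime.1 hcop)
  have hd := Rat.den_div_eq_of_coprime (show 0 < v by omega) (Int.isCoprime_iff_nat_coprime.1 hcop)
  rw [hc'] at hn hd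
  refine ⟨by rw [hu, hn], ?_⟩
  rw [hv, ← hd]
  simp [q]

/-- The parity of `n` decides the side of the return: right for even, left for odd. The bound `c <
1` keeps it within one turn. -/
lemma sub_convs_sign (hρ : Irrational ρ) (n : ℕ) :
    ∃ c : ℝ, 0 < c ∧ c < 1 ∧ (GenContFract.of ρ).dens n * ρ - (GenContFract.of ρ).nums n =
      (-1) ^ n * c := by
  have hstream : ∀ n, ∃ ifp, GenContFract.IntFractPair.stream ρ n = some ifp := by
    rintro (_ | n)
    · exact ⟨_, GenContFract.IntFractPair.stream_zero ρ⟩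
    · obtain ⟨k, -, hk⟩ := exists_quot hρ n
      obtain ⟨ifp, h, -⟩ :=
        GenContFract.IntFractPair.exists_succ_get?_stream_of_gcf_of_get?_eq_some hk
      exact ⟨ifp, h⟩
  obtain ⟨ifp, hifp⟩ := hstream n
  obtain ⟨ifp', hifp'⟩ := hstream (n + 1)
  have hne : ifp.fr ≠ 0 := fun h0 => by
    rw [GenContFract.IntFractPair.stream_eq_none_of_fr_eq_zero hifp h0] at hifp'
    cases hifp'
  have hpos : 0 < ifp.fr :=
    (GenContFract.IntFractPair.nth_stream_fr_nonneg hifp).lt_of_ne' hne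
  have hlt := GenContFract.IntFractPair.nth_stream_fr_lt_one hifp
  have hs := GenContFract.sub_convs_eq hifp
  simp only [if_neg hne] at hs
  have hB := one_le_dens hρ n
  have hp : 0 ≤ ((GenContFract.of ρ).contsAux n).b := GenContFract.zero_le_of_contsAux_b
  rw [← GenContFract.nth_cont_eq_succ_nth_contAux, ← GenContFract.den_eq_conts_b,
    GenContFract.conv_eq_num_div_den] at hs
  set B := (GenContFract.of ρ).dens n
  set p := ((GenContFract.of ρ).contsAux n).b
  have hinv : 1 < ifp.fr⁻¹ := (one_lt_inv₀ hpos).2 hlt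
  have hlarge : 1 < ifp.fr⁻¹ * B + p := by nlinarith
  refine ⟨(ifp.fr⁻¹ * B + p)⁻¹, by positivity, inv_lt_one_of_one_lt₀ hlarge, ?_⟩
  have hB0 : B ≠ 0 := by positivity
  have hl0 : ifp.fr⁻¹ * B + p ≠ 0 := by positivity
  have : B * ρ - (GenContFract.of ρ).nums n = B * (ρ - (GenContFract.of ρ).nums n / B) := by
    field_simp
  rw [this, hs]
  field_simp

/-- The convergents of the fractional part of an irrational number form a return sequence. -/
lemma exists_isReturnSequence {τ : ℝ} (hτ : Irrational (Int.fract τ))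
    (hb : BoundedType (Int.fract τ)) : ∃ (L : ℕ → ℤ) (A : ℕ → ℕ) (M : ℕ),
      IsReturnSequence τ (q (Int.fract τ)) L A ∧ ∀ n, A n ≤ M := by
  obtain ⟨M, -, hM⟩ := hb
  choose k hk1 hk using fun n => exists_quot hτ n
  set ρ := Int.fract τ with hρ
  have hnd := fun n => nums_dens_eq hτ n
  have hθ : ∀ n, (q ρ n : ℝ) * τ - (((ρ.convergent n).num + q ρ n * ⌊τ⌋ : ℤ) : ℝ) =
      (GenContFract.of ρ).dens n * ρ - (GenContFract.of ρ).nums n := by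
    intro n
    rw [(hnd n).1, (hnd n).2]
    push_cast
    have : ρ = τ - ⌊τ⌋ := rfl
    rw [this]; ring
  have hdet : ∀ n, (ρ.convergent n).num * (q ρ (n + 1) : ℤ) - q ρ n * (ρ.convergent (n + 1)).num =
      (-1) ^ (n + 1) := by
    intro n
    have := nums_mul_dens_sub hτ n
    rw [(hnd n).1, (hnd n).2, (hnd (n + 1)).1, (hnd (n + 1)).2] at this
    exact_mod_cast this
  have hneg : ∀ n, Odd n → (q ρ n : ℝ) * τ - (((ρ.convergent n).num + q ρ n * ⌊τ⌋ : ℤ) : ℝ) < 0 := by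
    intro n hn
    obtain ⟨c, h0, -, h⟩ := sub_convs_sign hτ n
    rw [hθ, h, hn.neg_one_pow]; linarith
  have hpos : ∀ n, Even n → 0 < (q ρ n : ℝ) * τ - (((ρ.convergent n).num + q ρ n * ⌊τ⌋ : ℤ) : ℝ) := by
    intro n hn
    obtain ⟨c, h0, -, h⟩ := sub_convs_sign hτ n
    rw [hθ, h, hn.neg_one_pow]; linarith
  -- The term with ⌊τ⌋ undoes the reduction of τ modulo 1. The stream starts with a₁ at index 0, and
  -- passing from `Q n` to `Q (n + 2)` uses a_(n+2), hence the index `n + 1`.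
  refine ⟨fun n => (ρ.convergent n).num + q ρ n * ⌊τ⌋, fun n => k (n + 1), ⌈M⌉₊,
    ⟨fun n => ?_, fun n => hk1 _, fun n => ?_, fun n => ?_, fun n hn => ?_, fun n hn => ?_,
      fun n => ?_⟩, fun n => ?_⟩
  · have := one_le_dens hτ n
    rw [(hnd n).2] at this
    exact_mod_cast this
  · have := GenContFract.dens_recurrence (hk (n + 1)) (hnd n).2 (hnd (n + 1)).2
    rw [(hnd (n + 2)).2] at this
    have h2 : (q ρ (n + 2) : ℝ) = ((q ρ n + k (n + 1) * q ρ (n + 1) : ℕ) : ℝ) := by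
      rw [this]; push_cast; ring
    exact_mod_cast h2
  · have h1 := GenContFract.dens_recurrence (hk (n + 1)) (hnd n).2 (hnd (n + 1)).2
    have h2 := GenContFract.nums_recurrence (hk (n + 1)) (hnd n).1 (hnd (n + 1)).1
    rw [(hnd (n + 2)).2] at h1
    rw [(hnd (n + 2)).1] at h2
    have h3 : (((ρ.convergent (n + 2)).num + q ρ (n + 2) * ⌊τ⌋ : ℤ) : ℝ) =
        (((ρ.convergent n).num + q ρ n * ⌊τ⌋ + k (n + 1) *
          ((ρ.convergent (n + 1)).num + q ρ (n + 1) * ⌊τ⌋) : ℤ) : ℝ) := by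
      push_cast; rw [h1, h2]; ring
    exact_mod_cast h3
  · have hodd : Odd n := by
      by_contra hc
      exact absurd hn (hpos n (Nat.not_odd_iff_even.1 hc)).not_gt
    refine ⟨hn, hpos _ hodd.add_one, ?_⟩
    have h1 := hdet n
    rw [hodd.add_one.neg_one_pow] at h1
    linear_combination h1
  · have heven : Even n := by
      by_contra hc
      exact absurd hn (hneg n (Nat.not_even_iff_odd.1 hc)).not_gt
    refine ⟨hneg _ heven.add_one, hn, ?_⟩
    have h1 := hdet n
    rw [heven.add_one.neg_one_pow] at h1
    linear_combination -h1
  · obtain ⟨c, h0, h1, h⟩ := sub_convs_sign hτ n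
    rw [hθ, h, abs_mul, abs_pow, abs_neg, abs_one, one_pow, one_mul, abs_of_pos h0]
    exact h1
  · have : (k (n + 1) : ℝ) < M := hM _ _ (GenContFract.partDen_eq_s_b (hk (n + 1)))
    exact_mod_cast (this.le.trans (Nat.le_ceil M))

end ContinuedFraction

/-! ### Log-concave derivatives and cross-ratios -/

section CrossRatio

variable {φ φ' : ℝ → ℝ} {u v : ℝ}

/-- The mean slope is an average of (φ'(t) + φ'(x + y - t)) / 2; by the mean value theorem it is
attained at some ξ, and the arithmetic–geometric mean inequality together with `hlog` bounds it
below by the geometric mean of the end slopes. -/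
lemma sub_sq_mul_deriv_le (hφ : ∀ x ∈ Ioo u v, HasDerivAt φ (φ' x) x)
    (hlog : ∀ x y t, u < x → x < t → t < y → y < v → φ' x * φ' y ≤ φ' t * φ' (x + y - t))
    {x y : ℝ} (hx : u < x) (hxy : x < y) (hy : y < v) :
    φ' x * φ' y * (y - x) ^ 2 ≤ (φ y - φ x) ^ 2 := by
  have hd : ∀ t ∈ Icc x y, HasDerivAt (fun t => φ t - φ (x + y - t))
      (φ' t + φ' (x + y - t)) t := by
    intro t ht
    have h1 := hφ t ⟨by linarith [ht.1], by linarith [ht.2]⟩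
    have h2 := (hφ (x + y - t) ⟨by linarith [ht.2], by linarith [ht.1]⟩).comp_const_sub (x + y) t
    exact (h1.fun_sub h2).congr_deriv (by ring)
  obtain ⟨ξ, hξ, he⟩ := exists_hasDerivAt_eq_slope (fun t => φ t - φ (x + y - t))
    (fun t => φ' t + φ' (x + y - t)) hxy (fun t ht => (hd t ht).continuousAt.continuousWithinAt)
    (fun t ht => hd t (Ioo_subset_Icc_self ht))
  have hm := hlog x y ξ hx hξ.1 hξ.2 hy
  rw [eq_div_iff (by linarith), add_sub_cancel_right, add_sub_cancel_left] at he
  have he' : φ y - φ x = (φ' ξ + φ' (x + y - ξ)) / 2 * (y - x) := by linarith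
  rw [he', mul_pow]
  refine mul_le_mul_of_nonneg_right ?_ (sq_nonneg _)
  nlinarith [sq_nonneg (φ' ξ - φ' (x + y - ξ))]

lemma sub_pos_of_hasDerivAt (hφ : ∀ x ∈ Ioo u v, HasDerivAt φ (φ' x) x)
    (hpos : ∀ x ∈ Ioo u v, 0 < φ' x) {x y : ℝ} (hx : u < x) (hxy : x < y) (hy : y < v) :
    0 < φ y - φ x := by
  have hsub : Icc x y ⊆ Ioo u v := fun t ht => ⟨by linarith [ht.1], by linarith [ht.2]⟩
  obtain ⟨ξ, hξ, he⟩ := exists_hasDerivAt_eq_slope φ φ' hxy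
    (fun t ht => (hφ t (hsub ht)).continuousAt.continuousWithinAt)
    (fun t ht => hφ t (hsub (Ioo_subset_Icc_self ht)))
  rw [eq_div_iff (by linarith)] at he
  rw [← he]
  exact mul_pos (hpos ξ (hsub (Ioo_subset_Icc_self hξ))) (by linarith)

/-- The function is ∂/∂x of H(x, y) = log((φ y - φ x) / (y - x)); the previous inequality says that
the mixed derivative of H is nonpositive. -/
lemma antitoneOn_inv_sub (hφ : ∀ x ∈ Ioo u v, HasDerivAt φ (φ' x) x)
    (hpos : ∀ x ∈ Ioo u v, 0 < φ' x)
    (hlog : ∀ x y t, u < x → x < t → t < y → y < v → φ' x * φ' y ≤ φ' t * φ' (x + y - t))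
    {x : ℝ} (hx : u < x) :
    AntitoneOn (fun y => (y - x)⁻¹ - φ' x * (φ y - φ x)⁻¹) (Ioo x v) := by
  have hd : ∀ y ∈ Ioo x v, HasDerivAt (fun y => (y - x)⁻¹ - φ' x * (φ y - φ x)⁻¹)
      (-1 / (y - x) ^ 2 - φ' x * (-φ' y / (φ y - φ x) ^ 2)) y := by
    intro y hy
    have h1 := ((hasDerivAt_id y).sub_const x).fun_inv (by simp [sub_ne_zero, hy.1.ne'])
    have h2 := ((hφ y ⟨hx.trans hy.1, hy.2⟩).sub_const (φ x)).fun_inv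
      (sub_pos_of_hasDerivAt hφ hpos hx hy.1 hy.2).ne'
    exact h1.sub (h2.const_mul (φ' x))
  refine antitoneOn_of_deriv_nonpos (convex_Ioo x v)
    (fun y hy => (hd y hy).continuousAt.continuousWithinAt) ?_ ?_
  · rw [interior_Ioo]
    exact fun y hy => (hd y hy).differentiableAt.differentiableWithinAt
  · rw [interior_Ioo]
    intro y hy
    rw [(hd y hy).deriv]
    have h1 := sub_sq_mul_deriv_le hφ hlog hx hy.1 hy.2
    have h2 := sub_pos_of_hasDerivAt hφ hpos hx hy.1 hy.2
    have h3 : 0 < y - x := by linarith [hy.1]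
    have : φ' x * φ' y / (φ y - φ x) ^ 2 ≤ 1 / (y - x) ^ 2 := by
      rw [div_le_div_iff₀ (by positivity) (by positivity)]
      linarith
    have e : -1 / (y - x) ^ 2 - φ' x * (-φ' y / (φ y - φ x) ^ 2) =
        φ' x * φ' y / (φ y - φ x) ^ 2 - 1 / (y - x) ^ 2 := by ring
    linarith

/-- A map whose derivative is log-concave in the midpoint sense expands cross-ratios. -/
lemma crossRatio_le_of_mul_le (hφ : ∀ x ∈ Ioo u v, HasDerivAt φ (φ' x) x)
    (hpos : ∀ x ∈ Ioo u v, 0 < φ' x)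
    (hlog : ∀ x y t, u < x → x < t → t < y → y < v → φ' x * φ' y ≤ φ' t * φ' (x + y - t))
    {t₁ t₂ t₃ t₄ : ℝ} (h1 : u < t₁) (h12 : t₁ < t₂) (h23 : t₂ < t₃) (h34 : t₃ < t₄)
    (h4 : t₄ < v) : crossRatio t₁ t₂ t₃ t₄ ≤ crossRatio (φ t₁) (φ t₂) (φ t₃) (φ t₄) := by
  have hp : ∀ {x y : ℝ}, u < x → x < y → y < v → 0 < φ y - φ x := fun a b c =>
    sub_pos_of_hasDerivAt hφ hpos a b c
  have hd : ∀ x ∈ Ioo u t₃, HasDerivAt (fun x => Real.log (φ t₄ - φ x) - Real.log (t₄ - x) -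
      (Real.log (φ t₃ - φ x) - Real.log (t₃ - x))) (-φ' x / (φ t₄ - φ x) - -1 / (t₄ - x) -
      (-φ' x / (φ t₃ - φ x) - -1 / (t₃ - x))) x := by
    intro x hx
    have hx' := hφ x ⟨hx.1, by linarith [hx.2]⟩
    have k : ∀ y, x < y → y < v → HasDerivAt (fun x => Real.log (φ y - φ x) - Real.log (y - x))
        (-φ' x / (φ y - φ x) - -1 / (y - x)) x := fun y hxy hy =>
      ((hx'.const_sub (φ y)).log (hp hx.1 hxy hy).ne').sub
        (((hasDerivAt_id x).const_sub y).log (by simp [sub_ne_zero, hxy.ne']))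
    exact (k t₄ (by linarith [hx.2]) h4).sub (k t₃ hx.2 (by linarith))
  have hanti : AntitoneOn (fun x => Real.log (φ t₄ - φ x) - Real.log (t₄ - x) -
      (Real.log (φ t₃ - φ x) - Real.log (t₃ - x))) (Ioo u t₃) := by
    refine antitoneOn_of_deriv_nonpos (convex_Ioo u t₃)
      (fun y hy => (hd y hy).continuousAt.continuousWithinAt) ?_ ?_
    · rw [interior_Ioo]
      exact fun y hy => (hd y hy).differentiableAt.differentiableWithinAt
    · rw [interior_Ioo]
      intro x hx
      rw [(hd x hx).deriv]
      have := antitoneOn_inv_sub hφ hpos hlog hx.1 (show t₃ ∈ Ioo x v from ⟨hx.2, by linarith⟩)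
        (show t₄ ∈ Ioo x v from ⟨by linarith [hx.2], h4⟩) h34.le
      simp only at this
      have e : ∀ y, -φ' x / (φ y - φ x) - -1 / (y - x) = (y - x)⁻¹ - φ' x * (φ y - φ x)⁻¹ :=
        fun y => by ring
      rw [e, e]
      linarith
  have hle := hanti (show t₁ ∈ Ioo u t₃ from ⟨h1, by linarith⟩)
    (show t₂ ∈ Ioo u t₃ from ⟨by linarith, h23⟩) h12.le
  simp only at hle
  have p21 := hp h1 h12 (by linarith)
  have p31 := hp h1 (h12.trans h23) (by linarith)
  have p41 := hp h1 (h12.trans (h23.trans h34)) h4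
  have p32 := hp (h1.trans h12) h23 (by linarith)
  have p42 := hp (h1.trans h12) (h23.trans h34) h4
  have p43 := hp (h1.trans (h12.trans h23)) h34 h4
  have q21 : 0 < t₂ - t₁ := by linarith
  have q31 : 0 < t₃ - t₁ := by linarith
  have q41 : 0 < t₄ - t₁ := by linarith
  have q32 : 0 < t₃ - t₂ := by linarith
  have q42 : 0 < t₄ - t₂ := by linarith
  have q43 : 0 < t₄ - t₃ := by linarith
  -- The four-point form of the sign of the mixed derivative: H(t₂, t₄) - H(t₂, t₃) ≤ H(t₁, t₄) -
  -- H(t₁, t₃).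
  have hprod : (φ t₄ - φ t₂) * (t₄ - t₁) * ((φ t₃ - φ t₁) * (t₃ - t₂)) ≤
      (φ t₄ - φ t₁) * (t₄ - t₂) * ((φ t₃ - φ t₂) * (t₃ - t₁)) := by
    rw [← Real.log_le_log_iff (by positivity) (by positivity), Real.log_mul (by positivity)
      (by positivity), Real.log_mul (by positivity) (by positivity), Real.log_mul (by positivity)
      (by positivity), Real.log_mul (by positivity) (by positivity), Real.log_mul (by positivity)
      (by positivity), Real.log_mul (by positivity) (by positivity)]
    linarith
  unfold crossRatio
  rw [div_le_div_iff₀ (by positivity) (by positivity)]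
  -- This rests on (t₃ - t₁)(t₄ - t₂) = (t₂ - t₁)(t₄ - t₃) + (t₃ - t₂)(t₄ - t₁), for the points and
  -- for their images.
  linear_combination hprod

/-- Cross-ratios are almost expanded if the derivative is the product of a log-concave function and
the exponential of a Lipschitz function. -/
lemma crossRatio_le_exp_mul (hφ : ∀ x ∈ Ioo u v, HasDerivAt φ (φ' x) x)
    (hpos : ∀ x ∈ Ioo u v, 0 < φ' x)
    (hlog : ∀ x y t, u < x → x < t → t < y → y < v → φ' x * φ' y ≤ φ' t * φ' (x + y - t))
    {g G : ℝ → ℝ} {K : ℝ} (hK : 0 ≤ K)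
    (hg : ∀ x ∈ Ioo u v, HasDerivAt g (Real.exp (G x) * φ' x) x)
    (hG : ∀ x ∈ Ioo u v, ∀ y ∈ Ioo u v, |G x - G y| ≤ K * |x - y|)
    {t₁ t₂ t₃ t₄ : ℝ} (h1 : u < t₁) (h12 : t₁ < t₂) (h23 : t₂ < t₃) (h34 : t₃ < t₄)
    (h4 : t₄ < v) : crossRatio t₁ t₂ t₃ t₄ ≤
      Real.exp (2 * K * (t₄ - t₁)) * crossRatio (g t₁) (g t₂) (g t₃) (g t₄) := by
  -- Cauchy's mean value theorem: each length under `g` is exp(G ξ) times the length under φ, so the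
  -- two cross-ratios differ by two differences of values of `G`.
  have hmv : ∀ x y, t₁ ≤ x → x < y → y ≤ t₄ → ∃ ξ ∈ Icc t₁ t₄, g y - g x =
      Real.exp (G ξ) * (φ y - φ x) := by
    intro x y hx hxy hy
    have hsub : Icc x y ⊆ Ioo u v := fun t ht => ⟨by linarith [ht.1], by linarith [ht.2]⟩
    obtain ⟨ξ, hξ, he⟩ := exists_ratio_hasDerivAt_eq_ratio_slope g (fun x => Real.exp (G x) * φ' x)
      hxy (fun t ht => (hg t (hsub ht)).continuousAt.continuousWithinAt)
      (fun t ht => hg t (hsub (Ioo_subset_Icc_self ht))) φ φ'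
      (fun t ht => (hφ t (hsub ht)).continuousAt.continuousWithinAt)
      (fun t ht => hφ t (hsub (Ioo_subset_Icc_self ht)))
    refine ⟨ξ, ⟨by linarith [hξ.1], by linarith [hξ.2]⟩, ?_⟩
    have := (hpos ξ (hsub (Ioo_subset_Icc_self hξ))).ne'
    apply mul_right_cancel₀ this
    linear_combination -he
  obtain ⟨ξ₁, m₁, e₁⟩ := hmv t₁ t₂ le_rfl h12 (by linarith)
  obtain ⟨ξ₂, m₂, e₂⟩ := hmv t₂ t₃ (by linarith) h23 (by linarith)
  obtain ⟨ξ₃, m₃, e₃⟩ := hmv t₃ t₄ (by linarith) h34 le_rfl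
  obtain ⟨ξ₄, m₄, e₄⟩ := hmv t₁ t₄ le_rfl (by linarith) le_rfl
  have hGd : ∀ {ξ ζ : ℝ}, ξ ∈ Icc t₁ t₄ → ζ ∈ Icc t₁ t₄ → G ξ - G ζ ≤ K * (t₄ - t₁) := by
    intro ξ ζ hξ hζ
    have h := hG ξ ⟨by linarith [hξ.1], by linarith [hξ.2]⟩ ζ
      ⟨by linarith [hζ.1], by linarith [hζ.2]⟩
    refine (le_abs_self _).trans (h.trans (mul_le_mul_of_nonneg_left ?_ hK))
    rw [abs_le]
    constructor <;> linarith [hξ.1, hξ.2, hζ.1, hζ.2]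
  refine (crossRatio_le_of_mul_le hφ hpos hlog h1 h12 h23 h34 h4).trans ?_
  have hcr : crossRatio (g t₁) (g t₂) (g t₃) (g t₄) = Real.exp (G ξ₂ + G ξ₄ - G ξ₁ - G ξ₃) *
      crossRatio (φ t₁) (φ t₂) (φ t₃) (φ t₄) := by
    unfold crossRatio
    rw [e₁, e₂, e₃, e₄, Real.exp_sub, Real.exp_sub, Real.exp_add]
    rw [div_div, div_mul_div_comm]
    congr 1 <;> ring
  rw [hcr, ← mul_assoc, ← Real.exp_add]
  have hn : 0 ≤ crossRatio (φ t₁) (φ t₂) (φ t₃) (φ t₄) := by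
    have hp : ∀ {x y : ℝ}, u < x → x < y → y < v → φ x < φ y := fun a b c =>
      sub_pos.1 (sub_pos_of_hasDerivAt hφ hpos a b c)
    exact crossRatio_nonneg (hp h1 h12 (by linarith)) (hp (by linarith) h23 (by linarith))
      (hp (by linarith) h34 h4)
  refine le_mul_of_one_le_left hn (Real.one_le_exp ?_)
  linarith [hGd m₁ m₂, hGd m₃ m₄]

end CrossRatio

/-! ### Regularity at a power-law end -/

section PowerEnd

variable {F : ℝ → ℝ} {a b ℓ : ℝ}

/-- To the right of `b` the map is a `C²` diffeomorphism of the power `(x - b) ^ ℓ`. -/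
def HasPowerEnd (F : ℝ → ℝ) (b ℓ : ℝ) : Prop :=
  ∃ h : ℝ → ℝ, ContDiffAt ℝ 2 h 0 ∧ deriv h 0 ≠ 0 ∧ ∀ᶠ x in 𝓝[≥] b, F x = h ((x - b) ^ ℓ)

/-- The logarithm of the ratio of the derivative of `F` and `((x - b) * (a + 1 - x)) ^ (ℓ - 1)`. -/
def logDistortion (F : ℝ → ℝ) (a b ℓ x : ℝ) : ℝ :=
  Real.log (deriv F x) - (ℓ - 1) * (Real.log (x - b) + Real.log (a + 1 - x))

/-- If ℓ < 1, then s ↦ s^(1/ℓ) is differentiable at 0, so h(s) = F(b + s^(1/ℓ)) would have one-sided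
derivative 0 there, contrary to h being a diffeomorphism. -/
lemma HasPowerEnd.one_le (hF : HasPowerEnd F b ℓ) (hℓ : 0 < ℓ) (hd : HasDerivAt F 0 b) :
    1 ≤ ℓ := by
  obtain ⟨h, hh, h0, he⟩ := hF
  by_contra! hlt
  have hinv : 1 ≤ ℓ⁻¹ := (one_le_inv₀ hℓ).2 hlt.le
  have hpow : HasDerivAt (fun s : ℝ => b + s ^ ℓ⁻¹) (ℓ⁻¹ * 0 ^ (ℓ⁻¹ - 1)) 0 :=
    (Real.hasDerivAt_rpow_const (Or.inr hinv)).const_add b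
  have hz : b + (0 : ℝ) ^ ℓ⁻¹ = b := by rw [Real.zero_rpow (by positivity), add_zero]
  have hcomp : HasDerivAt (fun s : ℝ => F (b + s ^ ℓ⁻¹)) 0 0 := by
    have hd' : HasDerivAt F 0 (b + (0 : ℝ) ^ ℓ⁻¹) := by rwa [hz]
    have := hd'.comp (0 : ℝ) hpow
    rwa [zero_mul] at this
  have htend : Tendsto (fun s : ℝ => b + s ^ ℓ⁻¹) (𝓝[≥] 0) (𝓝[≥] b) := by
    refine tendsto_nhdsWithin_iff.2 ⟨?_, ?_⟩
    · have := hpow.continuousAt.tendsto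
      simp only [hz] at this
      exact this.mono_left nhdsWithin_le_nhds
    · filter_upwards [self_mem_nhdsWithin] with s hs
      have := Real.rpow_nonneg hs ℓ⁻¹
      simp only [mem_Ici]; linarith
  have heq : h =ᶠ[𝓝[≥] 0] fun s : ℝ => F (b + s ^ ℓ⁻¹) := by
    filter_upwards [htend.eventually he, self_mem_nhdsWithin] with s hs hs0
    rw [hs, add_sub_cancel_left, Real.rpow_inv_rpow hs0 hℓ.ne']
  have h1 : HasDerivWithinAt h 0 (Ici 0) 0 :=
    hcomp.hasDerivWithinAt.congr_of_eventuallyEq heq (heq.self_of_nhdsWithin self_mem_Ici)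
  have h2 : HasDerivWithinAt h (deriv h 0) (Ici 0) 0 :=
    (hh.differentiableAt two_ne_zero).hasDerivAt.hasDerivWithinAt
  exact h0 ((uniqueDiffWithinAt_Ici (0 : ℝ)).eq_deriv _ h2 h1)

lemma contDiffAt_deriv {h : ℝ → ℝ} {x : ℝ} {m n : ℕ∞} (hh : ContDiffAt ℝ n h x)
    (hmn : m + 1 ≤ n) : ContDiffAt ℝ m (deriv h) x := by
  have := (hh.fderiv_right (m := m) (by exact_mod_cast hmn)).clm_apply
    (contDiffAt_const (c := (1 : ℝ)))
  simpa only [fderiv_apply_one_eq_deriv] using this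

lemma eventually_nhds_of_nhdsGT {p : ℝ → Prop} (h : ∀ᶠ x in 𝓝[>] b, p x) :
    ∀ᶠ y in 𝓝[>] b, ∀ᶠ x in 𝓝 y, p x := by
  filter_upwards [eventually_eventually_nhdsWithin.2 h, self_mem_nhdsWithin] with y hy hyb
  rwa [isOpen_Ioi.nhdsWithin_eq hyb] at hy

/-- Near `b` the singular term (ℓ - 1) log(x - b) cancels. What is left involves x only through
h'((x - b)^ℓ) and a smooth term, and is C¹ up to `b` because h is C² and ℓ ≥ 1. -/
lemma HasPowerEnd.exists_abs_deriv_le (hF : HasPowerEnd F b ℓ) (hℓ : 1 ≤ ℓ) (hab : b < a + 1) :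
    ∃ K : ℝ, ∀ᶠ x in 𝓝[>] b, |deriv (logDistortion F a b ℓ) x| ≤ K := by
  obtain ⟨h, hh, h0, he⟩ := hF
  have hpow : ContDiffAt ℝ (1 : ℕ) (fun x : ℝ => (x - b) ^ ℓ) b :=
    (contDiffAt_id.sub contDiffAt_const).rpow_const_of_le (by exact_mod_cast hℓ)
  have hz : (b - b) ^ ℓ = 0 := by rw [sub_self, Real.zero_rpow (by positivity)]
  have htend : Tendsto (fun x : ℝ => (x - b) ^ ℓ) (𝓝[>] b) (𝓝 0) := by
    have := hpow.continuousAt.tendsto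
    rw [hz] at this
    exact this.mono_left nhdsWithin_le_nhds
  have hd1 : ContDiffAt ℝ (1 : ℕ∞) (deriv h) 0 :=
    contDiffAt_deriv (n := 2) (by exact_mod_cast hh) (by norm_num)
  set G₁ : ℝ → ℝ := fun x => Real.log (deriv h ((x - b) ^ ℓ)) + Real.log ℓ -
    (ℓ - 1) * Real.log (a + 1 - x) with hG₁
  have hGc : ContDiffAt ℝ (1 : ℕ∞) G₁ b := by
    refine ContDiffAt.sub (ContDiffAt.add (ContDiffAt.log ?_ ?_) contDiffAt_const)
      (contDiffAt_const.mul (ContDiffAt.log (contDiffAt_const.sub contDiffAt_id) ?_))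
    · refine ContDiffAt.comp (g := deriv h) b ?_ (by exact_mod_cast hpow)
      rwa [hz]
    · rwa [hz]
    · exact (sub_pos.2 hab).ne'
  have hcont : ContinuousAt (deriv G₁) b := (contDiffAt_deriv (m := 0) hGc (by norm_num)).continuousAt
  have hderiv : ∀ᶠ x in 𝓝[>] b, deriv F x = deriv h ((x - b) ^ ℓ) * (ℓ * (x - b) ^ (ℓ - 1)) := by
    filter_upwards [eventually_nhds_of_nhdsGT (he.filter_mono (nhdsWithin_mono _ Ioi_subset_Ici_self)),
      htend.eventually (hh.eventually (by simp)), self_mem_nhdsWithin] with x hx hx' hxb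
    have hxb' : x - b ≠ 0 := sub_ne_zero.2 (ne_of_gt hxb)
    have h1 : HasDerivAt (fun x : ℝ => (x - b) ^ ℓ) (ℓ * (x - b) ^ (ℓ - 1)) x := by
      have := ((hasDerivAt_id x).sub_const b).rpow_const (p := ℓ) (Or.inl hxb')
      simpa using this
    rw [EventuallyEq.deriv_eq hx]
    exact ((hx'.differentiableAt two_ne_zero).hasDerivAt.comp x h1).deriv
  have heq : ∀ᶠ x in 𝓝[>] b, logDistortion F a b ℓ x = G₁ x := by
    filter_upwards [hderiv, htend.eventually (hd1.continuousAt.eventually_ne h0),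
      self_mem_nhdsWithin] with x hx hx0 hxb
    have hxb' : 0 < x - b := sub_pos.2 hxb
    have hp : 0 < (x - b) ^ (ℓ - 1) := Real.rpow_pos_of_pos hxb' _
    rw [logDistortion, hx, Real.log_mul hx0 (by positivity), Real.log_mul (by positivity) hp.ne',
      Real.log_rpow hxb', hG₁]
    ring
  refine ⟨|deriv G₁ b| + 1, ?_⟩
  filter_upwards [eventually_nhds_of_nhdsGT heq, nhdsWithin_le_nhds
    (hcont.abs.eventually_lt_const (lt_add_one _))] with x hx hx'
  rw [EventuallyEq.deriv_eq hx]
  exact hx'.le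

end PowerEnd

/-! ### From power-law ends to cross-ratio and end bounds -/

/-- The analytic properties of a lift with a flat piece and power-law ends. -/
structure IsPowerLift (F : CircleDeg1Lift) (a b ℓ : ℝ) : Prop extends IsFlatLift F a b where
  contDiff : ContDiffOn ℝ 2 F (Ioo b (a + 1))
  deriv_pos : ∀ x ∈ Ioo b (a + 1), 0 < deriv F x
  one_le : 1 ≤ ℓ
  right : HasPowerEnd F b ℓ
  left : HasPowerEnd (reflect F) (-a) ℓ

section PowerLift

variable {F : CircleDeg1Lift} {a b ℓ : ℝ}

lemma reflect_eq (F : CircleDeg1Lift) : ⇑(reflect F) = fun x => 1 - F (1 - x) := by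
  ext x
  rw [reflect_apply, show 1 - x = -x + 1 by ring, CircleDeg1Lift.map_add_one]
  ring

lemma deriv_reflect (F : CircleDeg1Lift) (x : ℝ) : deriv (reflect F) x = deriv F (1 - x) := by
  rw [reflect_eq, deriv_const_sub, deriv_comp_const_sub, neg_neg]

lemma IsPowerLift.reflect (h : IsPowerLift F a b ℓ) : IsPowerLift (reflect F) (-b) (-a) ℓ where
  toIsFlatLift := h.toIsFlatLift.reflect
  contDiff := by
    rw [reflect_eq]
    refine contDiffOn_const.sub (h.contDiff.comp (contDiffOn_const.sub contDiffOn_id) ?_)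
    exact fun x hx => ⟨show b < 1 - x by linarith [hx.2], show 1 - x < a + 1 by linarith [hx.1]⟩
  deriv_pos x hx := by
    rw [deriv_reflect]
    exact h.deriv_pos _ ⟨by linarith [hx.2], by linarith [hx.1]⟩
  one_le := h.one_le
  right := h.left
  left := by simpa using h.right

lemma logDistortion_reflect (F : CircleDeg1Lift) (a b ℓ : ℝ) :
    logDistortion (reflect F) (-b) (-a) ℓ = fun x => logDistortion F a b ℓ (1 - x) := by
  ext x
  rw [logDistortion, logDistortion, deriv_reflect, show x - -a = a + 1 - (1 - x) by ring,
    show -b + 1 - x = 1 - x - b by ring]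
  ring

lemma IsPowerLift.contDiffOn_logDistortion (h : IsPowerLift F a b ℓ) :
    ContDiffOn ℝ 1 (logDistortion F a b ℓ) (Ioo b (a + 1)) := by
  have h1 : ContDiffOn ℝ 1 (deriv F) (Ioo b (a + 1)) :=
    ((contDiffOn_succ_iff_deriv_of_isOpen (n := 1) isOpen_Ioo).1 h.contDiff).2.2
  refine (h1.log fun x hx => (h.deriv_pos x hx).ne').sub (contDiffOn_const.mul
    (((contDiffOn_id.sub contDiffOn_const).log fun x hx => ?_).add
      ((contDiffOn_const.sub contDiffOn_id).log fun x hx => ?_)))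
  · exact (sub_pos.2 hx.1).ne'
  · exact (sub_pos.2 hx.2).ne'

/-- The derivative is bounded near `b`, near `a + 1` by reflection, and on the compact interval in
between by continuity. -/
lemma IsPowerLift.exists_logDistortion_lipschitz (h : IsPowerLift F a b ℓ) :
    ∃ K : ℝ, 0 ≤ K ∧ ∀ x ∈ Ioo b (a + 1), ∀ y ∈ Ioo b (a + 1),
      |logDistortion F a b ℓ x - logDistortion F a b ℓ y| ≤ K * |x - y| := by
  set G := logDistortion F a b ℓ with hG
  have hc := h.contDiffOn_logDistortion
  obtain ⟨hdiff, -, hdc⟩ := (contDiffOn_succ_iff_deriv_of_isOpen (n := 0) isOpen_Ioo).1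
    (by simpa using hc)
  obtain ⟨K₁, hK₁⟩ := h.right.exists_abs_deriv_le h.one_le h.lt_add_one
  obtain ⟨K₂, hK₂⟩ := h.left.exists_abs_deriv_le (a := -b) h.one_le (by linarith [h.lt_add_one])
  obtain ⟨c₁, hc₁, hK₁⟩ := mem_nhdsGT_iff_exists_Ioo_subset.1 hK₁
  obtain ⟨c₂, hc₂, hK₂⟩ := mem_nhdsGT_iff_exists_Ioo_subset.1 hK₂
  simp only [mem_Ioi] at hc₁ hc₂
  set d := min ((b + c₁) / 2) ((b + a + 1) / 2)
  set e := max (1 - (-a + c₂) / 2) ((b + a + 1) / 2)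
  have hd1 : d ≤ (b + c₁) / 2 := min_le_left _ _
  have he1 : 1 - (-a + c₂) / 2 ≤ e := le_max_left _ _
  have hdb : b < d := lt_min (by linarith) (by linarith [h.lt_add_one])
  have hea : e < a + 1 := max_lt (by linarith) (by linarith [h.lt_add_one])
  obtain ⟨K₃, hK₃⟩ := (isCompact_Icc (a := d) (b := e)).exists_bound_of_continuousOn
    (hdc.continuousOn.mono fun x hx => ⟨hdb.trans_le hx.1, hx.2.trans_lt hea⟩)
  have hbound : ∀ x ∈ Ioo b (a + 1), ‖deriv G x‖ ≤ max (max K₁ K₂) K₃ := by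
    intro x hx
    rcases lt_or_ge x d with h1 | h1
    · exact (hK₁ ⟨hx.1, by linarith⟩).trans ((le_max_left _ _).trans (le_max_left _ _))
    rcases lt_or_ge e x with h2 | h2
    · have := hK₂ (show 1 - x ∈ Ioo (-a) c₂ from ⟨by linarith [hx.2], by linarith⟩)
      simp only [mem_ofPred_eq] at this
      rw [logDistortion_reflect, deriv_comp_const_sub, abs_neg, sub_sub_cancel] at this
      exact this.trans ((le_max_right _ _).trans (le_max_left _ _))
    · exact (hK₃ x ⟨h1, h2⟩).trans (le_max_right _ _)
  have hne : (b + a + 1) / 2 ∈ Ioo b (a + 1) :=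
    ⟨by linarith [h.lt_add_one], by linarith [h.lt_add_one]⟩
  refine ⟨_, (norm_nonneg _).trans (hbound _ hne), fun x hx y hy => ?_⟩
  exact (convex_Ioo b (a + 1)).norm_image_sub_le_of_norm_deriv_le
    (fun z hz => (hdiff z hz).differentiableAt (isOpen_Ioo.mem_nhds hz)) hbound hy hx

end PowerLift

section PowerLift

variable {F : CircleDeg1Lift} {a b ℓ : ℝ}

lemma IsPowerLift.hasDerivAt (h : IsPowerLift F a b ℓ) {x : ℝ} (hx : x ∈ Ioo b (a + 1)) :
    HasDerivAt F (Real.exp (logDistortion F a b ℓ x) * ((x - b) * (a + 1 - x)) ^ (ℓ - 1)) x := by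
  have hd : HasDerivAt F (deriv F x) x :=
    (((h.contDiff.differentiableOn two_ne_zero) x hx).differentiableAt
      (isOpen_Ioo.mem_nhds hx)).hasDerivAt
  have h1 : 0 < x - b := sub_pos.2 hx.1
  have h2 : 0 < a + 1 - x := sub_pos.2 hx.2
  convert hd using 1
  rw [logDistortion, ← Real.log_mul h1.ne' h2.ne', mul_comm (ℓ - 1), Real.exp_sub,
    Real.exp_log (h.deriv_pos x hx), ← Real.rpow_def_of_pos (mul_pos h1 h2)]
  exact div_mul_cancel₀ _ (Real.rpow_pos_of_pos (mul_pos h1 h2) _).ne'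

lemma rpow_mul_rpow_le {b c p x y t : ℝ} (hp : 0 ≤ p) (hx : b < x) (hxt : x < t) (hty : t < y)
    (hy : y < c) : ((x - b) * (c - x)) ^ p * ((y - b) * (c - y)) ^ p ≤
      ((t - b) * (c - t)) ^ p * ((x + y - t - b) * (c - (x + y - t))) ^ p := by
  have h1 : 0 < x - b := by linarith
  have h2 : 0 < c - x := by linarith
  have h3 : 0 < y - b := by linarith
  have h4 : 0 < c - y := by linarith
  have h5 : 0 < t - b := by linarith
  have h6 : 0 < c - t := by linarith
  have h7 : 0 < x + y - t - b := by linarith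
  have h8 : 0 < c - (x + y - t) := by linarith
  have h9 : 0 ≤ (t - x) * (y - t) := mul_nonneg (by linarith) (by linarith)
  have e1 : (x - b) * (y - b) ≤ (t - b) * (x + y - t - b) := by linear_combination h9
  have e2 : (c - x) * (c - y) ≤ (c - t) * (c - (x + y - t)) := by linear_combination h9
  rw [← Real.mul_rpow (by positivity) (by positivity), ← Real.mul_rpow (by positivity)
    (by positivity)]
  refine Real.rpow_le_rpow (by positivity) ?_ hp
  calc _ = ((x - b) * (y - b)) * ((c - x) * (c - y)) := by ring
    _ ≤ ((t - b) * (x + y - t - b)) * ((c - t) * (c - (x + y - t))) :=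
      mul_le_mul e1 e2 (by positivity) (by positivity)
    _ = _ := by ring

/-- The comparison map φ is a primitive of the log-concave factor, and `logDistortion` is the
Lipschitz exponent. -/
lemma IsPowerLift.exists_hasCrossBound (h : IsPowerLift F a b ℓ) :
    ∃ C, HasCrossBound F a b C := by
  obtain ⟨K, hK, hG⟩ := h.exists_logDistortion_lipschitz
  have hp : 0 ≤ ℓ - 1 := sub_nonneg.2 h.one_le
  have hc : Continuous fun x => ((x - b) * (a + 1 - x)) ^ (ℓ - 1) :=
    ((continuous_id.sub continuous_const).mul (continuous_const.sub continuous_id)).rpow_const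
      fun _ => Or.inr hp
  refine ⟨2 * K, by positivity, fun t₁ t₂ t₃ t₄ h1 h12 h23 h34 h4 => ?_⟩
  exact crossRatio_le_exp_mul (φ := fun x => ∫ t in b..x, ((t - b) * (a + 1 - t)) ^ (ℓ - 1))
    (fun x _ => (hc.integral_hasStrictDerivAt b x).hasDerivAt)
    (fun x hx => Real.rpow_pos_of_pos (mul_pos (sub_pos.2 hx.1) (sub_pos.2 hx.2)) _)
    (fun x y t hx hxt hty hy => rpow_mul_rpow_le hp hx hxt hty hy) hK
    (fun x hx => h.hasDerivAt hx) hG h1 h12 h23 h34 h4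

lemma IsPowerLift.exists_deriv_bounds (h : IsPowerLift F a b ℓ) :
    ∃ c C : ℝ, 0 < c ∧ 0 < C ∧ (∀ x ∈ Ioo b (a + 1), deriv F x ≤ C * (x - b) ^ (ℓ - 1)) ∧
      ∀ x ∈ Ioo b ((b + a + 1) / 2), c * (x - b) ^ (ℓ - 1) ≤ deriv F x := by
  obtain ⟨K, hK, hG⟩ := h.exists_logDistortion_lipschitz
  have hp : 0 ≤ ℓ - 1 := sub_nonneg.2 h.one_le
  have hm : (b + a + 1) / 2 ∈ Ioo b (a + 1) :=
    ⟨by linarith [h.lt_add_one], by linarith [h.lt_add_one]⟩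
  set m := (b + a + 1) / 2
  have hlt := h.lt
  have hGm : ∀ x ∈ Ioo b (a + 1), logDistortion F a b ℓ m - K ≤ logDistortion F a b ℓ x ∧
      logDistortion F a b ℓ x ≤ logDistortion F a b ℓ m + K := by
    intro x hx
    have h1 := hG x hx m hm
    have h2 : |x - m| ≤ 1 := by
      rw [abs_le]; constructor <;> linarith [hx.1, hx.2, hm.1, hm.2]
    have h3 := abs_le.1 (h1.trans (mul_le_of_le_one_right hK h2))
    constructor <;> linarith [h3.1, h3.2]
  refine ⟨Real.exp (logDistortion F a b ℓ m - K) * (a + 1 - m) ^ (ℓ - 1),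
    Real.exp (logDistortion F a b ℓ m + K),
    mul_pos (Real.exp_pos _) (Real.rpow_pos_of_pos (sub_pos.2 hm.2) _), Real.exp_pos _,
    fun x hx => ?_, fun x hx => ?_⟩
  · have h1 : 0 < x - b := sub_pos.2 hx.1
    have h2 : 0 < a + 1 - x := sub_pos.2 hx.2
    rw [(h.hasDerivAt hx).deriv]
    refine mul_le_mul (Real.exp_le_exp.2 (hGm x hx).2) (Real.rpow_le_rpow (by positivity) ?_ hp)
      (by positivity) (Real.exp_pos _).le
    exact mul_le_of_le_one_right h1.le (by linarith)
  · have hx' : x ∈ Ioo b (a + 1) := ⟨hx.1, hx.2.trans hm.2⟩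
    have h1 : 0 < x - b := sub_pos.2 hx.1
    have h2 : 0 < a + 1 - x := sub_pos.2 hx'.2
    have h3 : 0 < a + 1 - m := sub_pos.2 hm.2
    rw [(h.hasDerivAt hx').deriv, mul_assoc]
    refine mul_le_mul (Real.exp_le_exp.2 (hGm x hx').1) ?_ (by positivity) (Real.exp_pos _).le
    rw [← Real.mul_rpow h3.le h1.le]
    refine Real.rpow_le_rpow (by positivity) ?_ hp
    rw [mul_comm]
    exact mul_le_mul_of_nonneg_left (by linarith [hx.2]) h1.le

lemma IsPowerLift.hasEndBounds (h : IsPowerLift F a b ℓ) : HasEndBounds F a b := by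
  obtain ⟨c, C, hc, hC, hup, hlow⟩ := h.exists_deriv_bounds
  have hp : 0 ≤ ℓ - 1 := sub_nonneg.2 h.one_le
  have hlt := h.lt
  have hm : (b + a + 1) / 2 ∈ Ioo b (a + 1) :=
    ⟨by linarith [h.lt_add_one], by linarith [h.lt_add_one]⟩
  set m := (b + a + 1) / 2
  have hcont := h.continuous
  have hmv : ∀ {x y : ℝ}, b ≤ x → x < y → y ≤ a + 1 →
      ∃ ξ ∈ Ioo x y, F y - F x = deriv F ξ * (y - x) := by
    intro x y hx hxy hy
    obtain ⟨ξ, hξ, he⟩ := exists_deriv_eq_slope F hxy hcont.continuousOn fun z hz =>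
      (h.hasDerivAt ⟨by linarith [hz.1], by linarith [hz.2]⟩).differentiableAt.differentiableWithinAt
    exact ⟨ξ, hξ, by rw [he, div_mul_cancel₀ _ (by linarith)]⟩
  have hupper : ∀ {x y : ℝ}, b ≤ x → x < y → y ≤ a + 1 →
      F y - F x ≤ C * (y - b) ^ (ℓ - 1) * (y - x) := by
    intro x y hx hxy hy
    obtain ⟨ξ, hξ, he⟩ := hmv hx hxy hy
    rw [he]
    refine mul_le_mul_of_nonneg_right ((hup ξ ⟨by linarith [hξ.1], by linarith [hξ.2]⟩).trans ?_)
      (by linarith)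
    exact mul_le_mul_of_nonneg_left (Real.rpow_le_rpow (by linarith [hξ.1]) (by linarith [hξ.2]) hp)
      hC.le
  have hlower : ∀ {x y : ℝ}, b ≤ x → x < y → y ≤ m →
      c * (x - b) ^ (ℓ - 1) * (y - x) ≤ F y - F x := by
    intro x y hx hxy hy
    obtain ⟨ξ, hξ, he⟩ := hmv hx hxy (hy.trans hm.2.le)
    rw [he]
    refine mul_le_mul_of_nonneg_right (le_trans ?_ (hlow ξ ⟨by linarith [hξ.1], by linarith [hξ.2]⟩))
      (by linarith)
    exact mul_le_mul_of_nonneg_left (Real.rpow_le_rpow (by linarith) (by linarith [hξ.1]) hp)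
      hc.le
  obtain ⟨c', hc', hfar⟩ : ∃ c', 0 < c' ∧ ∀ x ∈ Ioo b (a + 1),
      c' * (x - b) ^ (ℓ - 1) * (x - b) ≤ F x - F b := by
    have hd : 0 < F m - F b :=
      sub_pos.2 (h.strictMonoOn ⟨le_rfl, h.lt_add_one.le⟩ ⟨hm.1.le, hm.2.le⟩ hm.1)
    -- Up to the midpoint `m` the derivative bound is used on the right half of `[b, x]`, whence the
    -- factors 1/2; beyond `m`, F x - F b ≥ F m - F b and the powers are at most 1.
    refine ⟨min (c * (1 / 2) ^ (ℓ - 1) * (1 / 2)) (F m - F b), lt_min (by positivity) hd,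
      fun x hx => ?_⟩
    have hx0 : 0 < x - b := sub_pos.2 hx.1
    have hpow : 0 < (x - b) ^ (ℓ - 1) := Real.rpow_pos_of_pos hx0 _
    rcases le_or_gt x m with hxm | hxm
    · have h1 := hlower (x := (b + x) / 2) (y := x) (by linarith) (by linarith) hxm
      have h2 : F b ≤ F ((b + x) / 2) := F.monotone (by linarith)
      rw [show (b + x) / 2 - b = 1 / 2 * (x - b) by ring,
        Real.mul_rpow (by norm_num) hx0.le] at h1
      calc _ ≤ c * (1 / 2) ^ (ℓ - 1) * (1 / 2) * (x - b) ^ (ℓ - 1) * (x - b) := by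
            gcongr; exact min_le_left _ _
        _ = c * ((1 / 2) ^ (ℓ - 1) * (x - b) ^ (ℓ - 1)) * (x - (b + x) / 2) := by ring
        _ ≤ _ := by linarith
    · have h1 : (x - b) ^ (ℓ - 1) ≤ 1 := Real.rpow_le_one hx0.le (by linarith [hx.2]) hp
      have h2 : F m ≤ F x := F.monotone hxm.le
      calc _ ≤ (F m - F b) * 1 * 1 := by
            gcongr
            · exact min_le_right _ _
            · linarith [hx.2]
        _ ≤ _ := by linarith
  refine ⟨fun C₀ => ?_, c / C, by positivity, m - b, sub_pos.2 hm.1, fun x y hx hxy hy => ?_⟩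
  · have hC₀ : 0 < max C₀ 1 := lt_max_of_lt_right one_pos
    refine ⟨C * (max C₀ 1) ^ (ℓ - 1) / c', by positivity, fun x y hx hxy hy hxy' => ?_⟩
    have hx0 : 0 < x - b := sub_pos.2 hx
    have hy0 : y - b ≤ max C₀ 1 * (x - b) :=
      hxy'.trans (mul_le_mul_of_nonneg_right (le_max_left _ _) hx0.le)
    have h1 := hupper hx.le hxy hy.le
    have h2 := hfar x ⟨hx, hxy.trans hy⟩
    have h3 : (y - b) ^ (ℓ - 1) ≤ (max C₀ 1) ^ (ℓ - 1) * (x - b) ^ (ℓ - 1) := by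
      rw [← Real.mul_rpow hC₀.le hx0.le]
      exact Real.rpow_le_rpow (by linarith) hy0 hp
    have h4 : 0 ≤ y - x := by linarith
    calc (F y - F x) * (x - b) ≤ C * (y - b) ^ (ℓ - 1) * (y - x) * (x - b) := by gcongr
      _ ≤ C * ((max C₀ 1) ^ (ℓ - 1) * (x - b) ^ (ℓ - 1)) * (y - x) * (x - b) := by gcongr
      _ = C * (max C₀ 1) ^ (ℓ - 1) / c' * ((y - x) * (c' * (x - b) ^ (ℓ - 1) * (x - b))) := by
        field_simp
      _ ≤ _ := by gcongr
  · have hx0 : 0 < x - b := sub_pos.2 hx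
    have h1 := hlower hx.le hxy (by linarith)
    have h2 := hupper le_rfl hx (by linarith [hm.2])
    have h4 : 0 ≤ y - x := by linarith
    calc c / C * ((y - x) * (F x - F b))
        ≤ c / C * ((y - x) * (C * (x - b) ^ (ℓ - 1) * (x - b))) := by gcongr
      _ = c * (x - b) ^ (ℓ - 1) * (y - x) * (x - b) := by field_simp
      _ ≤ _ := by gcongr

lemma IsPowerLift.exists_isRegularLift (h : IsPowerLift F a b ℓ) :
    ∃ C, IsRegularLift F a b C := by
  obtain ⟨C, hC⟩ := h.exists_hasCrossBound
  exact ⟨C, h.toIsFlatLift, hC, h.hasEndBounds, h.reflect.hasEndBounds⟩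

end PowerLift

/-! ### Verification for maps with a flat interval -/

lemma hasPowerEnd_of_openPartialHomeomorph {F : ℝ → ℝ} {b ℓ : ℝ} (h : OpenPartialHomeomorph ℝ ℝ)
    (h0 : (0 : ℝ) ∈ h.source) (hh : ContDiffOn ℝ 2 h h.source)
    (hs : ContDiffOn ℝ 2 h.symm h.target) (he : ∀ᶠ x in 𝓝[≥] b, F x = h ((x - b) ^ ℓ)) :
    HasPowerEnd F b ℓ := by
  have h1 : ContDiffAt ℝ 2 h 0 := hh.contDiffAt (h.open_source.mem_nhds h0)
  have h2 : ContDiffAt ℝ 2 h.symm (h 0) :=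
    hs.contDiffAt (h.open_target.mem_nhds (h.map_source h0))
  refine ⟨h, h1, fun hz => ?_, he⟩
  have hd := (h2.differentiableAt two_ne_zero).hasDerivAt.comp (0 : ℝ)
    (h1.differentiableAt two_ne_zero).hasDerivAt
  have hid : (h.symm ∘ h) =ᶠ[𝓝 0] id := by
    filter_upwards [h.open_source.mem_nhds h0] with x hx using h.left_inv hx
  have := (hd.congr_of_eventuallyEq hid.symm).unique (hasDerivAt_id (0 : ℝ))
  rw [hz, mul_zero] at this
  exact zero_ne_one this

lemma IsFlatMap.isPowerLift {f : UnitAddCircle → UnitAddCircle} {F : CircleDeg1Lift} {a b ℓ : ℝ}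
    (hf : IsFlatMap f F a b ℓ) (hρ : Irrational (rotationNumber F)) : IsPowerLift F a b ℓ where
  continuous := hf.continuous_lift
  lt := hf.lt
  lt_add_one := hf.lt_add_one
  map_eq x hx := by
    refine (convex_Icc a b).is_const_of_fderivWithin_eq_zero (𝕜 := ℝ) (f := F)
      (fun y hy => (hf.flat y hy).differentiableAt.differentiableWithinAt) (fun y hy => ?_) hx
      ⟨hf.lt.le, le_rfl⟩
    have h1 := (hf.flat y hy).hasFDerivAt.hasFDerivWithinAt (s := Icc a b)
    rw [h1.fderivWithin ((uniqueDiffOn_Icc hf.lt) y hy)]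
    simp
  strictMonoOn := by
    refine strictMonoOn_of_deriv_pos (convex_Icc b (a + 1)) hf.continuous_lift.continuousOn ?_
    rw [interior_Icc]
    exact hf.deriv_pos
  irrational := by
    have := hρ.add_intCast ⌊F.translationNumber⌋
    rwa [rotationNumber, Int.fract_add_floor] at this
  contDiff := hf.contDiff_outside
  deriv_pos := hf.deriv_pos
  one_le := by
    obtain ⟨h, h0, hh, hs, he⟩ := hf.right_end
    exact (hasPowerEnd_of_openPartialHomeomorph h h0 hh hs he).one_le hf.exponent_pos
      (hf.flat b ⟨hf.lt.le, le_rfl⟩)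
  right := by
    obtain ⟨h, h0, hh, hs, he⟩ := hf.right_end
    exact hasPowerEnd_of_openPartialHomeomorph h h0 hh hs he
  left := by
    obtain ⟨h, h0, hh, hs, he⟩ := hf.left_end
    obtain ⟨g, hg, hg0, hg'⟩ : HasPowerEnd (fun x => F (-x)) (-a) ℓ := by
      refine hasPowerEnd_of_openPartialHomeomorph h h0 hh hs ?_
      have ht : Tendsto (fun x : ℝ => -x) (𝓝[≥] (-a)) (𝓝[≤] a) := by
        refine tendsto_nhdsWithin_iff.2 ⟨?_, ?_⟩
        · have := (continuous_neg (G := ℝ)).tendsto (-a)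
          rw [neg_neg] at this
          exact this.mono_left nhdsWithin_le_nhds
        · filter_upwards [self_mem_nhdsWithin] with x hx
          exact neg_le.1 (mem_Ici.1 hx)
      filter_upwards [ht.eventually he] with x hx
      rw [hx, sub_neg_eq_add, sub_neg_eq_add, add_comm]
    refine ⟨fun x => -g x, hg.neg, ?_, ?_⟩
    · rw [deriv.fun_neg]
      exact neg_ne_zero.2 hg0
    · filter_upwards [hg'] with x hx
      rw [reflect_apply, hx]

/-! ### Bounded geometry on the circle and on the line -/

lemma dist_coe_le (x y : ℝ) : dist (x : UnitAddCircle) (y : UnitAddCircle) ≤ |x - y| := by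
  rw [dist_eq_norm, ← AddCircle.coe_sub, UnitAddCircle.norm_eq]
  simpa using round_le (x - y) 0

lemma exists_dist_coe_eq (x y : ℝ) :
    ∃ l : ℤ, dist (x : UnitAddCircle) (y : UnitAddCircle) = |x - y - l| :=
  ⟨round (x - y), by rw [dist_eq_norm, ← AddCircle.coe_sub, UnitAddCircle.norm_eq]⟩

lemma infDist_flatInterval_le {a b x : ℝ} (hab : a < b) {z : ℝ} (hz : z ∈ Icc a b) :
    Metric.infDist (x : UnitAddCircle) (flatInterval a b) ≤ |x - z| := by
  rw [← Metric.infDist_closure]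
  refine (Metric.infDist_le_dist_of_mem (y := (z : UnitAddCircle)) ?_).trans (dist_coe_le x z)
  refine image_closure_subset_closure_image (AddCircle.continuous_mk' 1) ⟨z, ?_, rfl⟩
  rwa [closure_Ioo hab.ne]

/-- The distance on the circle to the flat interval is attained on one of its two sides. -/
lemma le_infDist_flatInterval {a b x d : ℝ} (hab : a < b) (hd : d ≤ max (a - x) (x - b))
    (h1 : d ≤ x + 1 - b) (h2 : d ≤ a + 1 - x) :
    d ≤ Metric.infDist (x : UnitAddCircle) (flatInterval a b) := by
  have hne : (flatInterval a b).Nonempty := (nonempty_Ioo.2 hab).image _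
  refine (Metric.le_infDist hne).2 ?_
  rintro _ ⟨z, hz, rfl⟩
  obtain ⟨l, hl⟩ := exists_dist_coe_eq x z
  change d ≤ dist (x : UnitAddCircle) (z : UnitAddCircle)
  rw [hl]
  rcases lt_trichotomy l 0 with h | rfl | h
  · have : (l : ℝ) ≤ -1 := by exact_mod_cast (show l ≤ -1 by omega)
    exact le_trans (by linarith [hz.2]) (le_abs_self _)
  · rcases le_max_iff.1 hd with h | h
    · refine le_trans ?_ (neg_le_abs _)
      push_cast; linarith [hz.1]
    · refine le_trans ?_ (le_abs_self _)
      push_cast; linarith [hz.2]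
  · have : (1 : ℝ) ≤ l := by exact_mod_cast (show 1 ≤ l by omega)
    exact le_trans (by linarith [hz.1]) (neg_le_abs _)

/-- On the circle the distance might be realised the other way round. Returns of one parity approach
the flat interval monotonically, so that other distance stays above its value at the first two
indices. -/
lemma IsReturnSequence.exists_distance_other_side {F : CircleDeg1Lift} {a b : ℝ} {Q : ℕ → ℕ}
    {L : ℕ → ℤ} {A : ℕ → ℕ} (hF : IsFlatLift F a b)
    (hT : IsReturnSequence F.translationNumber Q L A) : ∃ d, 0 < d ∧ d ≤ 1 ∧
      ∀ n, d ≤ F^[Q n] b - L n + 1 - b ∧ d ≤ a + 1 - (F^[Q n] b - L n) := by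
  set e : ℕ → ℝ := fun n => min (F^[Q n] b - L n + 1 - b) (a + 1 - (F^[Q n] b - L n))
  have hpos : ∀ n, 0 < e n := by
    intro n
    have h := abs_lt.1 (hT.abs_lt_one n)
    have h1 := lt_iterate_right (F := F) (b := b) (k := Q n) (l := L n - 1)
      (by push_cast; linarith [h.1])
    have h2 := hF.iterate_lt_left (hT.one_le n) (l := L n + 1) (by push_cast; linarith [h.2])
    push_cast at h1 h2
    exact lt_min (by linarith) (by linarith)
  have hlt := hF.lt
  have hstep : ∀ n, e n ≤ e (n + 2) := by
    intro n
    have hA : (0 : ℝ) < A n := by exact_mod_cast hT.one_le_quot n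
    have hr := hT.rotation_add_two n
    rcases lt_or_gt_of_ne (rotation_ne_zero hF.irrational (hT.one_le n) (L n)) with hn | hn
    · have h1 := mul_pos hA (hT.pos_of_neg hn)
      have h2 := iterate_sub_lt_iterate_sub (F := F) (j := Q n) (l := L n) (k := Q (n + 2))
        (m := L (n + 2)) (by linarith) b
      have h3 := hF.iterate_lt_left (hT.one_le n) hn
      have h4 := hF.iterate_lt_left (hT.one_le (n + 2)) (hT.neg_of_pos (hT.pos_of_neg hn))
      have h5 : e n ≤ F^[Q n] b - L n + 1 - b := min_le_left _ _
      exact le_min (by linarith) (by linarith)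
    · have h1 := mul_pos hA (neg_pos.2 (hT.neg_of_pos hn))
      have h2 := iterate_sub_lt_iterate_sub (F := F) (j := Q (n + 2)) (l := L (n + 2)) (k := Q n)
        (m := L n) (by linarith) b
      have h3 := lt_iterate_right (b := b) hn
      have h4 := lt_iterate_right (b := b) (hT.pos_of_neg (hT.neg_of_pos hn))
      have h5 : e n ≤ a + 1 - (F^[Q n] b - L n) := min_le_right _ _
      exact le_min (by linarith) (by linarith)
  have hmin : ∀ n, min (e 0) (e 1) ≤ e n ∧ min (e 0) (e 1) ≤ e (n + 1) := by
    intro n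
    induction n with
    | zero => exact ⟨min_le_left _ _, min_le_right _ _⟩
    | succ n ih => exact ⟨ih.2, ih.1.trans (hstep n)⟩
  refine ⟨min (min (e 0) (e 1)) 1, lt_min (lt_min (hpos 0) (hpos 1)) one_pos, min_le_right _ _,
    fun n => ?_⟩
  have := (min_le_left (min (e 0) (e 1)) 1).trans (hmin n).1
  exact ⟨this.trans (min_le_left _ _), this.trans (min_le_right _ _)⟩

/-- Bounded geometry in terms of the distances of the closest returns on the line. -/
lemma BoundedGeometry.exists_returnGap_le {f : UnitAddCircle → UnitAddCircle} {F : CircleDeg1Lift}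
    {a b : ℝ} {L : ℕ → ℤ} {A : ℕ → ℕ} (hBG : BoundedGeometry f F a b)
    (hf : ∀ x : ℝ, f (x : UnitAddCircle) = ((F x : ℝ) : UnitAddCircle)) (hF : IsFlatLift F a b)
    (hT : IsReturnSequence F.translationNumber (q (rotationNumber F)) L A) :
    ∃ C₀, 0 < C₀ ∧ ∀ n, returnGap F a b (q (rotationNumber F)) L n 0 ≤
      C₀ * returnGap F a b (q (rotationNumber F)) L (n + 2) 0 := by
  obtain ⟨c, hc, hcn⟩ := hBG
  obtain ⟨d, hd, hd1, hdn⟩ := hT.exists_distance_other_side hF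
  set Q := q (rotationNumber F)
  have hgap : ∀ n, returnGap F a b Q L n 0 = gap F a b (Q n) (L n) := fun n => by
    rw [returnGap, midTime_zero, midShift_zero]
  have hdist : ∀ n, imageDist f a b (Q n) =
      Metric.infDist ((F^[Q n] b - L n : ℝ) : UnitAddCircle) (flatInterval a b) := by
    intro n
    have : f^[Q n] (a : UnitAddCircle) = ((F^[Q n] b - L n : ℝ) : UnitAddCircle) := by
      rw [iterate_coe hf, hF.iterate_eq (hT.one_le n), coe_eq_coe_iff]
      exact ⟨-L n, by push_cast; ring⟩
    rw [imageDist, this]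
  have hle : ∀ n, imageDist f a b (Q n) ≤ gap F a b (Q n) (L n) := by
    intro n
    have hpos := hF.gap_pos (hT.one_le n) (L n)
    rw [hdist]
    rcases lt_or_gt_of_ne (rotation_ne_zero hF.irrational (hT.one_le n) (L n)) with hn | hn
    · have h1 := hF.gap_left (hT.one_le n) hn
      refine (infDist_flatInterval_le hF.lt (left_mem_Icc.2 hF.lt.le)).trans ?_
      rw [abs_of_neg (by linarith)]; linarith
    · have h1 := hF.gap_right (k := Q n) hn
      refine (infDist_flatInterval_le hF.lt (right_mem_Icc.2 hF.lt.le)).trans ?_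
      rw [abs_of_pos (by linarith)]; linarith
  -- The circle distance is at least min(gap, d), and gap ≤ 1, d ≤ 1 make this at least d · gap.
  have hge : ∀ n, d * gap F a b (Q n) (L n) ≤ imageDist f a b (Q n) := by
    intro n
    have hpos := hF.gap_pos (hT.one_le n) (L n)
    have hlt := hF.lt
    have hone : gap F a b (Q n) (L n) ≤ 1 :=
      max_le (by linarith [(hdn n).1]) (by linarith [(hdn n).2])
    have h1 : d * gap F a b (Q n) (L n) ≤ d := mul_le_of_le_one_right hd.le hone
    rw [hdist]
    exact le_infDist_flatInterval hlt (mul_le_of_le_one_left hpos.le hd1) (h1.trans (hdn n).1)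
      (h1.trans (hdn n).2)
  refine ⟨1 / (c * d), by positivity, fun n => ?_⟩
  have hpos : 0 < imageDist f a b (Q n) :=
    (mul_pos hd (hF.gap_pos (hT.one_le n) (L n))).trans_le (hge n)
  have h1 := (le_div_iff₀ hpos).1 (hcn n)
  rw [hgap, hgap, one_div, inv_mul_eq_div, le_div_iff₀ (by positivity)]
  calc _ = c * (d * gap F a b (Q n) (L n)) := by ring
    _ ≤ c * imageDist f a b (Q n) := mul_le_mul_of_nonneg_left (hge n) hc.le
    _ ≤ _ := h1.trans (hle _)

lemma IsReturnSequence.le_of_add_two_le {τ : ℝ} {Q : ℕ → ℕ} {L : ℕ → ℤ} {A : ℕ → ℕ}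
    (h : IsReturnSequence τ Q L A) {m n : ℕ} (hmn : m + 2 ≤ n) : Q m ≤ Q n := by
  induction n, hmn using Nat.le_induction with
  | base => rw [h.add_two]; exact Nat.le_add_right _ _
  | succ n hn ih =>
    obtain ⟨k, rfl⟩ := Nat.exists_eq_add_of_le' (show 1 ≤ n by omega)
    exact ih.trans (h.lt_succ k).le

end FlatCircle

end

theorem mainTheorem4 (f : UnitAddCircle → UnitAddCircle) (F : CircleDeg1Lift) (a b ℓ : ℝ)
    (hf : FlatCircle.IsClassB f F a b ℓ) (Q : ℝ) (hQ : 0 < Q) :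
    ∃ N : ℕ, ∀ n : ℕ, N ≤ n → ∀ i : ℕ, FlatCircle.q (FlatCircle.rotationNumber F) n ≤ i →
      FlatCircle.preim f a b i ∈ FlatCircle.partitionPreimages f F a b n →
      ¬ FlatCircle.IsQuasiSymmetricOn Q f^[i] (FlatCircle.preim f a b i) := by
  obtain ⟨C, hR⟩ := (hf.toIsFlatMap.isPowerLift hf.irrational).exists_isRegularLift
  have hF := hR.toIsFlatLift
  obtain ⟨L, A, M, hT, hM⟩ := FlatCircle.exists_isReturnSequence hf.irrational hf.boundedType
  obtain ⟨C₀, hC₀, hBG⟩ := hf.boundedGeometry.exists_returnGap_le hf.lift hF hT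
  obtain ⟨K, hK⟩ := FlatCircle.exists_portion hR hC₀ hT hM hBG
  obtain ⟨k, hk⟩ := pow_unbounded_of_one_lt K (one_lt_two : (1 : ℝ) < 2)
  have hpow : 0 < (1 + Q) ^ k := by positivity
  -- A portion of at least 2^(-k) of the preimage would have to cover at least (b - a) / (1 + Q)^k;
  -- the image is chosen shorter than that.
  obtain ⟨n₀, hn₀⟩ := hK ((b - a) / (1 + Q) ^ k) (div_pos (sub_pos.2 hf.lt) hpow)
  -- The shift by two is where `le_of_add_two_le` gives monotonicity of the denominators.
  refine ⟨n₀ + 2, fun n hn i hi _ => ?_⟩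
  obtain ⟨α, α', β, D, l, hD, hDlt, hαβ, hα, hβ, h⟩ := hn₀ i ((hT.le_of_add_two_le hn).trans hi)
  exact FlatCircle.not_isQuasiSymmetricOn hf.lift hF hQ hk.le hD
    (by rwa [lt_div_iff₀' hpow] at hDlt) hαβ hα hβ h
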